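/- Let $X\subset\mathbb C^N$ be an analytic variety (that is, a subset which near each of its points is the common zero set of finitely many holomorphic functions) of pure dimension $n$, and let $dV_X$ be the volume measure on $X$: the Riemannian volume measure of the regular part $\operatorname{Reg}X$ with respect to the metric induced from $\mathbb C^N$, extended by zero to the singular part. Let $D\subset\subset X$ be a relatively compact, relatively open subset, let $i\in\{1,\dots,N\}$, and let $0\le\gamma<2n$ and $0\le\alpha<1$ be real numbers such that $\gamma=0$ or $\alpha<\gamma$ (this is automatic if $\gamma$ is an integer, or if $\gamma\ge1$). Put $$\tilde k_\gamma(\zeta,z):=\frac{\|z\|^\gamma}{\|\zeta\|^\gamma}\,\frac{\overline{\zeta_i-z_i}}{\|\zeta-z\|^{2n}}.$$ Then for every $f\in L^\infty(D)=L^\infty(D,dV_X)$ and every $z\in D$ the function $\zeta\mapsto f(\zeta)\tilde k_\gamma(\zeta,z)$ is integrable on $D$ with respect to $dV_X$, and $$f\mapsto \mathbf T(f)(z):=\int_D f(\zeta)\,\tilde k_\gamma(\zeta,z)\,dV_X(\zeta)$$ defines a compact continuous linear operator $\mathbf T:L^\infty(D)\to C^\alpha(D)$. Here $C^\alpha(D)$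 is the space of bounded continuous functions $g:D\to\mathbb C$ for which the norm $$\sup_{z\in D}|g(z)|+\sup_{z\ne w\in D}\frac{|g(z)-g(w)|}{\|z-w\|^{\alpha}}$$ is finite, with this norm (for $\alpha=0$: the bounded continuous functions, with a norm equivalent to the supremum norm). -/

import Mathlib

open MeasureTheory
open scoped ENNReal NNReal BoundedContinuousFunction

namespace AnalyticVariety

/-- `ℂ^N` with its standard Hermitian metric. -/
abbrev CSpace (N : ℕ) : Type := EuclideanSpace ℂ (Fin N)

/-- `X ⊆ ℂ^N` is an analytic variety: near each of its points it is the common zero set of finitely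
many holomorphic functions. (Closed analytic subsets of `ℂ^N`, or of an open subset of `ℂ^N`, are
exactly of this kind.) -/
def IsAnalyticVariety {N : ℕ} (X : Set (CSpace N)) : Prop :=
  ∀ x ∈ X, ∃ V : Set (CSpace N), IsOpen V ∧ x ∈ V ∧
    ∃ (m : ℕ) (h : CSpace N → Fin m → ℂ),
      AnalyticOnNhd ℂ h V ∧ X ∩ V = {y | y ∈ V ∧ h y = 0}

/-- The regular points of `X` of dimension `n`: the points near which `X` is an `n`-dimensional
complex submanifold of `ℂ^N`, i.e. the zero set of a holomorphic submersion to `ℂ^(N-n)`. -/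
def regularPoints {N : ℕ} (n : ℕ) (X : Set (CSpace N)) : Set (CSpace N) :=
  {x | x ∈ X ∧ ∃ V : Set (CSpace N), IsOpen V ∧ x ∈ V ∧
    ∃ k : ℕ, n + k = N ∧ ∃ h : CSpace N → Fin k → ℂ,
      AnalyticOnNhd ℂ h V ∧ (∀ y ∈ V, Function.Surjective (fderiv ℂ h y)) ∧
      X ∩ V = {y | y ∈ V ∧ h y = 0}}

/-- `X` is an analytic variety of pure dimension `n`: its regular points of dimension `n` are dense
in it. -/
structure IsPureDim {N : ℕ} (n : ℕ) (X : Set (CSpace N)) : Prop where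
  isAnalyticVariety : IsAnalyticVariety X
  subset_closure : X ⊆ closure (regularPoints n X)

/-- The volume measure `dV_X` of the `n`-dimensional variety `X`: the Riemannian volume of the
complex manifold `Reg X ⊆ ℂ^N` with the induced metric, that is, its `2n`-dimensional Hausdorff
measure (normalized to be Lebesgue measure on `2n`-dimensional Euclidean space), extended to be zero
on `Sing X`. -/
noncomputable def volX {N : ℕ} (n : ℕ) (X : Set (CSpace N)) : Measure (CSpace N) :=
  (Measure.euclideanHausdorffMeasure (2 * n)).restrict (regularPoints n X)

/-- `D` is a relatively compact (relatively) open subset of `X`. -/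
structure IsRelCompactOpen {N : ℕ} (X D : Set (CSpace N)) : Prop where
  isOpen : ∃ O : Set (CSpace N), IsOpen O ∧ D = X ∩ O
  isCompact_closure : IsCompact (closure D)
  closure_subset : closure D ⊆ X

/-- The kernel `(‖z‖^γ / ‖ζ‖^γ) * conj (ζ_i - z_i) / ‖ζ - z‖^(2n)`. -/
noncomputable def kernel {N : ℕ} (n : ℕ) (γ : ℝ) (i : Fin N) (ζ z : CSpace N) : ℂ :=
  ((‖z‖ ^ γ / ‖ζ‖ ^ γ : ℝ) : ℂ) * (starRingEnd ℂ (ζ i - z i) / ((‖ζ - z‖ ^ (2 * n) : ℝ) : ℂ))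

/-- The bounded continuous functions `S → ℂ` that are Hölder continuous with exponent `α`,
as a vector space. -/
def holderSubmodule (α : ℝ≥0) (S : Type) [MetricSpace S] : Submodule ℂ (S →ᵇ ℂ) where
  carrier := {f | MemHolder α f}
  add_mem' {f g} hf hg := by
    change MemHolder α ((f : S → ℂ) + (g : S → ℂ))
    exact MemHolder.add hf hg
  zero_mem' := by
    change MemHolder α (0 : S → ℂ)
    exact memHolder_zero
  smul_mem' c f hf := by
    change MemHolder α (c • (f : S → ℂ))
    exact MemHolder.smul (c := c) hf

/-- The Hölder space `C^α(S)`, which carries the norm `sup |f| + sup |f x - f y| / dist x y ^ α`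
(and not just the supremum norm). For `α = 0` these are the bounded continuous functions, with a
norm equivalent to the supremum norm. -/
def HolderSpace (α : ℝ≥0) (S : Type) [MetricSpace S] : Type := holderSubmodule α S

namespace HolderSpace

variable {α : ℝ≥0} {S : Type} [MetricSpace S]

noncomputable instance : AddCommGroup (HolderSpace α S) :=
  inferInstanceAs (AddCommGroup (holderSubmodule α S))

noncomputable instance : Module ℂ (HolderSpace α S) :=
  inferInstanceAs (Module ℂ (holderSubmodule α S))

/-- The bounded continuous function underlying an element of the Hölder space. -/
def toBCF (f : HolderSpace α S) : S →ᵇ ℂ := f.1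

noncomputable instance : CoeFun (HolderSpace α S) (fun _ => S → ℂ) := ⟨fun f => f.toBCF⟩

noncomputable instance : Norm (HolderSpace α S) :=
  ⟨fun f => ‖f.toBCF‖ + (nnHolderNorm α (f.toBCF : S → ℂ) : ℝ)⟩

theorem norm_def (f : HolderSpace α S) :
    ‖f‖ = ‖f.toBCF‖ + (nnHolderNorm α (f.toBCF : S → ℂ) : ℝ) := rfl

theorem memHolder (f : HolderSpace α S) : MemHolder α (f.toBCF : S → ℂ) := f.2

theorem core : NormedSpace.Core ℂ (HolderSpace α S) where
  norm_nonneg f := by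
    rw [norm_def]
    positivity
  norm_smul c f := by
    have h : nnHolderNorm α ((c • f).toBCF : S → ℂ)
        = ‖c‖₊ * nnHolderNorm α (f.toBCF : S → ℂ) := f.memHolder.nnHolderNorm_smul c
    have h' : ‖(c • f).toBCF‖ = ‖c‖ * ‖f.toBCF‖ := norm_smul c f.toBCF
    rw [norm_def, norm_def, h, h', NNReal.coe_mul, coe_nnnorm, mul_add]
  norm_triangle f g := by
    have h : nnHolderNorm α ((f + g).toBCF : S → ℂ)
        ≤ nnHolderNorm α (f.toBCF : S → ℂ) + nnHolderNorm α (g.toBCF : S → ℂ) :=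
      f.memHolder.nnHolderNorm_add_le g.memHolder
    have h' : ‖(f + g).toBCF‖ ≤ ‖f.toBCF‖ + ‖g.toBCF‖ := norm_add_le f.toBCF g.toBCF
    have h'' := NNReal.coe_le_coe.2 h
    rw [NNReal.coe_add] at h''
    rw [norm_def, norm_def, norm_def]
    linarith
  norm_eq_zero_iff f := by
    constructor
    · intro h
      rw [norm_def] at h
      have h1 : ‖f.toBCF‖ = 0 := by
        have := norm_nonneg f.toBCF
        have := (nnHolderNorm α (f.toBCF : S → ℂ)).coe_nonneg
        linarith
      exact Subtype.ext (norm_eq_zero.1 h1)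
    · rintro rfl
      have h : nnHolderNorm α ((0 : HolderSpace α S).toBCF : S → ℂ) = 0 := nnHolderNorm_zero S α
      have h' : ‖(0 : HolderSpace α S).toBCF‖ = 0 := norm_zero
      rw [norm_def, h, h', NNReal.coe_zero, add_zero]

noncomputable instance : NormedAddCommGroup (HolderSpace α S) := NormedAddCommGroup.ofCore core

noncomputable instance : NormedSpace ℂ (HolderSpace α S) := NormedSpace.ofCore core

end HolderSpace

end AnalyticVariety

/-! The operator is a weighted Riesz potential of order one, and the only geometric input is the
upper Ahlfors bound `IsPureDim.exists_volume_bound`: on `D`, balls of radius `r` about any centre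
have volume at most `C r^(2n)`. By the layer-cake formula this makes `‖ζ - w‖^(-p)` integrable
uniformly in `w` for every `p < 2n`, exactly as on `ℂ^n`; `exists_lintegral_weighted_le` adds the
weight `‖w‖^γ / ‖ζ‖^γ`. Choose `β` with `α < β < 1`, and `β ≤ γ` unless `γ = 0`. Pointwise estimates
then show that `z ↦ kernel · z` is bounded and `β`-Hölder as an `L¹`-valued map on `closure D`. The
unit ball of `L^∞` therefore goes into a set bounded in `C^β`, which is compact in `C^α` by
Arzelà–Ascoli and interpolation (`HolderSpace.isCompact_setOf_holder`).

The volume bound, which must hold up to the singular points, comes from finitely many linear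
projections to `ℂ^n` near each point of `X`, chosen so that their fibres on `X` are uniformly finite
and every possible tangent space is uniformly transverse to one of them (`hasGoodProjections`). Near
a regular point one of these projections has a Lipschitz inverse on `X` with a uniform constant, so
the Hausdorff measure of a piece of `X` is at most a constant times the number of sheets times the
measure of its shadow in `ℂ^n` (`hausdorffMeasure_le_of_finite_fibres`).

The projections are found by induction on the ambient dimension. Weierstrass division, obtained by
inverting an operator on the disc algebra, turns the equations into polynomials in one variable with
holomorphic coefficients, and resultants eliminate that variable. Pure dimension enters only through
the statement that no graph-like piece of `X` has dimension above `n`, which passes to projections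
because such pieces lift (`exists_projection_step`). -/

namespace AnalyticVariety

open Set Filter Topology Metric

/-! ### Differentiable families of functions as maps into function spaces -/

section FunctionSpaces

/-- The pointwise evaluation of a continuous family of continuous linear maps. -/
noncomputable def familyToLinear (E K : Type*) [NormedAddCommGroup E] [NormedSpace ℂ E]
    [TopologicalSpace K] [CompactSpace K] : C(K, E →L[ℂ] ℂ) →L[ℂ] (E →L[ℂ] C(K, ℂ)) :=
  LinearMap.mkContinuous₂
    (LinearMap.mk₂ ℂ (fun (G : C(K, E →L[ℂ] ℂ)) (v : E) =>
      (⟨fun t => G t v, by fun_prop⟩ : C(K, ℂ)))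
      (fun _ _ _ => by ext; simp) (fun _ _ _ => by ext; simp)
      (fun _ _ _ => by ext; simp) (fun _ _ _ => by ext; simp)) 1
    (fun G v => by
      rw [ContinuousMap.norm_le _ (by positivity), one_mul]
      intro t
      exact ((G t).le_opNorm v).trans
        (mul_le_mul_of_nonneg_right (G.norm_coe_le_norm t) (norm_nonneg v)))

theorem familyToLinear_apply {E K : Type*} [NormedAddCommGroup E] [NormedSpace ℂ E]
    [TopologicalSpace K] [CompactSpace K] (G : C(K, E →L[ℂ] ℂ)) (v : E) (t : K) :
    familyToLinear E K G v t = G t v := rfl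

/-- Compactness of `K` turns joint continuity of the partial derivatives into continuity in the
supremum norm. The mean value inequality on a small ball, with the same `ε` for all parameters, then
gives Fréchet differentiability. -/
theorem contDiffOn_continuousMap {E K : Type*} [NormedAddCommGroup E] [NormedSpace ℂ E]
    [TopologicalSpace K] [CompactSpace K] {U : Set E} (hU : IsOpen U) (H : E → C(K, ℂ))
    (g' : E → K → E →L[ℂ] ℂ)
    (hg : ∀ t, ∀ y ∈ U, HasFDerivAt (fun y => H y t) (g' y t) y)
    (hc : ContinuousOn (Function.uncurry g') (U ×ˢ univ)) : ContDiffOn ℂ 1 H U := by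
  classical
  let F : C(U × K, E →L[ℂ] ℂ) := ⟨fun p => g' p.1 p.2, by
    refine hc.comp_continuous (f := fun p : U × K => ((p.1 : E), p.2)) (by fun_prop) ?_
    rintro ⟨y, t⟩; exact ⟨y.2, trivial⟩⟩
  let G : C(U, C(K, E →L[ℂ] ℂ)) := F.curry
  have hG : ∀ (y : U) t, G y t = g' y t := fun y t => rfl
  let G' : E → C(K, E →L[ℂ] ℂ) := fun y => if h : y ∈ U then G ⟨y, h⟩ else 0
  have hG' : ContinuousOn G' U := by
    rw [continuousOn_iff_continuous_domRestrict]
    convert G.continuous using 1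
    ext y t
    simp [G']
  have hd : ∀ y ∈ U, HasFDerivAt H (familyToLinear E K (G' y)) y := by
    intro y hy
    rw [hasFDerivAt_iff_isLittleO]
    rw [Asymptotics.isLittleO_iff]
    intro ε hε
    have h1 : ∀ᶠ z in 𝓝 y, z ∈ U ∧ ∀ t, dist (G' y t) (G' z t) < ε :=
      (hU.eventually_mem hy).and
        (Metric.tendstoUniformly_iff.1 (ContinuousMap.tendsto_iff_tendstoUniformly.1
        (hG'.continuousAt (hU.mem_nhds hy))) ε hε)
    obtain ⟨δ, hδ, hb⟩ := Metric.eventually_nhds_iff_ball.1 h1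
    filter_upwards [ball_mem_nhds y hδ] with z hz
    rw [ContinuousMap.norm_le _ (by positivity)]
    intro t
    have key := Convex.norm_image_sub_le_of_norm_hasFDerivWithin_le' (𝕜 := ℂ)
      (f := fun y => H y t) (f' := fun y => g' y t) (φ := g' y t) (s := ball y δ) (C := ε)
      (fun x hx => (hg t x (hb x hx).1).hasFDerivWithinAt) (fun x hx => ?_)
      (convex_ball y δ) (mem_ball_self hδ) hz
    · simpa [familyToLinear_apply, G', hy, hG] using key
    · have h3 := ((hb x hx).2 t).le
      rw [dist_comm, dist_eq_norm] at h3
      simpa [G', hy, (hb x hx).1, hG] using h3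
  intro y hy
  refine ContDiffAt.contDiffWithinAt ?_
  rw [contDiffAt_one_iff]
  exact ⟨_, U, hU.mem_nhds hy, (familyToLinear E K).continuous.comp_continuousOn hG', hd⟩

/-- Directional derivatives are limits of difference quotients, which lie in the closed subspace, so
the derivative can be corestricted without changing norms. -/
theorem contDiffOn_submodule {E B : Type*} [NormedAddCommGroup E] [NormedSpace ℂ E]
    [NormedAddCommGroup B] [NormedSpace ℂ B] {S : Submodule ℂ B} (hS : IsClosed (S : Set B))
    {U : Set E} (hU : IsOpen U) (f : E → S) (hf : ContDiffOn ℂ 1 (fun y => (f y : B)) U) :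
    ContDiffOn ℂ 1 f U := by
  set g : E → B := fun y => (f y : B) with hg
  have hmem : ∀ y ∈ U, ∀ v, fderiv ℂ g y v ∈ S := by
    intro y hy v
    have hd : HasFDerivAt g (fderiv ℂ g y) y :=
      ((hf.contDiffAt (hU.mem_nhds hy)).differentiableAt one_ne_zero).hasFDerivAt
    have hl : HasDerivAt (fun s : ℂ => g (y + s • v)) (fderiv ℂ g y v) 0 := by
      have h2 : HasDerivAt (fun s : ℂ => y + s • v) v 0 := by
        simpa using ((hasDerivAt_id (0 : ℂ)).smul_const v).const_add y
      have hd' : HasFDerivAt g (fderiv ℂ g y) (y + (0 : ℂ) • v) := by simpa using hd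
      exact hd'.comp_hasDerivAt 0 h2
    have ht := hasDerivAt_iff_tendsto_slope.1 hl
    refine hS.mem_of_tendsto ht (Eventually.of_forall fun s => ?_)
    rw [slope_def_module]
    exact S.smul_mem _ (S.sub_mem (f _).2 (f _).2)
  intro y hy
  refine ContDiffAt.contDiffWithinAt ?_
  rw [contDiffAt_one_iff]
  classical
  refine ⟨fun z => if h : z ∈ U then (fderiv ℂ g z).codRestrict S (hmem z h) else 0, U,
    hU.mem_nhds hy, ?_, ?_⟩
  · have hc : ContinuousOn (fderiv ℂ g) U := hf.continuousOn_fderiv_of_isOpen hU le_rfl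
    rw [Metric.continuousOn_iff] at hc ⊢
    intro b hb ε hε
    obtain ⟨δ, hδ, h⟩ := hc b hb (ε / 2) (by positivity)
    refine ⟨δ, hδ, fun a ha hab => ?_⟩
    have h1 := (h a ha hab).le
    rw [dist_eq_norm] at h1 ⊢
    refine lt_of_le_of_lt ?_ (half_lt_self hε)
    refine ContinuousLinearMap.opNorm_le_bound _ (by positivity) fun v => ?_
    have h2 := (fderiv ℂ g a - fderiv ℂ g b).le_of_opNorm_le h1 v
    simpa [ha, hb] using h2
  · intro z hz
    have hd : HasFDerivAt g (fderiv ℂ g z) z :=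
      ((hf.contDiffAt (hU.mem_nhds hz)).differentiableAt one_ne_zero).hasFDerivAt
    rw [hasFDerivAt_iff_isLittleO] at hd ⊢
    rw [← Asymptotics.isLittleO_norm_left] at hd ⊢
    refine hd.congr_left fun x => ?_
    simp [hz, hg]

end FunctionSpaces


open Set Filter Topology Metric

/-! ### The disc algebra and division by powers of the coordinate -/

section DiscAlgebra

/-- The disc algebra: continuous functions on a closed disc that are holomorphic inside. -/
def discAlgebra (ρ : ℝ) : Subalgebra ℂ C(closedBall (0 : ℂ) ρ, ℂ) where
  carrier := {f | ∃ g : ℂ → ℂ, DifferentiableOn ℂ g (ball 0 ρ) ∧ ∀ t : closedBall (0 : ℂ) ρ, g t = f t}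
  mul_mem' := by
    rintro f₁ f₂ ⟨g₁, h₁, e₁⟩ ⟨g₂, h₂, e₂⟩
    exact ⟨g₁ * g₂, h₁.mul h₂, fun t => by simp [e₁, e₂]⟩
  add_mem' := by
    rintro f₁ f₂ ⟨g₁, h₁, e₁⟩ ⟨g₂, h₂, e₂⟩
    exact ⟨g₁ + g₂, h₁.add h₂, fun t => by simp [e₁, e₂]⟩
  algebraMap_mem' := fun c => ⟨fun _ => c, by fun_prop, fun t => by simp⟩

/-- Locally uniform limits of holomorphic functions are holomorphic. The resulting completeness is
what allows operators on the disc algebra to be inverted. -/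
theorem isClosed_discAlgebra (ρ : ℝ) :
    IsClosed ((discAlgebra ρ).toSubmodule : Set C(closedBall (0 : ℂ) ρ, ℂ)) := by
  classical
  refine isClosed_of_closure_subset fun f hf => ?_
  obtain ⟨u, hu, hlim⟩ := mem_closure_iff_seq_limit.1 hf
  choose g hg hgu using hu
  let G : ℂ → ℂ := fun t => if h : t ∈ closedBall (0 : ℂ) ρ then f ⟨t, h⟩ else 0
  refine ⟨G, ?_, fun t => by simp only [G, t.2, dif_pos]⟩
  refine TendstoLocallyUniformlyOn.differentiableOn (F := g) (φ := atTop) ?_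
    (Eventually.of_forall hg) isOpen_ball
  refine TendstoUniformlyOn.tendstoLocallyUniformlyOn ?_
  rw [Metric.tendstoUniformlyOn_iff]
  intro ε hε
  filter_upwards [Metric.tendstoUniformly_iff.1
    (ContinuousMap.tendsto_iff_tendstoUniformly.1 hlim) ε hε] with n hn t ht
  have ht' := ball_subset_closedBall ht
  have h1 := hn ⟨t, ht'⟩
  rw [← hgu] at h1
  simpa only [G, ht', dif_pos] using h1

instance (ρ : ℝ) : CompleteSpace (discAlgebra ρ) :=
  (isClosed_discAlgebra ρ).completeSpace_coe

/-- Iterates `g t = g 0 + t * dslope g 0 t`; the slope at an interior point keeps holomorphy inside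
and continuity up to the boundary. -/
theorem exists_taylor_remainder {ρ : ℝ} (hρ : 0 < ρ) (d : ℕ) : ∀ g : ℂ → ℂ,
    ContinuousOn g (closedBall 0 ρ) → DifferentiableOn ℂ g (ball 0 ρ) →
    ∃ (c : Fin d → ℂ) (q : ℂ → ℂ), ContinuousOn q (closedBall 0 ρ) ∧
      DifferentiableOn ℂ q (ball 0 ρ) ∧ ∀ t, g t = ∑ i, c i * t ^ (i : ℕ) + t ^ d * q t := by
  induction d with
  | zero => exact fun g h1 h2 => ⟨Fin.elim0, g, h1, h2, fun t => by simp⟩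
  | succ d ih =>
    intro g h1 h2
    have h3 : DifferentiableAt ℂ g 0 := h2.differentiableAt (ball_mem_nhds 0 hρ)
    obtain ⟨c, q, hq, hq', e⟩ := ih (dslope g 0)
      ((continuousOn_dslope (closedBall_mem_nhds 0 hρ)).2 ⟨h1, h3⟩)
      ((Complex.differentiableOn_dslope (ball_mem_nhds 0 hρ)).2 h2)
    refine ⟨Fin.cons (g 0) c, q, hq, hq', fun t => ?_⟩
    have h4 := sub_smul_dslope g 0 t
    rw [e t, sub_zero, smul_eq_mul] at h4
    rw [Fin.sum_univ_succ]
    simp only [Fin.cons_zero, Fin.cons_succ, Fin.val_zero, Fin.val_succ, pow_zero, mul_one]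
    have h5 : ∑ i : Fin d, c i * t ^ ((i : ℕ) + 1) = t * ∑ i : Fin d, c i * t ^ (i : ℕ) := by
      rw [Finset.mul_sum]; exact Finset.sum_congr rfl fun i _ => by ring
    rw [h5]
    linear_combination -h4

theorem eqOn_closedBall_of_ne_zero {ρ : ℝ} (hρ : 0 < ρ) {f g : ℂ → ℂ}
    (hf : ContinuousOn f (closedBall 0 ρ)) (hg : ContinuousOn g (closedBall 0 ρ))
    (h : ∀ t ∈ closedBall (0 : ℂ) ρ, t ≠ 0 → f t = g t) : EqOn f g (closedBall 0 ρ) := by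
  refine Set.EqOn.of_subset_closure (s := ball 0 ρ ∩ {0}ᶜ)
    (fun t ht => h t (ball_subset_closedBall ht.1) ht.2) hf hg
    (inter_subset_left.trans ball_subset_closedBall) ?_
  rw [← closure_ball 0 hρ.ne']
  refine closure_minimal ?_ isClosed_closure
  exact (dense_compl_singleton (0 : ℂ)).open_subset_closure_inter isOpen_ball

/-- Uniqueness in division by `t^d`: evaluate at `0`, cancel one factor `t` off the origin, and
recover the origin by continuity. -/
theorem eq_zero_of_sum_add_pow_mul {ρ : ℝ} (hρ : 0 < ρ) (d : ℕ) : ∀ (c : Fin d → ℂ) (g : ℂ → ℂ),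
    ContinuousOn g (closedBall 0 ρ) →
    (∀ t ∈ closedBall (0 : ℂ) ρ, ∑ i, c i * t ^ (i : ℕ) + t ^ d * g t = 0) →
    c = 0 ∧ ∀ t ∈ closedBall (0 : ℂ) ρ, g t = 0 := by
  induction d with
  | zero => exact fun c g h1 h2 => ⟨Subsingleton.elim _ _, fun t ht => by simpa using h2 t ht⟩
  | succ d ih =>
    intro c g h1 h2
    have h0 : c 0 = 0 := by
      simpa [Fin.sum_univ_succ] using h2 0 (mem_closedBall_self hρ.le)
    have key := eqOn_closedBall_of_ne_zero hρ
      (f := fun t => ∑ i : Fin d, c i.succ * t ^ (i : ℕ) + t ^ d * g t) (g := fun _ => 0)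
      (by fun_prop) (by fun_prop) (fun t ht ht0 => by
        have h3 := h2 t ht
        rw [Fin.sum_univ_succ, h0] at h3
        simp only [Fin.val_succ, zero_mul, zero_add] at h3
        have h5 : ∑ i : Fin d, c i.succ * t ^ ((i : ℕ) + 1)
            = t * ∑ i : Fin d, c i.succ * t ^ (i : ℕ) := by
          rw [Finset.mul_sum]; exact Finset.sum_congr rfl fun i _ => by ring
        rw [h5] at h3
        refine (mul_eq_zero.1 (?_ : t * _ = 0)).resolve_left ht0
        linear_combination h3)
    obtain ⟨h6, h7⟩ := ih (fun i => c i.succ) g h1 key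
    refine ⟨funext fun i => ?_, h7⟩
    refine Fin.cases h0 (fun j => congrFun h6 j) i

theorem exists_toDiscAlgebra {F : Type*} [NormedAddCommGroup F] [NormedSpace ℂ F]
    {V : Set (F × ℂ)} (hV : IsOpen V) {Ω : Set F} (hΩ : IsOpen Ω) {ρ : ℝ}
    (hsub : Ω ×ˢ closedBall (0 : ℂ) ρ ⊆ V) (f : F × ℂ → ℂ) (hf : ContDiffOn ℂ 1 f V) :
    ∃ H : F → discAlgebra ρ, ContDiffOn ℂ 1 H Ω ∧
      ∀ y ∈ Ω, ∀ t : closedBall (0 : ℂ) ρ, (H y : C(closedBall (0 : ℂ) ρ, ℂ)) t = f (y, t) := by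
  classical
  have hmem : ∀ y ∈ Ω, ∀ t : closedBall (0 : ℂ) ρ, (y, (t : ℂ)) ∈ V :=
    fun y hy t => hsub ⟨hy, t.2⟩
  have hdiff : ∀ p ∈ V, HasFDerivAt f (fderiv ℂ f p) p := fun p hp =>
    ((hf.contDiffAt (hV.mem_nhds hp)).differentiableAt one_ne_zero).hasFDerivAt
  let H : F → discAlgebra ρ := fun y => if hy : y ∈ Ω then
    ⟨⟨fun t => f (y, t), hf.continuousOn.comp_continuous (by fun_prop) (hmem y hy)⟩,
      fun t => f (y, t), fun t ht => by
        have h1 := (hdiff (y, t) (hsub ⟨hy, ball_subset_closedBall ht⟩)).differentiableAt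
        exact (h1.comp t (f := fun t => (y, t)) (by fun_prop)).differentiableWithinAt,
      fun t => rfl⟩ else 0
  have hH : ∀ y ∈ Ω, ∀ t : closedBall (0 : ℂ) ρ,
      (H y : C(closedBall (0 : ℂ) ρ, ℂ)) t = f (y, t) := by
    intro y hy t
    simp only [H, hy, dif_pos]; rfl
  refine ⟨H, ?_, hH⟩
  refine contDiffOn_submodule (S := (discAlgebra ρ).toSubmodule) (isClosed_discAlgebra ρ) hΩ H ?_
  refine contDiffOn_continuousMap hΩ _
    (fun y t => (fderiv ℂ f (y, t)).comp (ContinuousLinearMap.inl ℂ F ℂ)) ?_ ?_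
  · intro t y hy
    have h1 := HasFDerivAt.comp (g := f) (f := fun z => (z, (t : ℂ))) y
      (hdiff (y, t) (hmem y hy t)) (hasFDerivAt_prodMk_left (𝕜 := ℂ) y (t : ℂ))
    refine h1.congr_of_eventuallyEq ?_
    filter_upwards [hΩ.mem_nhds hy] with z hz
    exact hH z hz t
  · have h1 := hf.continuousOn_fderiv_of_isOpen hV le_rfl
    have h2 : ContinuousOn (fun p : F × closedBall (0 : ℂ) ρ => fderiv ℂ f (p.1, (p.2 : ℂ)))
        (Ω ×ˢ univ) := h1.comp (by fun_prop) (fun p hp => hmem p.1 hp.1 p.2)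
    exact h2.clm_comp continuousOn_const

end DiscAlgebra


open Set Filter Topology Metric

/-! ### Weierstrass division with parameters -/

section WeierstrassDivision

variable {F : Type*} [NormedAddCommGroup F] [NormedSpace ℂ F]

theorem exists_pow_mul_on_closedBall {g : ℂ → ℂ} {W : Set ℂ} (hW : IsOpen W) (h0 : 0 ∈ W)
    (hg : DifferentiableOn ℂ g W) (hne : ∃ᶠ t in 𝓝 (0 : ℂ), g t ≠ 0) :
    ∃ (d : ℕ) (ρ : ℝ) (u : ℂ → ℂ), 0 < ρ ∧ closedBall 0 ρ ⊆ W ∧ ContinuousOn u (closedBall 0 ρ) ∧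
      DifferentiableOn ℂ u (ball 0 ρ) ∧ ∀ t ∈ closedBall (0 : ℂ) ρ, u t ≠ 0 ∧ g t = t ^ d * u t := by
  have hga : AnalyticAt ℂ g 0 := hg.analyticAt (hW.mem_nhds h0)
  obtain ⟨d, u, hu, hu0, he⟩ := hga.exists_eventuallyEq_pow_smul_nonzero_iff.2
    (fun h => hne (h.mono fun t ht => by simpa using ht))
  have h1 : ∀ᶠ t in 𝓝 (0 : ℂ), t ∈ W ∧ AnalyticAt ℂ u t ∧ u t ≠ 0 ∧ g t = t ^ d * u t := by
    filter_upwards [hW.mem_nhds h0, hu.eventually_analyticAt, hu.continuousAt.eventually_ne hu0, he]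
      with t a b c e
    exact ⟨a, b, c, by simpa using e⟩
  obtain ⟨ρ, hρ, hb⟩ := Metric.nhds_basis_closedBall.eventually_iff.1 h1
  exact ⟨d, ρ, u, hρ, fun t ht => (hb ht).1,
    fun t ht => (hb ht).2.1.continuousAt.continuousWithinAt,
    fun t ht => (hb (ball_subset_closedBall ht)).2.1.differentiableAt.differentiableWithinAt,
    fun t ht => (hb ht).2.2⟩

/-- The coordinate function as an element of the disc algebra. -/
noncomputable def discAlgebraId (ρ : ℝ) : discAlgebra ρ :=
  ⟨⟨fun t => t, by fun_prop⟩, fun t => t, differentiableOn_id, fun _ => rfl⟩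

/-- The map `(c, q) ↦ ∑ c_i t^i + h q`. -/
noncomputable def divisionMap (ρ : ℝ) (d : ℕ) (h : discAlgebra ρ) :
    ((Fin d → ℂ) × discAlgebra ρ) →L[ℂ] discAlgebra ρ :=
  (LinearMap.toContinuousLinearMap
      (Fintype.linearCombination ℂ (fun i : Fin d => discAlgebraId ρ ^ (i : ℕ)))).comp
      (ContinuousLinearMap.fst ℂ _ _) +
    (ContinuousLinearMap.mul ℂ (discAlgebra ρ) h).comp (ContinuousLinearMap.snd ℂ _ _)

theorem divisionMap_apply (ρ : ℝ) (d : ℕ) (h q : discAlgebra ρ) (c : Fin d → ℂ)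
    (t : closedBall (0 : ℂ) ρ) :
    (divisionMap ρ d h (c, q) : C(closedBall (0 : ℂ) ρ, ℂ)) t =
      ∑ i, c i * (t : ℂ) ^ (i : ℕ) + h.1 t * q.1 t := by
  simp [divisionMap, Fintype.linearCombination_apply, discAlgebraId]

theorem contDiff_divisionMap (ρ : ℝ) (d : ℕ) : ContDiff ℂ 1 (divisionMap ρ d) := by
  unfold divisionMap
  have h1 : ContDiff ℂ 1 (fun h => ContinuousLinearMap.mul ℂ (discAlgebra ρ) h) :=
    ContinuousLinearMap.contDiff (𝕜 := ℂ) (n := 1) (E := discAlgebra ρ)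
      (F := discAlgebra ρ →L[ℂ] discAlgebra ρ) (ContinuousLinearMap.mul ℂ (discAlgebra ρ))
  exact contDiff_const.add (h1.clm_comp contDiff_const)

/-- An arbitrary extension of an element of the disc algebra to the plane. -/
noncomputable def discExtend {ρ : ℝ} (f : C(closedBall (0 : ℂ) ρ, ℂ)) (t : ℂ) : ℂ :=
  open Classical in if h : t ∈ closedBall (0 : ℂ) ρ then f ⟨t, h⟩ else 0

theorem discExtend_apply {ρ : ℝ} (f : C(closedBall (0 : ℂ) ρ, ℂ)) (t : closedBall (0 : ℂ) ρ) :
    discExtend f t = f t := by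
  simp [discExtend, -mem_closedBall, t.2]

theorem continuousOn_discExtend {ρ : ℝ} (f : C(closedBall (0 : ℂ) ρ, ℂ)) :
    ContinuousOn (discExtend f) (closedBall 0 ρ) := by
  rw [continuousOn_iff_continuous_domRestrict]
  convert f.continuous using 1
  ext t
  exact discExtend_apply f t

theorem differentiableOn_discExtend {ρ : ℝ} (f : discAlgebra ρ) :
    DifferentiableOn ℂ (discExtend f.1) (ball 0 ρ) := by
  obtain ⟨g, hg, e⟩ := f.2
  refine hg.congr fun t ht => ?_
  rw [discExtend_apply f.1 ⟨t, ball_subset_closedBall ht⟩, ← e]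

/-- Since `h` is `t^d` times a unit, division by `h` is Taylor expansion to order `d` followed by
division of the remainder by `u`. -/
theorem bijective_divisionMap {ρ : ℝ} (hρ : 0 < ρ) (d : ℕ) (h : discAlgebra ρ) (u : ℂ → ℂ)
    (hu : ContinuousOn u (closedBall 0 ρ)) (hu' : DifferentiableOn ℂ u (ball 0 ρ))
    (hu0 : ∀ t : closedBall (0 : ℂ) ρ, u t ≠ 0 ∧ h.1 t = (t : ℂ) ^ d * u t) :
    Function.Bijective (divisionMap ρ d h) := by
  constructor
  · rw [injective_iff_map_eq_zero]
    rintro ⟨c, q⟩ e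
    obtain ⟨h1, h2⟩ := eq_zero_of_sum_add_pow_mul hρ d c (fun t => u t * discExtend q.1 t)
      (hu.mul (continuousOn_discExtend _)) (fun t ht => by
        have h3 := divisionMap_apply ρ d h q c ⟨t, ht⟩
        rw [e, (hu0 ⟨t, ht⟩).2, ← discExtend_apply q.1] at h3
        simp only [mul_assoc] at h3
        exact h3.symm)
    refine Prod.ext h1 (Subtype.ext (ContinuousMap.ext fun t => ?_))
    have h4 := (mul_eq_zero.1 (h2 t t.2)).resolve_left (hu0 t).1
    rw [discExtend_apply] at h4
    exact h4
  · intro f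
    obtain ⟨c, q, hq, hq', e⟩ := exists_taylor_remainder hρ d (discExtend f.1)
      (continuousOn_discExtend _) (differentiableOn_discExtend f)
    refine ⟨(c, ⟨⟨fun t => q t / u t, ?_⟩, fun t => q t / u t, ?_, fun t => rfl⟩), ?_⟩
    · exact (hq.div hu fun t ht => (hu0 ⟨t, ht⟩).1).comp_continuous (by fun_prop) (fun t => t.2)
    · exact hq'.div hu' fun t ht => (hu0 ⟨t, ball_subset_closedBall ht⟩).1
    · refine Subtype.ext (ContinuousMap.ext fun t => ?_)
      rw [divisionMap_apply, ← discExtend_apply f.1, e, (hu0 t).2]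
      simp only [ContinuousMap.coe_mk]
      have := (hu0 t).1
      field_simp

/-- Division by `h (y, ·)` means inverting an operator that depends holomorphically on `y`. It is
invertible at `y = 0`, where `h` is a power times a unit, hence for nearby `y`, and the inverse is
again `C¹`. The neighbourhood does not depend on the dividend `f`. -/
theorem weierstrass_division {V : Set (F × ℂ)} (hV : IsOpen V) (h0 : (0, 0) ∈ V) (h : F × ℂ → ℂ)
    (hh : ContDiffOn ℂ 1 h V) (hne : ∃ᶠ t in 𝓝 (0 : ℂ), h (0, t) ≠ 0) :
    ∃ (d : ℕ) (ρ : ℝ) (Ω : Set F), 0 < ρ ∧ IsOpen Ω ∧ 0 ∈ Ω ∧ Ω ×ˢ closedBall (0 : ℂ) ρ ⊆ V ∧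
      (∃ u : ℂ → ℂ, ContinuousOn u (closedBall 0 ρ) ∧
        ∀ t ∈ closedBall (0 : ℂ) ρ, h (0, t) = t ^ d * u t) ∧
      ∀ f : F × ℂ → ℂ, ContDiffOn ℂ 1 f V → ∃ c : F → Fin d → ℂ, ContDiffOn ℂ 1 c Ω ∧
        ∀ y ∈ Ω, ∃ q : ℂ → ℂ, ContinuousOn q (closedBall 0 ρ) ∧
          ∀ t ∈ closedBall (0 : ℂ) ρ, f (y, t) = ∑ i, c y i * t ^ (i : ℕ) + h (y, t) * q t := by
  obtain ⟨d, ρ, u, hρ, hsub0, hu, hu', hu0⟩ := exists_pow_mul_on_closedBall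
    (g := fun t => h (0, t)) (W := (fun t => ((0 : F), t)) ⁻¹' V)
    (hV.preimage (by fun_prop)) h0
    ((hh.differentiableOn one_ne_zero).comp (by fun_prop) (fun t ht => ht)) hne
  obtain ⟨Ω₀, T, hΩ₀, hT, h0Ω, hKT, hΩT⟩ := generalized_tube_lemma (isCompact_singleton (x := (0 : F)))
    (isCompact_closedBall (0 : ℂ) ρ) hV (by
      rintro ⟨y, t⟩ ⟨hy, ht⟩
      obtain rfl : y = 0 := hy
      exact hsub0 ht)
  have h0Ω : (0 : F) ∈ Ω₀ := h0Ω rfl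
  have hsub : Ω₀ ×ˢ closedBall (0 : ℂ) ρ ⊆ V := (prod_mono_right hKT).trans hΩT
  obtain ⟨H, hH, eH⟩ := exists_toDiscAlgebra hV hΩ₀ hsub h hh
  let L : F → ((Fin d → ℂ) × discAlgebra ρ) →L[ℂ] discAlgebra ρ := fun y => divisionMap ρ d (H y)
  have hL : ContDiffOn ℂ 1 L Ω₀ := (contDiff_divisionMap ρ d).comp_contDiffOn hH
  have hbij := bijective_divisionMap hρ d (H 0) u hu hu' (fun t => by
    rw [eH 0 h0Ω]; exact hu0 t t.2)
  let S : Set (((Fin d → ℂ) × discAlgebra ρ) →L[ℂ] discAlgebra ρ) :=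
    range ((↑) : (((Fin d → ℂ) × discAlgebra ρ) ≃L[ℂ] discAlgebra ρ) → _)
  have hS : IsOpen S := ContinuousLinearEquiv.isOpen
  have hΩ : IsOpen (Ω₀ ∩ L ⁻¹' S) := hL.continuousOn.isOpen_inter_preimage hΩ₀ hS
  refine ⟨d, ρ, Ω₀ ∩ L ⁻¹' S, hρ, hΩ, ⟨h0Ω, ?_⟩, (prod_mono_left inter_subset_left).trans hsub,
    ⟨u, hu, fun t ht => (hu0 t ht).2⟩, ?_⟩
  · refine ⟨ContinuousLinearEquiv.ofBijective (L 0) (LinearMap.ker_eq_bot.2 hbij.1)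
      (LinearMap.range_eq_top.2 hbij.2), ?_⟩
    exact ContinuousLinearMap.ext fun x => rfl
  · intro f hf
    obtain ⟨G, hG, eG⟩ := exists_toDiscAlgebra hV hΩ₀ hsub f hf
    have hsol : ContDiffOn ℂ 1 (fun y => (L y).inverse (G y)) (Ω₀ ∩ L ⁻¹' S) := by
      rintro y ⟨hy, e, he⟩
      refine ContDiffAt.contDiffWithinAt ?_
      have h1 : ContDiffAt ℂ 1 ContinuousLinearMap.inverse (L y) := by
        rw [← he]; exact contDiffAt_map_inverse e
      exact (h1.comp y (hL.contDiffAt (hΩ₀.mem_nhds hy))).clm_apply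
        (hG.contDiffAt (hΩ₀.mem_nhds hy))
    refine ⟨fun y => ((L y).inverse (G y)).1, contDiff_fst.comp_contDiffOn hsol, ?_⟩
    rintro y ⟨hy, e, he⟩
    refine ⟨discExtend ((L y).inverse (G y)).2.1, continuousOn_discExtend _, fun t ht => ?_⟩
    have h2 : L y ((L y).inverse (G y)) = G y := by
      rw [← he, ContinuousLinearMap.inverse_equiv]; exact e.apply_symm_apply _
    have h3 := divisionMap_apply ρ d (H y) ((L y).inverse (G y)).2 ((L y).inverse (G y)).1 ⟨t, ht⟩
    rw [Prod.mk.eta] at h3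
    rw [discExtend_apply _ ⟨t, ht⟩, ← eH y hy ⟨t, ht⟩, ← h3, ← eG y hy ⟨t, ht⟩]
    exact (congrArg (fun g : discAlgebra ρ => g.1 ⟨t, ht⟩) h2).symm

end WeierstrassDivision


open Set Filter Topology Metric Polynomial

/-! ### Replacing analytic equations by polynomial ones -/

section WeierstrassForm

variable {F : Type*} [NormedAddCommGroup F] [NormedSpace ℂ F]

/-- The polynomial with given coefficients. -/
noncomputable def polyOfCoeffs {d : ℕ} (c : Fin d → ℂ) : ℂ[X] := ∑ i, C (c i) * X ^ (i : ℕ)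

theorem eval_polyOfCoeffs {d : ℕ} (c : Fin d → ℂ) (t : ℂ) :
    (polyOfCoeffs c).eval t = ∑ i, c i * t ^ (i : ℕ) := by
  simp [polyOfCoeffs, eval_finsetSum]

theorem degree_polyOfCoeffs_lt {d : ℕ} (c : Fin d → ℂ) : (polyOfCoeffs c).degree < d :=
  degree_sum_fin_lt c

theorem contDiffOn_coeff_polyOfCoeffs {d : ℕ} {Ω : Set F} {c : F → Fin d → ℂ}
    (hc : ContDiffOn ℂ 1 c Ω) (k : ℕ) :
    ContDiffOn ℂ 1 (fun y => (polyOfCoeffs (c y)).coeff k) Ω := by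
  simp only [polyOfCoeffs, finsetSum_coeff, coeff_C_mul]
  exact ContDiffOn.sum fun i _ => (contDiffOn_pi.1 hc i).mul contDiffOn_const

/-- A root bound of Cauchy type: if `‖t‖ ≥ ρ`, each `t^i` with `i < d` grows by at most the factor
`(‖t‖/ρ)^d` from its size at radius `ρ`, so the sum stays below `‖t‖^d`. -/
theorem norm_lt_of_pow_eq_sum {d : ℕ} {c : Fin d → ℂ} {ρ : ℝ} (hρ : 0 < ρ)
    (hc : ∑ i, ‖c i‖ * ρ ^ (i : ℕ) < ρ ^ d) {t : ℂ} (ht : t ^ d = ∑ i, c i * t ^ (i : ℕ)) :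
    ‖t‖ < ρ := by
  by_contra! hlt
  have h1 : 1 ≤ ‖t‖ / ρ := (one_le_div hρ).2 hlt
  have h2 : ‖t‖ ^ d ≤ (∑ i, ‖c i‖ * ρ ^ (i : ℕ)) * (‖t‖ / ρ) ^ d := by
    rw [← norm_pow, ht, Finset.sum_mul]
    refine (norm_sum_le _ _).trans (Finset.sum_le_sum fun i _ => ?_)
    have h3 : (‖t‖ / ρ) ^ (i : ℕ) ≤ (‖t‖ / ρ) ^ d := pow_le_pow_right₀ h1 i.2.le
    calc ‖c i * t ^ (i : ℕ)‖ = ‖c i‖ * ρ ^ (i : ℕ) * (‖t‖ / ρ) ^ (i : ℕ) := by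
          rw [norm_mul, norm_pow, div_pow]; field_simp
      _ ≤ _ := by gcongr
  have h4 : (∑ i, ‖c i‖ * ρ ^ (i : ℕ)) * (‖t‖ / ρ) ^ d < ρ ^ d * (‖t‖ / ρ) ^ d := by
    gcongr
  rw [div_pow, mul_div_cancel₀ _ (by positivity)] at h4
  rw [div_pow] at h2
  exact absurd h2 (not_le.2 h4)

/-- Dividing `t^d` by `h i₀` gives a monic `P` that vanishes wherever `h i₀` does. Dividing every `h
i` by `P` gives remainders `r i` that agree with `h i` at the roots of `P`. As `i₀` is among the
indices, it does not matter that `P` need not be a multiple of `h i₀`. -/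
theorem exists_weierstrass_form {V : Set (F × ℂ)} (hV : IsOpen V) (h0 : (0, 0) ∈ V) {ι : Type}
    (h : ι → F × ℂ → ℂ) (hh : ∀ i, ContDiffOn ℂ 1 (h i) V) (i₀ : ι)
    (hne : ∃ᶠ t in 𝓝 (0 : ℂ), h i₀ (0, t) ≠ 0) :
    ∃ (d e : ℕ) (ρ : ℝ) (Ω : Set F) (P : F → ℂ[X]) (r : ι → F → ℂ[X]),
      0 < ρ ∧ IsOpen Ω ∧ 0 ∈ Ω ∧ Ω ×ˢ ball (0 : ℂ) ρ ⊆ V ∧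
      (∀ k, ContDiffOn ℂ 1 (fun y => (P y).coeff k) Ω) ∧
      (∀ y ∈ Ω, (P y).Monic ∧ (P y).natDegree = d) ∧
      (∀ i k, ContDiffOn ℂ 1 (fun y => (r i y).coeff k) Ω) ∧
      (∀ i y, (r i y).natDegree ≤ e) ∧
      ∀ y ∈ Ω, ∀ t : ℂ, (‖t‖ < ρ ∧ ∀ i, h i (y, t) = 0) ↔
        ((P y).eval t = 0 ∧ ∀ i, (r i y).eval t = 0) := by
  obtain ⟨d, ρ₁, Ω₁, hρ₁, hΩ₁, h0Ω₁, hsub₁, ⟨u, hu, hu0⟩, hdiv₁⟩ :=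
    weierstrass_division hV h0 (h i₀) (hh i₀) hne
  obtain ⟨c, hc, hcq⟩ := hdiv₁ (fun p => p.2 ^ d) (by fun_prop)
  -- At the base point `h i₀` is `t^d u`, so uniqueness of division forces the remainder of `t^d` to
  -- vanish. By continuity the coefficients remain small, which keeps all roots of `P` inside the
  -- disc.
  have hc0 : c 0 = 0 := by
    obtain ⟨q, hq, e⟩ := hcq 0 h0Ω₁
    refine (eq_zero_of_sum_add_pow_mul hρ₁ d (c 0) (fun t => u t * q t - 1)
      ((hu.mul hq).sub continuousOn_const) (fun t ht => ?_)).1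
    have h1 := e t ht
    rw [hu0 t ht] at h1
    simp only at h1
    linear_combination -h1
  let p : F × ℂ → ℂ := fun z => z.2 ^ d - ∑ i, c z.1 i * z.2 ^ (i : ℕ)
  have hV' : IsOpen ((Ω₁ ×ˢ univ) ∩ V) := (hΩ₁.prod isOpen_univ).inter hV
  have hp : ContDiffOn ℂ 1 p ((Ω₁ ×ˢ univ) ∩ V) := by
    refine ContDiffOn.sub (by fun_prop) (ContDiffOn.sum fun i _ => ContDiffOn.mul ?_ (by fun_prop))
    exact (contDiffOn_pi.1 hc i).comp contDiffOn_fst (fun z hz => hz.1.1)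
  have hp0 : ∃ᶠ t in 𝓝 (0 : ℂ), p (0, t) ≠ 0 := by
    simp only [p, hc0, Pi.zero_apply, zero_mul, Finset.sum_const_zero, sub_zero]
    have h1 : ∃ᶠ t in 𝓝 (0 : ℂ), t ≠ 0 := by
      have := (inferInstance : (𝓝[≠] (0 : ℂ)).NeBot)
      exact frequently_mem_iff_neBot.2 this
    exact h1.mono fun t ht => pow_ne_zero d ht
  obtain ⟨e, ρ₂, Ω₂, hρ₂, hΩ₂, h0Ω₂, hsub₂, -, hdiv₂⟩ :=
    weierstrass_division hV' ⟨⟨h0Ω₁, trivial⟩, h0⟩ p hp hp0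
  choose b hb hbq using fun i => hdiv₂ (h i) ((hh i).mono inter_subset_right)
  set ρ := min ρ₁ ρ₂ with hρdef
  have hρ : 0 < ρ := lt_min hρ₁ hρ₂
  have hcont : ContinuousOn (fun y => ∑ i, ‖c y i‖ * ρ ^ (i : ℕ)) Ω₁ :=
    continuousOn_finsetSum _ fun i _ =>
      ((continuousOn_pi.1 hc.continuousOn i).norm).mul continuousOn_const
  let Ω := (Ω₁ ∩ (fun y => ∑ i, ‖c y i‖ * ρ ^ (i : ℕ)) ⁻¹' Iio (ρ ^ d)) ∩ Ω₂
  have hΩ : IsOpen Ω := (hcont.isOpen_inter_preimage hΩ₁ isOpen_Iio).inter hΩ₂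
  have hball₁ : ∀ t : ℂ, ‖t‖ < ρ → t ∈ closedBall (0 : ℂ) ρ₁ := fun t ht => by
    rw [mem_closedBall_zero_iff]; exact ht.le.trans (min_le_left _ _)
  have hball₂ : ∀ t : ℂ, ‖t‖ < ρ → t ∈ closedBall (0 : ℂ) ρ₂ := fun t ht => by
    rw [mem_closedBall_zero_iff]; exact ht.le.trans (min_le_right _ _)
  have hPe : ∀ y t, (X ^ d - polyOfCoeffs (c y)).eval t = p (y, t) := fun y t => by
    simp [p, eval_polyOfCoeffs]
  refine ⟨d, e, ρ, Ω, fun y => X ^ d - polyOfCoeffs (c y), fun i y => polyOfCoeffs (b i y),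
    hρ, hΩ, ⟨⟨h0Ω₁, ?_⟩, h0Ω₂⟩, ?_, ?_, ?_, ?_, ?_, ?_⟩
  · simp only [hc0, mem_preimage, Pi.zero_apply, norm_zero, zero_mul, Finset.sum_const_zero, mem_Iio]
    positivity
  · rintro ⟨y, t⟩ ⟨hy, ht⟩
    exact hsub₁ ⟨hy.1.1, hball₁ t (mem_ball_zero_iff.1 ht)⟩
  · intro k
    simp only [coeff_sub]
    exact contDiffOn_const.sub ((contDiffOn_coeff_polyOfCoeffs hc k).mono fun y hy => hy.1.1)
  · intro y _
    have h1 := degree_polyOfCoeffs_lt (c y)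
    refine ⟨monic_X_pow_sub h1, natDegree_eq_of_degree_eq_some ?_⟩
    rw [degree_sub_eq_left_of_degree_lt (by rwa [degree_X_pow]), degree_X_pow]
  · exact fun i k => (contDiffOn_coeff_polyOfCoeffs (hb i) k).mono inter_subset_right
  · exact fun i y => natDegree_le_of_degree_le (degree_polyOfCoeffs_lt _).le
  · intro y hy t
    simp only [hPe, eval_polyOfCoeffs]
    obtain ⟨q, -, hq⟩ := hcq y hy.1.1
    have hz : p (y, t) = 0 → ‖t‖ < ρ := fun h1 =>
      norm_lt_of_pow_eq_sum hρ hy.1.2 (sub_eq_zero.1 h1)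
    have hr : ‖t‖ < ρ → p (y, t) = 0 → ∀ i, h i (y, t) = ∑ j, b i y j * t ^ (j : ℕ) := by
      intro ht h1 i
      obtain ⟨q', -, hq'⟩ := hbq i y hy.2
      rw [hq' t (hball₂ t ht), h1, zero_mul, add_zero]
    constructor
    · rintro ⟨ht, hi⟩
      have h1 : p (y, t) = 0 := by
        have h2 := hq t (hball₁ t ht)
        rw [hi i₀, zero_mul, add_zero] at h2
        exact sub_eq_zero.2 h2
      exact ⟨h1, fun i => (hr ht h1 i).symm.trans (hi i)⟩
    · rintro ⟨h1, hi⟩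
      exact ⟨hz h1, fun i => (hr (hz h1) h1 i).trans (hi i)⟩

end WeierstrassForm


open Set Filter Topology Metric Polynomial

/-! ### Elimination of one variable by resultants -/

section Elimination

variable {F : Type*} [NormedAddCommGroup F] [NormedSpace ℂ F]

/-- The formal degree `e` may exceed the degree of `q`: each surplus degree costs only a factor
equal to the leading coefficient of `p`, which is one. A fixed `e` makes the resultant one fixed
polynomial expression in the coefficients. -/
theorem resultant_eq_zero_iff_exists_root {p q : ℂ[X]} {d e : ℕ} (hp : p.Monic)
    (hd : p.natDegree = d) (he : q.natDegree ≤ e) :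
    resultant p q d e = 0 ↔ ∃ t, p.eval t = 0 ∧ q.eval t = 0 := by
  obtain ⟨k, rfl⟩ := Nat.exists_eq_add_of_le he
  subst hd
  rw [resultant_add_right_deg _ _ _ _ _ le_rfl, hp.coeff_natDegree, one_pow, one_mul,
    resultant_eq_zero_iff, isCoprime_iff_aeval_ne_zero_of_isAlgClosed ℂ ℂ]
  simp [hp.ne_zero]

theorem contDiffOn_resultant {p q : F → ℂ[X]} {Ω : Set F} (d e : ℕ)
    (hp : ∀ k, ContDiffOn ℂ 1 (fun y => (p y).coeff k) Ω)
    (hq : ∀ k, ContDiffOn ℂ 1 (fun y => (q y).coeff k) Ω) :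
    ContDiffOn ℂ 1 (fun y => resultant (p y) (q y) d e) Ω := by
  simp only [resultant, Matrix.det_apply]
  refine ContDiffOn.sum fun τ _ => ContDiffOn.const_smul _ (contDiffOn_prod fun i _ => ?_)
  simp only [sylvester, Matrix.of_apply]
  refine Fin.addCases (fun j => ?_) (fun j => ?_) i
  · simp only [Fin.addCases_left]
    split_ifs
    · exact hq _
    · exact contDiffOn_const
  · simp only [Fin.addCases_right]
    split_ifs
    · exact hp _
    · exact contDiffOn_const

/-- The projected set is cut out by the resultants of `P` with all finite linear combinations of the
`r i`. Arbitrary index types are allowed throughout, so the infinitely many equations obtained here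
can be fed back into the induction. -/
theorem exists_elimination {Ω : Set F} {d e : ℕ} {ι : Type} {P : F → ℂ[X]} {r : ι → F → ℂ[X]}
    (hPc : ∀ k, ContDiffOn ℂ 1 (fun y => (P y).coeff k) Ω)
    (hP : ∀ y ∈ Ω, (P y).Monic ∧ (P y).natDegree = d)
    (hrc : ∀ i k, ContDiffOn ℂ 1 (fun y => (r i y).coeff k) Ω)
    (hr : ∀ i y, (r i y).natDegree ≤ e) :
    ∃ R : (ι →₀ ℂ) → F → ℂ, (∀ s, ContDiffOn ℂ 1 (R s) Ω) ∧
      ∀ y ∈ Ω, (∀ s, R s y = 0) ↔ ∃ t, (P y).eval t = 0 ∧ ∀ i, (r i y).eval t = 0 := by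
  let q : (ι →₀ ℂ) → F → ℂ[X] := fun s y => ∑ i ∈ s.support, C (s i) * r i y
  have hq : ∀ s y, (q s y).natDegree ≤ e := fun s y =>
    natDegree_sum_le_of_forall_le _ _ fun i _ => (natDegree_C_mul_le _ _).trans (hr i y)
  refine ⟨fun s y => resultant (P y) (q s y) d e, fun s => contDiffOn_resultant d e hPc fun k => ?_,
    fun y hy => ⟨fun h => ?_, ?_⟩⟩
  · simp only [q, finsetSum_coeff, coeff_C_mul]
    exact ContDiffOn.sum fun i _ => contDiffOn_const.mul (hrc i k)
  · obtain ⟨hm, hd⟩ := hP y hy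
    have h1 : ∀ s, ∃ t, (P y).eval t = 0 ∧ (q s y).eval t = 0 := fun s =>
      (resultant_eq_zero_iff_exists_root hm hd (hq s y)).1 (h s)
    -- The combinations vanishing at a given root of `P` form a subspace, and these finitely many
    -- subspaces cover everything; over an infinite field one of them is the whole space, so its
    -- root is common to all `r i`.
    let p : (P y).roots.toFinset → Submodule ℂ (ι →₀ ℂ) := fun a =>
      LinearMap.ker (Finsupp.linearCombination ℂ (fun i => (r i y).eval (a : ℂ)))
    have hmem : ∀ a s, s ∈ p a ↔ (q s y).eval (a : ℂ) = 0 := fun a s => by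
      simp [p, q, Finsupp.linearCombination_apply, Finsupp.sum, eval_finsetSum]
    obtain ⟨a, ha⟩ := Subspace.exists_eq_top_of_iUnion_eq_univ (p := p) (by
      refine eq_univ_of_forall fun s => mem_iUnion.2 ?_
      obtain ⟨t, ht, hqt⟩ := h1 s
      exact ⟨⟨t, by simpa [hm.ne_zero] using ht⟩, (hmem _ s).2 hqt⟩)
    refine ⟨a, (mem_roots hm.ne_zero).1 (Multiset.mem_toFinset.1 a.2), fun i => ?_⟩
    have h2 : Finsupp.single i (1 : ℂ) ∈ p a := ha ▸ Submodule.mem_top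
    simpa [p] using h2
  · rintro ⟨t, ht, hrt⟩ s
    obtain ⟨hm, hd⟩ := hP y hy
    refine (resultant_eq_zero_iff_exists_root hm hd (hq s y)).2 ⟨t, ht, ?_⟩
    simp [q, eval_finsetSum, hrt]

end Elimination

/-! ### Local holomorphic sections of a finite cover -/

section LocalSections

variable {G : Type*} [NormedAddCommGroup G] [NormedSpace ℂ G] [CompleteSpace G]

theorem exists_implicit_root {Δ : Set G} (hΔ : IsOpen Δ) {P : G → ℂ[X]} {d : ℕ}
    (hPc : ∀ k, ContDiffOn ℂ 1 (fun y => (P y).coeff k) Δ) (hd : ∀ y ∈ Δ, (P y).natDegree = d)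
    {y₀ : G} (hy₀ : y₀ ∈ Δ) {t₀ : ℂ} (h0 : (P y₀).eval t₀ = 0)
    (h1 : (P y₀).derivative.eval t₀ ≠ 0) :
    ∃ (Δ' : Set G) (B : Set ℂ) (φ : G → ℂ), IsOpen Δ' ∧ y₀ ∈ Δ' ∧ Δ' ⊆ Δ ∧ IsOpen B ∧
      ContDiffOn ℂ 1 φ Δ' ∧ (∀ y ∈ Δ', φ y ∈ B) ∧
      ∀ y ∈ Δ', ∀ t ∈ B, (P y).eval t = 0 ↔ t = φ y := by
  let f : G × ℂ → ℂ := fun p => ∑ k ∈ Finset.range (d + 1), (P p.1).coeff k * p.2 ^ k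
  have hf : ∀ y ∈ Δ, ∀ t, f (y, t) = (P y).eval t := fun y hy t =>
    (eval_eq_sum_range' (by rw [hd y hy]; omega) t).symm
  have hfc : ContDiffAt ℂ 1 f (y₀, t₀) := by
    refine ContDiffAt.sum fun k _ => ContDiffAt.mul ?_ (by fun_prop)
    exact ContDiffAt.comp (g := fun y => (P y).coeff k) (y₀, t₀)
      ((hPc k).contDiffAt (hΔ.mem_nhds hy₀)) contDiffAt_fst
  have hder : (fderiv ℂ f (y₀, t₀) ∘L .inr ℂ G ℂ).IsInvertible := by
    refine ⟨ContinuousLinearEquiv.unitsEquivAut ℂ (Units.mk0 _ h1), ?_⟩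
    have h2 : HasFDerivAt (fun t => f (y₀, t)) (fderiv ℂ f (y₀, t₀) ∘L .inr ℂ G ℂ) t₀ :=
      HasFDerivAt.comp (g := f) (f := fun t => (y₀, t)) t₀
        (hfc.differentiableAt one_ne_zero).hasFDerivAt (hasFDerivAt_prodMk_right (𝕜 := ℂ) y₀ t₀)
    have h3 : HasDerivAt (fun t => f (y₀, t)) ((P y₀).derivative.eval t₀) t₀ := by
      simp only [hf y₀ hy₀]
      exact (P y₀).hasDerivAt t₀
    have h4 := h2.hasDerivAt.unique h3
    ext
    simpa using h4.symm
  set φ := hfc.implicitFunction one_ne_zero hder with hφdef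
  have hφ0 : φ y₀ = t₀ := hfc.implicitFunction_apply_self one_ne_zero hder
  have hφc : ContDiffAt ℂ 1 φ y₀ := by
    have := hfc.contDiffAt_implicitFunction one_ne_zero hder
    exact this
  have hev := hfc.eventually_apply_eq_iff_implicitFunction one_ne_zero hder
  rw [nhds_prod_eq] at hev
  obtain ⟨pa, hpa, pb, hpb, hab⟩ := eventually_prod_iff.1 hev
  obtain ⟨B, hBsub, hB, htB⟩ := _root_.mem_nhds_iff.1 hpb
  have hφc' : ∀ᶠ y in 𝓝 y₀, ContDiffAt ℂ 1 φ y := hφc.eventually (by simp)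
  have hall : ∀ᶠ y in 𝓝 y₀, y ∈ Δ ∧ pa y ∧ ContDiffAt ℂ 1 φ y ∧ φ y ∈ B := by
    filter_upwards [hΔ.mem_nhds hy₀, hpa, hφc',
      hφc.continuousAt.eventually_mem (hφ0 ▸ hB.mem_nhds htB)] with y a b c e
    exact ⟨a, b, c, e⟩
  obtain ⟨Δ', hsub, hΔ', hyΔ'⟩ := _root_.mem_nhds_iff.1 hall
  refine ⟨Δ', B, φ, hΔ', hyΔ', fun y hy => (hsub hy).1, hB,
    fun y hy => (hsub hy).2.2.1.contDiffWithinAt, fun y hy => (hsub hy).2.2.2, ?_⟩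
  intro y hy t ht
  have := hab (hsub hy).2.1 (hBsub ht)
  rw [hf y (hsub hy).1, hf y₀ hy₀, h0] at this
  rw [this, eq_comm]

/-- Induction on the degree of a polynomial vanishing on `Z`. The degree drops, either by
differentiating or by splitting off a root, until some simple root branch stays in `Z` over an open
set; degree zero contradicts nonempty fibres. -/
theorem exists_local_section {Z : Set (G × ℂ)} (d : ℕ) : ∀ {Δ : Set G} (_ : IsOpen Δ)
    (_ : Δ.Nonempty) (_ : ∀ y ∈ Δ, ∃ t, (y, t) ∈ Z) (_ : IsOpen {p : G × ℂ | p.1 ∈ Δ ∧ p ∉ Z})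
    (P : G → ℂ[X]) (_ : ∀ k, ContDiffOn ℂ 1 (fun y => (P y).coeff k) Δ)
    (_ : ∀ y ∈ Δ, (P y).Monic ∧ (P y).natDegree = d)
    (_ : ∀ y ∈ Δ, ∀ t, (y, t) ∈ Z → (P y).eval t = 0),
    ∃ (Δ' : Set G) (B : Set ℂ) (φ : G → ℂ), IsOpen Δ' ∧ Δ'.Nonempty ∧ Δ' ⊆ Δ ∧ IsOpen B ∧
      ContDiffOn ℂ 1 φ Δ' ∧ (∀ y ∈ Δ', φ y ∈ B) ∧ ∀ y ∈ Δ', ∀ t ∈ B, (y, t) ∈ Z ↔ t = φ y := by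
  induction d with
  | zero =>
    intro Δ hΔ ⟨y, hy⟩ hsurj hcl P hPc hP hroot
    obtain ⟨t, ht⟩ := hsurj y hy
    have h1 := hroot y hy t ht
    rw [(hP y hy).1.natDegree_eq_zero.1 (hP y hy).2] at h1
    simp at h1
  | succ d ih =>
    intro Δ hΔ hne hsurj hcl P hPc hP hroot
    -- If every point of `Z` is a multiple root, the normalised derivative is a monic polynomial of
    -- degree `d` still vanishing on `Z`.
    by_cases hcase : ∀ y ∈ Δ, ∀ t, (y, t) ∈ Z → (P y).derivative.eval t = 0
    · refine ih hΔ hne hsurj hcl (fun y => C ((d + 1 : ℂ)⁻¹) * (P y).derivative) ?_ ?_ ?_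
      · intro k
        simp only [coeff_C_mul, coeff_derivative]
        exact contDiffOn_const.mul ((hPc _).mul contDiffOn_const)
      · intro y hy
        obtain ⟨hm, hd⟩ := hP y hy
        have h0 : (d + 1 : ℂ) ≠ 0 := by exact_mod_cast Nat.succ_ne_zero d
        have h1 : (P y).derivative.natDegree = d := by
          rw [natDegree_derivative, hd, Nat.add_sub_cancel]
        have h2 : (C ((d + 1 : ℂ)⁻¹) * (P y).derivative).natDegree = d := by
          rw [natDegree_C_mul (inv_ne_zero h0), h1]
        refine ⟨?_, h2⟩
        rw [Monic, leadingCoeff, h2, coeff_C_mul, coeff_derivative, ← hd, hm.coeff_natDegree,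
          one_mul, inv_mul_cancel₀ h0]
      · intro y hy t ht
        rw [eval_mul, hcase y hy t ht, mul_zero]
    · push Not at hcase
      obtain ⟨y₀, hy₀, t₀, ht₀, hder⟩ := hcase
      obtain ⟨Δ', B, φ, hΔ', hyΔ', hsub, hB, hφ, hφB, hiff⟩ :=
        exists_implicit_root hΔ hPc (fun y hy => (hP y hy).2) hy₀ (hroot y₀ hy₀ t₀ ht₀) hder
      by_cases hfull : ∀ y ∈ Δ', (y, φ y) ∈ Z
      · refine ⟨Δ', B, φ, hΔ', ⟨y₀, hyΔ'⟩, hsub, hB, hφ, hφB, fun y hy t ht => ⟨fun h => ?_, ?_⟩⟩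
        · exact (hiff y hy t ht).1 (hroot y (hsub hy) t h)
        · rintro rfl; exact hfull y hy
      · push Not at hfull
        obtain ⟨y₁, hy₁, hy₁Z⟩ := hfull
        have hgr : ContinuousOn (fun y => (y, φ y)) Δ' := continuousOn_id.prodMk hφ.continuousOn
        -- The branch leaves `Z` over an open set of base points; there the linear factor `X - φ y`
        -- can be divided out without losing points of `Z`.
        set Δ₃ := Δ' ∩ (fun y => (y, φ y)) ⁻¹' {p : G × ℂ | p.1 ∈ Δ ∧ p ∉ Z} with hΔ₃def
        have hΔ₃ : IsOpen Δ₃ := hgr.isOpen_inter_preimage hΔ' hcl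
        have hsub₃ : Δ₃ ⊆ Δ := fun y hy => hsub hy.1
        have hPφ : ∀ y ∈ Δ₃, (P y).eval (φ y) = 0 := fun y hy =>
          (hiff y hy.1 _ (hφB y hy.1)).2 rfl
        obtain ⟨Δ₄, B₄, ψ, a1, a2, a3, a4, a5, a6, a7⟩ := ih hΔ₃ ⟨y₁, hy₁, hsub hy₁, hy₁Z⟩
          (fun y hy => hsurj y (hsub₃ hy)) (by
            have : {p : G × ℂ | p.1 ∈ Δ₃ ∧ p ∉ Z} = (Δ₃ ×ˢ univ) ∩ {p | p.1 ∈ Δ ∧ p ∉ Z} := by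
              ext p
              simp only [mem_ofPred_eq, mem_inter_iff, mem_prod, mem_univ, and_true]
              exact ⟨fun h => ⟨h.1, hsub₃ h.1, h.2⟩, fun h => ⟨h.1, h.2.2⟩⟩
            rw [this]
            exact (hΔ₃.prod isOpen_univ).inter hcl)
          (fun y => P y /ₘ (X - C (φ y))) (fun k => by
            refine ContDiffOn.congr (f := fun y => ∑ i ∈ Finset.Icc (k + 1) (d + 1),
              φ y ^ (i - (k + 1)) * (P y).coeff i) ?_ (fun y hy => ?_)
            · exact ContDiffOn.sum fun i _ => ((hφ.mono inter_subset_left).pow _).mul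
                ((hPc i).mono hsub₃)
            · rw [coeff_divByMonic_X_sub_C, (hP y (hsub₃ hy)).2])
          (fun y hy => by
            obtain ⟨hm, hd⟩ := hP y (hsub₃ hy)
            refine ⟨?_, ?_⟩
            · rw [Monic, leadingCoeff_divByMonic_of_monic (monic_X_sub_C _), hm]
              rw [degree_X_sub_C, degree_eq_natDegree hm.ne_zero, hd]
              exact_mod_cast Nat.le_add_left 1 d
            · rw [natDegree_divByMonic _ (monic_X_sub_C _), hd, natDegree_X_sub_C,
                Nat.add_sub_cancel])
          (fun y hy t ht => by
            have h1 := hroot y (hsub₃ hy) t ht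
            rw [← mul_divByMonic_eq_iff_isRoot.2 (hPφ y hy), eval_mul] at h1
            refine (mul_eq_zero.1 h1).resolve_left fun h2 => ?_
            rw [eval_sub, eval_X, eval_C, sub_eq_zero] at h2
            subst h2
            exact hy.2.2 ht)
        exact ⟨Δ₄, B₄, ψ, a1, a2, a3.trans hsub₃, a4, a5, a6, a7⟩

end LocalSections


open Set Filter Topology Metric Polynomial

/-! ### Projection along one coordinate: dimension and fibres -/

section Charts

variable {E E' F : Type*} [NormedAddCommGroup E] [NormedSpace ℂ E]
  [NormedAddCommGroup E'] [NormedSpace ℂ E'] [NormedAddCommGroup F] [NormedSpace ℂ F]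

/-- Some nonempty relatively open part of `X` is a graph-like `k`-dimensional submanifold. -/
def HasChart (k : ℕ) (X : Set E) : Prop :=
  ∃ (Δ : Set (Fin k → ℂ)) (W : Set E) (σ : (Fin k → ℂ) → E) (π : E →L[ℂ] (Fin k → ℂ)),
    IsOpen Δ ∧ Δ.Nonempty ∧ IsOpen W ∧ ContDiffOn ℂ 1 σ Δ ∧ (∀ y ∈ Δ, π (σ y) = y) ∧
      X ∩ W = σ '' Δ

theorem HasChart.preimage {k : ℕ} {X : Set E'} (e : E ≃L[ℂ] E') (h : HasChart k X) :
    HasChart k (e ⁻¹' X) := by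
  obtain ⟨Δ, W, σ, π, hΔ, hne, hW, hσ, hπ, hX⟩ := h
  refine ⟨Δ, e ⁻¹' W, e.symm ∘ σ, π.comp (e : E →L[ℂ] E'), hΔ, hne, hW.preimage e.continuous,
    e.symm.contDiff.comp_contDiffOn hσ, fun y hy => by simpa using hπ y hy, ?_⟩
  rw [← preimage_inter, hX, image_comp, ContinuousLinearEquiv.image_symm_eq_preimage]

theorem continuousOn_eval_family {k : ℕ} {Δ : Set (Fin k → ℂ)} {Q : (Fin k → ℂ) → ℂ[X]} {e : ℕ}
    (hQ : ∀ j, ContDiffOn ℂ 1 (fun y => (Q y).coeff j) Δ) (he : ∀ y ∈ Δ, (Q y).natDegree ≤ e) :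
    ContinuousOn (fun p : (Fin k → ℂ) × ℂ => (Q p.1).eval p.2) (Δ ×ˢ univ) := by
  refine ContinuousOn.congr (f := fun p : (Fin k → ℂ) × ℂ =>
    ∑ j ∈ Finset.range (e + 1), (Q p.1).coeff j * p.2 ^ j) ?_ ?_
  · refine continuousOn_finsetSum _ fun j _ => ContinuousOn.mul ?_ (by fun_prop)
    exact (hQ j).continuousOn.comp continuousOn_fst (fun p hp => hp.1)
  · intro p hp
    exact eval_eq_sum_range' (Nat.lt_succ_of_le (he _ hp.1)) _

/-- A chart of the projected set lifts because the cover above it has a local section over a smaller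
open set; hence a dimension bound descends to the projection. Fibres are counted by the roots of the
Weierstrass polynomial. -/
theorem exists_projection_step {V : Set (F × ℂ)} (hV : IsOpen V) (h0 : (0, 0) ∈ V) {ι : Type}
    (h : ι → F × ℂ → ℂ) (hh : ∀ i, ContDiffOn ℂ 1 (h i) V)
    (hne : ∃ i, ∃ᶠ t in 𝓝 (0 : ℂ), h i (0, t) ≠ 0) :
    ∃ (d : ℕ) (ρ : ℝ) (Ω : Set F) (κ : Type) (R : κ → F → ℂ),
      0 < ρ ∧ IsOpen Ω ∧ 0 ∈ Ω ∧ (∀ s, ContDiffOn ℂ 1 (R s) Ω) ∧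
      (∀ k, HasChart k {y | y ∈ Ω ∧ ∀ s, R s y = 0} → HasChart k {p | p ∈ V ∧ ∀ i, h i p = 0}) ∧
      (∀ p, p.1 ∈ Ω → ‖p.2‖ < ρ → (∀ i, h i p = 0) → ∀ s, R s p.1 = 0) ∧
      ∀ y ∈ Ω, ∀ s : Finset (F × ℂ), (∀ p ∈ s, (∀ i, h i p = 0) ∧ ‖p.2‖ < ρ ∧ p.1 = y) →
        s.card ≤ d := by
  obtain ⟨i₀, hi₀⟩ := hne
  obtain ⟨d, e, ρ, Ω, P, r, hρ, hΩ, h0Ω, hsub, hPc, hP, hrc, hr, hiff⟩ :=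
    exists_weierstrass_form hV h0 h hh i₀ hi₀
  obtain ⟨R, hRc, hR⟩ := exists_elimination hPc hP hrc hr
  refine ⟨d, ρ, Ω, _, R, hρ, hΩ, h0Ω, hRc, ?_, ?_, ?_⟩
  · rintro k ⟨Δ, W, σ, π, hΔ, hΔne, hW, hσ, hπ, hX⟩
    have hσX : ∀ y ∈ Δ, (σ y ∈ Ω ∧ ∀ s, R s (σ y) = 0) ∧ σ y ∈ W := fun y hy => by
      have : σ y ∈ {y | y ∈ Ω ∧ ∀ s, R s y = 0} ∩ W := hX ▸ mem_image_of_mem σ hy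
      exact this
    have hσΩ : MapsTo σ Δ Ω := fun y hy => (hσX y hy).1.1
    let Z : Set ((Fin k → ℂ) × ℂ) :=
      {p | (P (σ p.1)).eval p.2 = 0 ∧ ∀ i, (r i (σ p.1)).eval p.2 = 0}
    obtain ⟨Δ', B, φ, hΔ', hΔ'ne, hsub', hB, hφ, hφB, hZ⟩ := exists_local_section (Z := Z) d hΔ hΔne
      (fun y hy => (hR _ (hσΩ hy)).1 (hσX y hy).1.2)
      (by
        have h1 := continuousOn_eval_family (Q := fun y => P (σ y)) (e := d)
          (fun j => (hPc j).comp hσ hσΩ) (fun y hy => (hP _ (hσΩ hy)).2.le)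
        have h2 := fun i => continuousOn_eval_family (Q := fun y => r i (σ y)) (e := e)
          (fun j => (hrc i j).comp hσ hσΩ) (fun y hy => hr i _)
        have hU : IsOpen (Δ ×ˢ (univ : Set ℂ)) := hΔ.prod isOpen_univ
        have h3 : {p : (Fin k → ℂ) × ℂ | p.1 ∈ Δ ∧ p ∉ Z} =
            ((Δ ×ˢ univ) ∩ (fun p : (Fin k → ℂ) × ℂ => (P (σ p.1)).eval p.2) ⁻¹' {0}ᶜ) ∪
            ⋃ i, ((Δ ×ˢ univ) ∩ (fun p : (Fin k → ℂ) × ℂ => (r i (σ p.1)).eval p.2) ⁻¹' {0}ᶜ) := by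
          ext p
          simp only [Z, mem_ofPred_eq, not_and_or, not_forall, mem_union, mem_inter_iff, mem_prod,
            mem_univ, and_true, mem_preimage, mem_compl_iff, mem_singleton_iff, mem_iUnion,
            exists_and_left]
          tauto
        rw [h3]
        exact (h1.isOpen_inter_preimage hU isOpen_compl_singleton).union
          (isOpen_iUnion fun i => (h2 i).isOpen_inter_preimage hU isOpen_compl_singleton))
      (fun y => P (σ y)) (fun j => (hPc j).comp hσ hσΩ) (fun y hy => hP _ (hσΩ hy))
      (fun y _ t ht => ht.1)
    refine ⟨Δ', ((Ω ×ˢ ball 0 ρ) ∩ (W ×ˢ B)) ∩ (fun p => π p.1) ⁻¹' Δ', fun y => (σ y, φ y),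
      π.comp (ContinuousLinearMap.fst ℂ F ℂ), hΔ', hΔ'ne,
      ((hΩ.prod isOpen_ball).inter (hW.prod hB)).inter (hΔ'.preimage (by fun_prop)),
      (hσ.mono hsub').prodMk hφ, fun y hy => hπ y (hsub' hy), ?_⟩
    ext ⟨x, t⟩
    constructor
    · rintro ⟨⟨-, hi⟩, ⟨⟨hxΩ, htρ⟩, hxW, htB⟩, hxΔ⟩
      rw [mem_ball_zero_iff] at htρ
      have h1 := (hiff x hxΩ t).1 ⟨htρ, hi⟩
      have h2 : x ∈ {y | y ∈ Ω ∧ ∀ s, R s y = 0} ∩ W := ⟨⟨hxΩ, (hR x hxΩ).2 ⟨t, h1⟩⟩, hxW⟩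
      rw [hX] at h2
      obtain ⟨y, hy, rfl⟩ := h2
      have hy' : y ∈ Δ' := by
        have : π (σ y) ∈ Δ' := hxΔ
        rwa [hπ y hy] at this
      exact ⟨y, hy', Prod.ext rfl ((hZ y hy' t htB).1 h1).symm⟩
    · rintro ⟨y, hy, hyx⟩
      obtain ⟨rfl, rfl⟩ := Prod.mk.inj hyx
      have h1 : (y, φ y) ∈ Z := (hZ y hy _ (hφB y hy)).2 rfl
      have hy' := hsub' hy
      obtain ⟨h2, h3⟩ := (hiff _ (hσΩ hy') _).2 h1
      have h4 : (σ y, φ y) ∈ Ω ×ˢ ball (0 : ℂ) ρ := ⟨hσΩ hy', mem_ball_zero_iff.2 h2⟩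
      refine ⟨⟨hsub h4, h3⟩, ⟨h4, (hσX y hy').2, hφB y hy⟩, ?_⟩
      change π (σ y) ∈ Δ'
      rwa [hπ y hy']
  · rintro ⟨y, t⟩ hy ht hi
    exact (hR y hy).2 ⟨t, (hiff y hy t).1 ⟨ht, hi⟩⟩
  · intro y hy s hs
    obtain ⟨hm, hd⟩ := hP y hy
    rw [← hd]
    refine le_trans ?_ ((P y).card_roots')
    refine le_trans ?_ (Multiset.toFinset_card_le _)
    refine Finset.card_le_card_of_injOn Prod.snd (fun p hp => ?_) (fun p hp q hq hpq => ?_)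
    · obtain ⟨h1, h2, h3⟩ := hs p hp
      have h4 := ((hiff y hy p.2).1 ⟨h2, fun i => by rw [← h3]; exact h1 i⟩).1
      simpa [hm.ne_zero] using h4
    · exact Prod.ext ((hs p hp).2.2.trans (hs q hq).2.2.symm) hpq

end Charts

/-! ### Choosing finitely many directions of projection -/

section Directions

/-- Take a point `x` of `G` and its small shifts along the coordinate axes. Differences of these
vectors recover the standard basis, so no functional is small on all of them relative to its norm.
-/
theorem exists_spanning_directions {l : ℕ} {G : Set (Fin l → ℂ)} (hG : IsOpen G)
    (hne : G.Nonempty) : ∃ (S : Finset (Fin l → ℂ)) (c : ℝ), (∀ v ∈ S, v ∈ G) ∧ 0 ≤ c ∧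
      ∀ φ : (Fin l → ℂ) →ₗ[ℂ] ℂ, ∃ v ∈ S, ∀ p, ‖φ p‖ ≤ c * ‖φ v‖ * ‖p‖ := by
  classical
  obtain ⟨x, hx⟩ := hne
  obtain ⟨ε, hε, hb⟩ := Metric.isOpen_iff.1 hG x hx
  set δ : ℂ := ((ε / 2 : ℝ) : ℂ) with hδ
  have hδn : ‖δ‖ = ε / 2 := by rw [hδ, Complex.norm_real, Real.norm_of_nonneg (by positivity)]
  have hδ0 : δ ≠ 0 := by rw [← norm_ne_zero_iff, hδn]; positivity
  let w : Fin l → Fin l → ℂ := fun k => x + δ • Pi.single k 1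
  have hw : ∀ k, w k ∈ G := fun k => hb (by
    rw [mem_ball, dist_eq_norm, add_sub_cancel_left, norm_smul, hδn, Pi.norm_single]
    simp; linarith)
  refine ⟨insert x (Finset.univ.image w), l * (2 / (ε / 2)), ?_, by positivity, fun φ => ?_⟩
  · intro v hv
    rcases Finset.mem_insert.1 hv with rfl | hv
    · exact hx
    · obtain ⟨k, -, rfl⟩ := Finset.mem_image.1 hv
      exact hw k
  · obtain ⟨v, hv, hmax⟩ := Finset.exists_max_image (insert x (Finset.univ.image w))
      (fun v => ‖φ v‖) ⟨x, Finset.mem_insert_self _ _⟩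
    refine ⟨v, hv, fun p => ?_⟩
    have h1 : ∀ k, ‖φ (Pi.single k 1)‖ ≤ 2 / (ε / 2) * ‖φ v‖ := fun k => by
      have h2 : φ (Pi.single k 1) = δ⁻¹ * (φ (w k) - φ x) := by
        simp only [w, map_add, map_smul, smul_eq_mul]
        field_simp
        ring
      rw [h2, norm_mul, norm_inv, hδn]
      have h3 := norm_sub_le (φ (w k)) (φ x)
      have h4 := hmax (w k) (Finset.mem_insert_of_mem (Finset.mem_image_of_mem _ (Finset.mem_univ k)))
      have h5 := hmax x (Finset.mem_insert_self _ _)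
      calc (ε / 2)⁻¹ * ‖φ (w k) - φ x‖ ≤ (ε / 2)⁻¹ * (2 * ‖φ v‖) := by
            gcongr; linarith
        _ = _ := by ring
    calc ‖φ p‖ = ‖∑ k, p k * φ (Pi.single k 1)‖ := by
          conv_lhs => rw [LinearMap.pi_apply_eq_sum_univ φ p]
          simp only [smul_eq_mul]
          congr 1
          refine Finset.sum_congr rfl fun k _ => ?_
          congr 2
          ext j
          simp [Pi.single_apply, eq_comm]
      _ ≤ ∑ _k : Fin l, ‖p‖ * (2 / (ε / 2) * ‖φ v‖) := by
          refine (norm_sum_le _ _).trans (Finset.sum_le_sum fun k _ => ?_)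
          rw [norm_mul]
          gcongr
          · exact norm_le_pi_norm p k
          · exact h1 k
      _ = _ := by simp; ring

theorem exists_straightening {l : ℕ} {v : Fin (l + 1) → ℂ} (hv : v ≠ 0) :
    ∃ e : (Fin (l + 1) → ℂ) ≃L[ℂ] (Fin l → ℂ) × ℂ, e v = (0, 1) := by
  let e₀ : (Fin (l + 1) → ℂ) ≃L[ℂ] (Fin l → ℂ) × ℂ :=
    ContinuousLinearEquiv.ofFinrankEq (by simp)
  obtain ⟨A, hA⟩ := SeparatingDual.exists_continuousLinearEquiv_apply_eq (R := ℂ) (x := e₀ v)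
    (y := ((0 : Fin l → ℂ), (1 : ℂ))) (by simpa using hv) (by simp)
  exact ⟨e₀.trans A, hA⟩

/-- A vector of `ker φ` is determined by its projection along `v`: its `v`-component is fixed by `φ
p = 0`, and is controlled because `φ v` is comparable to the norm of `φ`. -/
theorem norm_le_of_functional {E F : Type*} [NormedAddCommGroup E] [NormedSpace ℂ E]
    [NormedAddCommGroup F] [NormedSpace ℂ F] (e : E ≃L[ℂ] F × ℂ) {v : E} (hv : e v = (0, 1))
    (φ : E →ₗ[ℂ] ℂ) (hφ : φ ≠ 0) {c : ℝ} (hc : ∀ p, ‖φ p‖ ≤ c * ‖φ v‖ * ‖p‖) (hc0 : 0 ≤ c)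
    {p : E} (hp : φ p = 0) :
    ‖p‖ ≤ ‖(e.symm : F × ℂ →L[ℂ] E)‖ * (1 + c * ‖(e.symm : F × ℂ →L[ℂ] E)‖) * ‖(e p).1‖ := by
  set M := ‖(e.symm : F × ℂ →L[ℂ] E)‖ with hM
  have hφv : φ v ≠ 0 := fun h => hφ (by
    ext q
    have h2 := hc q
    rw [h, norm_zero, mul_zero, zero_mul] at h2
    simpa using h2)
  set y := (e p).1 with hy
  set t := (e p).2 with ht
  have hb : ∀ z, ‖e.symm z‖ ≤ M * ‖z‖ := fun z => (e.symm : F × ℂ →L[ℂ] E).le_opNorm z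
  have h1 : p = e.symm (y, 0) + t • v := by
    apply e.injective
    rw [map_add, map_smul, e.apply_symm_apply, hv]
    ext <;> simp [hy, ht]
  have h2 : ‖t‖ ≤ c * M * ‖y‖ := by
    have h3 : t * φ v = -φ (e.symm (y, 0)) := by
      rw [h1, map_add, map_smul, smul_eq_mul] at hp
      linear_combination hp
    have h4 : ‖t‖ * ‖φ v‖ ≤ (c * M * ‖y‖) * ‖φ v‖ := by
      rw [← norm_mul, h3, norm_neg]
      refine (hc _).trans ?_
      have h5 := hb (y, 0)
      rw [Prod.norm_mk, norm_zero, max_eq_left (norm_nonneg y)] at h5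
      calc c * ‖φ v‖ * ‖e.symm (y, 0)‖ ≤ c * ‖φ v‖ * (M * ‖y‖) := by gcongr
        _ = _ := by ring
    exact le_of_mul_le_mul_right h4 (norm_pos_iff.2 hφv)
  have h6 : p = e.symm (y, t) := by rw [hy, ht, Prod.mk.eta, e.symm_apply_apply]
  have hM0 : 0 ≤ M := norm_nonneg _
  calc ‖p‖ ≤ M * ‖(y, t)‖ := by rw [h6]; simpa using hb (y, t)
    _ ≤ M * ((1 + c * M) * ‖y‖) := by
        gcongr
        rw [Prod.norm_mk]
        refine max_le ?_ ?_
        · nlinarith [mul_nonneg (mul_nonneg hc0 hM0) (norm_nonneg y)]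
        · nlinarith [norm_nonneg y]
    _ = _ := by ring

end Directions


open Set Filter Topology Metric

/-! ### Finite, uniformly transverse projections to `ℂ^n` -/

section Projections

variable {E : Type*} [NormedAddCommGroup E] [NormedSpace ℂ E]

/-- Near `0`, finitely many linear projections to `ℂ^n` have uniformly finite fibres on `X`, and
every subspace of dimension at most `n` is uniformly transverse to one of them. -/
def HasGoodProjections (n : ℕ) (X : Set E) : Prop :=
  ∃ U ∈ 𝓝 (0 : E), ∃ (D : ℕ) (𝓕 : Set (E →L[ℂ] (Fin n → ℂ))), 𝓕.Finite ∧
    (∀ π ∈ 𝓕, ∀ y, ∀ s : Finset E, (∀ x ∈ s, x ∈ U ∧ x ∈ X ∧ π x = y) → s.card ≤ D) ∧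
    ∃ C : ℝ, 0 ≤ C ∧ ∀ P : Submodule ℂ E, Module.finrank ℂ P ≤ n →
      ∃ π ∈ 𝓕, ∀ p ∈ P, ‖p‖ ≤ C * ‖π p‖

theorem hasGoodProjections_of_le {l n : ℕ} (hln : l ≤ n) (X : Set (Fin l → ℂ)) :
    HasGoodProjections n X := by
  obtain ⟨f, hf⟩ : ∃ f : (Fin l → ℂ) →ₗ[ℂ] (Fin n → ℂ), Function.Injective f :=
    ⟨Function.ExtendByZero.linearMap ℂ (Fin.castLE hln), fun a b hab => funext fun i => by
      have h1 := congrFun hab (Fin.castLE hln i)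
      simpa [Function.ExtendByZero.linearMap_apply,
        (Fin.castLE_injective hln).extend_apply] using h1⟩
  obtain ⟨K, -, hK⟩ := f.exists_antilipschitzWith (LinearMap.ker_eq_bot.2 hf)
  refine ⟨univ, univ_mem, 1, {LinearMap.toContinuousLinearMap f}, finite_singleton _, ?_,
    K, K.2, fun P _ => ⟨_, rfl, fun p _ => ?_⟩⟩
  · rintro π rfl y s hs
    refine Finset.card_le_one.2 fun a ha b hb => hf ?_
    exact (hs a ha).2.2.trans (hs b hb).2.2.symm
  · simpa using hK.le_mul_dist p 0

/-- The identity theorem on the complex line through `0` and `x`, whose intersection with the ball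
is convex and contains the parameters `0` and `1`. -/
theorem frequently_ne_zero_on_line {V : Set E} {r : ℝ} (hr : ball 0 r ⊆ V) {f : E → ℂ}
    (hf : DifferentiableOn ℂ f V) {x : E} (hx : x ∈ ball (0 : E) r) (hfx : f x ≠ 0) :
    ∃ᶠ t in 𝓝 (0 : ℂ), f (t • x) ≠ 0 := by
  intro hev
  simp only [not_not] at hev
  let L : ℂ →L[ℂ] E := ContinuousLinearMap.toSpanSingleton ℂ x
  set T : Set ℂ := L ⁻¹' ball 0 r with hT
  have hTo : IsOpen T := isOpen_ball.preimage L.continuous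
  have hTc : Convex ℝ T := (convex_ball (0 : E) r).is_linear_preimage
    ⟨fun a b => map_add L a b, fun c a => by
      rw [← Complex.coe_smul, ← Complex.coe_smul, map_smul]⟩
  have hd : AnalyticOnNhd ℂ (fun t => f (L t)) T := by
    refine DifferentiableOn.analyticOnNhd ?_ hTo
    exact hf.comp L.differentiable.differentiableOn (fun t ht => hr ht)
  have h0 : (0 : ℂ) ∈ T := by
    simp only [hT, mem_preimage, map_zero]
    exact mem_ball_self (pos_of_mem_ball hx)
  have h1 : (1 : ℂ) ∈ T := by simpa [hT, L] using hx
  have := hd.eqOn_zero_of_preconnected_of_eventuallyEq_zero hTc.isPreconnected h0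
    (by filter_upwards [hev] with t ht; simpa [L] using ht) h1
  exact hfx (by simpa [L] using this)

/-- The inductive step for one direction: project along `v`, then apply the hypothesis to the image.
Fibre bounds multiply, and transversality is kept relative to the image subspace. -/
theorem exists_projections_along {l n : ℕ}
    (ih : ∀ {V : Set (Fin l → ℂ)} (_ : IsOpen V) (_ : 0 ∈ V) {ι : Type}
      (h : ι → (Fin l → ℂ) → ℂ) (_ : ∀ i, ContDiffOn ℂ 1 (h i) V)
      (_ : ∀ k, HasChart k {p | p ∈ V ∧ ∀ i, h i p = 0} → k ≤ n),
      HasGoodProjections n {p | p ∈ V ∧ ∀ i, h i p = 0})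
    {V : Set (Fin (l + 1) → ℂ)} (hV : IsOpen V) (h0 : 0 ∈ V) {ι : Type}
    (h : ι → (Fin (l + 1) → ℂ) → ℂ) (hh : ∀ i, ContDiffOn ℂ 1 (h i) V)
    (hchart : ∀ k, HasChart k {p | p ∈ V ∧ ∀ i, h i p = 0} → k ≤ n)
    {v : Fin (l + 1) → ℂ} (hv : v ≠ 0) (hne : ∃ i, ∃ᶠ t in 𝓝 (0 : ℂ), h i (t • v) ≠ 0) :
    ∃ e : (Fin (l + 1) → ℂ) ≃L[ℂ] (Fin l → ℂ) × ℂ, e v = (0, 1) ∧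
    ∃ U ∈ 𝓝 (0 : Fin (l + 1) → ℂ), ∃ (D : ℕ) (𝓕 : Set ((Fin (l + 1) → ℂ) →L[ℂ] (Fin n → ℂ))),
      𝓕.Finite ∧
      (∀ π ∈ 𝓕, ∀ y, ∀ s : Finset (Fin (l + 1) → ℂ),
        (∀ x ∈ s, x ∈ U ∧ (∀ i, h i x = 0) ∧ π x = y) → s.card ≤ D) ∧
      ∃ C : ℝ, 0 ≤ C ∧ ∀ P : Submodule ℂ (Fin l → ℂ), Module.finrank ℂ P ≤ n →
        ∃ π ∈ 𝓕, ∀ p, (e p).1 ∈ P → ‖(e p).1‖ ≤ C * ‖π p‖ := by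
  classical
  obtain ⟨e, he⟩ := exists_straightening hv
  refine ⟨e, he, ?_⟩
  obtain ⟨d, ρ, Ω, κ, R, hρ, hΩ, h0Ω, hRc, hlift, hproj, hcard⟩ := exists_projection_step
    (V := e.symm ⁻¹' V) (hV.preimage e.symm.continuous) (by
      change e.symm 0 ∈ V
      simpa using h0)
    (fun i p => h i (e.symm p))
    (fun i => (hh i).comp e.symm.contDiff.contDiffOn (fun p hp => hp)) (by
      obtain ⟨i, hi⟩ := hne
      refine ⟨i, hi.mono fun t ht => ?_⟩
      have h1 : e.symm (0, t) = t • v := by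
        apply e.injective
        rw [e.apply_symm_apply, map_smul, he]
        simp
      rwa [h1])
  obtain ⟨U, hU, D, 𝓕, h𝓕, hfib, C, hC, htr⟩ := ih hΩ h0Ω R hRc (fun k hk => by
    refine hchart k ?_
    have := (hlift k hk).preimage e
    simpa [preimage] using this)
  let p₁ : (Fin (l + 1) → ℂ) →L[ℂ] (Fin l → ℂ) :=
    (ContinuousLinearMap.fst ℂ _ _).comp (e : (Fin (l + 1) → ℂ) →L[ℂ] (Fin l → ℂ) × ℂ)
  have hp₁ : ∀ x, p₁ x = (e x).1 := fun x => rfl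
  refine ⟨e ⁻¹' ((U ∩ Ω) ×ˢ ball 0 ρ), ?_, d * D, (fun π => π.comp p₁) '' 𝓕, h𝓕.image _, ?_,
    C, hC, ?_⟩
  · refine e.continuous.continuousAt.preimage_mem_nhds ?_
    rw [map_zero]
    exact prod_mem_nhds (inter_mem hU (hΩ.mem_nhds h0Ω)) (ball_mem_nhds _ hρ)
  · rintro _ ⟨π, hπ, rfl⟩ y s hs
    refine (Finset.card_le_mul_card_image (f := p₁) s d ?_).trans ?_
    · intro b hb
      obtain ⟨x, hx, rfl⟩ := Finset.mem_image.1 hb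
      rw [← Finset.card_image_of_injective _ e.injective]
      refine hcard (p₁ x) (hs x hx).1.1.2 _ fun q hq => ?_
      obtain ⟨z, hz, rfl⟩ := Finset.mem_image.1 hq
      obtain ⟨hz, hzx⟩ := Finset.mem_filter.1 hz
      refine ⟨fun i => ?_, mem_ball_zero_iff.1 (hs z hz).1.2, hzx⟩
      rw [e.symm_apply_apply]
      exact (hs z hz).2.1 i
    · refine Nat.mul_le_mul_left d (hfib π hπ y _ fun q hq => ?_)
      obtain ⟨z, hz, rfl⟩ := Finset.mem_image.1 hq
      obtain ⟨h1, h2, h3⟩ := hs z hz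
      refine ⟨h1.1.1, ⟨h1.1.2, hproj (e z) h1.1.2 (mem_ball_zero_iff.1 h1.2) fun i => ?_⟩, h3⟩
      rw [e.symm_apply_apply]
      exact h2 i
  · intro P hP
    obtain ⟨π, hπ, hb⟩ := htr P hP
    exact ⟨_, mem_image_of_mem _ hπ, fun p hp => hb _ hp⟩

theorem hasChart_of_mem_nhds {l : ℕ} {X U : Set (Fin l → ℂ)} (hU : U ∈ 𝓝 0) (hUX : U ⊆ X) :
    HasChart l X := by
  obtain ⟨O, hOU, hO, h0⟩ := _root_.mem_nhds_iff.1 hU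
  refine ⟨O, O, id, ContinuousLinearMap.id ℂ _, hO, ⟨0, h0⟩, hO, contDiff_id.contDiffOn,
    fun y _ => rfl, ?_⟩
  rw [image_id]
  exact inter_eq_self_of_subset_right (hOU.trans hUX)

/-- If the ambient dimension exceeds `n`, some equation is nontrivial near `0`, since otherwise an
open set would be a chart of too large dimension. A subspace of dimension at most `n` lies in the
kernel of some functional, and one of finitely many directions is uniformly transverse to that
kernel. -/
theorem hasGoodProjections {n : ℕ} (l : ℕ) : ∀ {V : Set (Fin l → ℂ)} (_ : IsOpen V) (_ : 0 ∈ V)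
    {ι : Type} (h : ι → (Fin l → ℂ) → ℂ) (_ : ∀ i, ContDiffOn ℂ 1 (h i) V)
    (_ : ∀ k, HasChart k {p | p ∈ V ∧ ∀ i, h i p = 0} → k ≤ n),
    HasGoodProjections n {p | p ∈ V ∧ ∀ i, h i p = 0} := by
  induction l with
  | zero => intros; exact hasGoodProjections_of_le (Nat.zero_le n) _
  | succ l ih =>
    intro V hV h0 ι h hh hchart
    by_cases hln : l + 1 ≤ n
    · exact hasGoodProjections_of_le hln _
    obtain ⟨r, hr, hrV⟩ := Metric.isOpen_iff.1 hV 0 h0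
    have hex : ∃ x ∈ ball (0 : Fin (l + 1) → ℂ) r, ∃ i, h i x ≠ 0 := by
      by_contra! hcon
      exact hln (hchart _ (hasChart_of_mem_nhds (ball_mem_nhds 0 hr)
        fun x hx => ⟨hrV hx, fun i => hcon x hx i⟩))
    obtain ⟨x, hxr, i, hix⟩ := hex
    -- An open set of admissible directions: `h i` does not vanish identically along them, and the
    -- zero vector, which is no direction, is removed.
    let G : Set (Fin (l + 1) → ℂ) := (ball 0 r ∩ h i ⁻¹' {0}ᶜ) ∩ {0}ᶜ
    have hG₀ : IsOpen (ball 0 r ∩ h i ⁻¹' {0}ᶜ) :=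
      ((hh i).continuousOn.mono hrV).isOpen_inter_preimage isOpen_ball isOpen_compl_singleton
    have hG : IsOpen G := hG₀.inter isOpen_compl_singleton
    have hGne : G.Nonempty :=
      (dense_compl_singleton (0 : Fin (l + 1) → ℂ)).inter_open_nonempty _ hG₀ ⟨x, hxr, hix⟩
    obtain ⟨S, c, hSG, hc, hS⟩ := exists_spanning_directions hG hGne
    have hdir : ∀ v : S, _ := fun v => exists_projections_along ih hV h0 h hh hchart
      (v := v) (hSG v v.2).2 ⟨i, frequently_ne_zero_on_line hrV ((hh i).differentiableOn one_ne_zero)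
        (hSG v v.2).1.1 (hSG v v.2).1.2⟩
    choose e he U hU D 𝓕 h𝓕 hfib C hC htr using hdir
    let M : S → ℝ := fun v => ‖((e v).symm : (Fin l → ℂ) × ℂ →L[ℂ] (Fin (l + 1) → ℂ))‖ *
      (1 + c * ‖((e v).symm : (Fin l → ℂ) × ℂ →L[ℂ] (Fin (l + 1) → ℂ))‖)
    have hM : ∀ v, 0 ≤ M v := fun v => by positivity
    refine ⟨⋂ v, U v, iInter_mem.2 hU, ∑ v, D v, ⋃ v, 𝓕 v, finite_iUnion h𝓕, ?_,
      ∑ v, M v * C v, Finset.sum_nonneg fun v _ => mul_nonneg (hM v) (hC v), ?_⟩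
    · intro π hπ y s hs
      obtain ⟨v, hv⟩ := mem_iUnion.1 hπ
      refine (hfib v π hv y s fun x hx => ?_).trans
        (Finset.single_le_sum (f := D) (fun _ _ => Nat.zero_le _) (Finset.mem_univ v))
      obtain ⟨h1, h2, h3⟩ := hs x hx
      exact ⟨mem_iInter.1 h1 v, h2.2, h3⟩
    · intro P hP
      have hPtop : P < ⊤ := by
        rw [lt_top_iff_ne_top]
        rintro rfl
        rw [finrank_top, Module.finrank_fin_fun] at hP
        exact hln hP
      obtain ⟨φ, hφ, hPφ⟩ := Submodule.exists_le_ker_of_lt_top P hPtop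
      obtain ⟨v, hvS, hv⟩ := hS φ
      obtain ⟨π, hπ, hb⟩ := htr ⟨v, hvS⟩ (P.map ((LinearMap.fst ℂ _ _).comp
        ((e ⟨v, hvS⟩).toLinearEquiv : (Fin (l + 1) → ℂ) →ₗ[ℂ] (Fin l → ℂ) × ℂ)))
        ((Submodule.finrank_map_le _ _).trans hP)
      refine ⟨π, mem_iUnion.2 ⟨⟨v, hvS⟩, hπ⟩, fun p hp => ?_⟩
      have h1 := norm_le_of_functional (e ⟨v, hvS⟩) (he ⟨v, hvS⟩) φ hφ hv hc (hPφ hp)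
      have h2 := hb p (Submodule.mem_map_of_mem hp)
      calc ‖p‖ ≤ M ⟨v, hvS⟩ * (C ⟨v, hvS⟩ * ‖π p‖) :=
            h1.trans (mul_le_mul_of_nonneg_left h2 (hM _))
        _ = M ⟨v, hvS⟩ * C ⟨v, hvS⟩ * ‖π p‖ := by ring
        _ ≤ _ := by
          refine mul_le_mul_of_nonneg_right ?_ (norm_nonneg _)
          exact Finset.single_le_sum (f := fun v => M v * C v)
            (fun v _ => mul_nonneg (hM v) (hC v)) (Finset.mem_univ _)

end Projections


open Set Filter Topology Metric

/-! ### Regular points, tangent spaces and local inverses of projections -/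

section RegularPoints

variable {N n : ℕ} {X : Set (CSpace N)}

/-- `X` is locally closed: it is a difference of two open sets. -/
theorem IsAnalyticVariety.measurableSet (hX : IsAnalyticVariety X) : MeasurableSet X := by
  choose! V hV hxV m h hh hXV using hX
  have h1 : ∀ x ∈ X, IsOpen (V x \ X) := fun x hx => by
    have h2 : V x \ X = V x ∩ h x ⁻¹' {0}ᶜ := by
      ext y
      constructor
      · rintro ⟨hy, hyX⟩
        refine ⟨hy, fun h3 => hyX ?_⟩
        have : y ∈ X ∩ V x := by rw [hXV x hx]; exact ⟨hy, h3⟩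
        exact this.1
      · rintro ⟨hy, hy0⟩
        refine ⟨hy, fun hyX => hy0 ?_⟩
        have : y ∈ X ∩ V x := ⟨hyX, hy⟩
        rw [hXV x hx] at this
        exact this.2
    rw [h2]
    exact (hh x hx).continuousOn.isOpen_inter_preimage (hV x hx) isOpen_compl_singleton
  have h3 : X = (⋃ x ∈ X, V x) \ ⋃ x ∈ X, (V x \ X) := by
    ext y
    simp only [Set.mem_sdiff, mem_iUnion, not_exists, exists_prop, not_and, not_not]
    constructor
    · exact fun hy => ⟨⟨y, hy, hxV y hy⟩, fun x _ _ => hy⟩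
    · rintro ⟨⟨x, hx, hyx⟩, h⟩
      exact h x hx hyx
  rw [h3]
  exact ((isOpen_biUnion hV).measurableSet).diff (isOpen_biUnion h1).measurableSet

theorem regularPoints_subset : regularPoints n X ⊆ X := fun _ hx => hx.1

theorem measurableSet_regularPoints (hX : MeasurableSet X) :
    MeasurableSet (regularPoints n X) := by
  let G : Set (CSpace N) := {x | ∃ V : Set (CSpace N), IsOpen V ∧ x ∈ V ∧
    ∃ k : ℕ, n + k = N ∧ ∃ h : CSpace N → Fin k → ℂ,
      AnalyticOnNhd ℂ h V ∧ (∀ y ∈ V, Function.Surjective (fderiv ℂ h y)) ∧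
      X ∩ V = {y | y ∈ V ∧ h y = 0}}
  have hG : IsOpen G := isOpen_iff_mem_nhds.2 fun x ⟨V, hV, hxV, h⟩ =>
    Filter.mem_of_superset (hV.mem_nhds hxV) fun y hy => ⟨V, hV, hy, h⟩
  exact hX.inter hG.measurableSet

/-- The tangent space at a regular point, and the vanishing of differences to first order. -/
theorem exists_tangent_of_mem_regularPoints {a : CSpace N} (ha : a ∈ regularPoints n X) :
    ∃ (k : ℕ) (h : CSpace N → Fin k → ℂ) (A : CSpace N →L[ℂ] (Fin k → ℂ)) (V : Set (CSpace N)),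
      IsOpen V ∧ a ∈ V ∧ (∀ x ∈ X ∩ V, h x = 0) ∧ HasStrictFDerivAt h A a ∧
      Function.Surjective A ∧ Module.finrank ℂ (LinearMap.ker A.toLinearMap) = n := by
  obtain ⟨-, V, hV, haV, k, hk, h, hh, hs, hXV⟩ := ha
  refine ⟨k, h, fderiv ℂ h a, V, hV, haV, fun x hx => ?_, (hh a haV).hasStrictFDerivAt, hs a haV, ?_⟩
  · rw [hXV] at hx
    exact hx.2
  · have h1 := LinearMap.finrank_range_add_finrank_ker (fderiv ℂ h a).toLinearMap
    rw [LinearMap.range_eq_top.2 (hs a haV), finrank_top, Module.finrank_fin_fun,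
      finrank_euclideanSpace_fin] at h1
    omega

/-- By density the chart contains a regular point. There the derivative of the parametrisation is
injective, having a linear left inverse, and its image lies in the `n`-dimensional tangent space. -/
theorem IsPureDim.le_of_hasChart (hX : IsPureDim n X) {O : Set (CSpace N)} (hO : IsOpen O)
    (x : CSpace N) (e : CSpace N ≃L[ℂ] (Fin N → ℂ)) {k : ℕ}
    (hk : HasChart k {p : Fin N → ℂ | x + e.symm p ∈ X ∩ O}) : k ≤ n := by
  obtain ⟨Δ, W, σ, π, hΔ, ⟨y₁, hy₁⟩, hW, hσ, hπ, hXW⟩ := hk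
  let τ : (Fin k → ℂ) → CSpace N := fun y => x + e.symm (σ y)
  have hτ : ContDiffOn ℂ 1 τ Δ := contDiffOn_const.add (e.symm.contDiff.comp_contDiffOn hσ)
  have himg : ∀ b, b ∈ X → b ∈ O → e (b - x) ∈ W → ∃ y ∈ Δ, τ y = b := by
    intro b hbX hbO hbW
    have h1 : e (b - x) ∈ {p : Fin N → ℂ | x + e.symm p ∈ X ∩ O} ∩ W := by
      refine ⟨?_, hbW⟩
      change x + e.symm (e (b - x)) ∈ X ∩ O
      rw [e.symm_apply_apply, add_sub_cancel]
      exact ⟨hbX, hbO⟩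
    rw [hXW] at h1
    obtain ⟨y, hy, hyb⟩ := h1
    exact ⟨y, hy, by simp [τ, hyb]⟩
  have hτX : ∀ y ∈ Δ, τ y ∈ X ∩ O ∧ e (τ y - x) ∈ W := by
    intro y hy
    have h1 : σ y ∈ {p : Fin N → ℂ | x + e.symm p ∈ X ∩ O} ∩ W := hXW ▸ mem_image_of_mem σ hy
    refine ⟨h1.1, ?_⟩
    simpa [τ] using h1.2
  have hopen : IsOpen (O ∩ (fun b => e (b - x)) ⁻¹' W) :=
    hO.inter (hW.preimage (by fun_prop))
  obtain ⟨b, ⟨hbO, hbW⟩, hb⟩ := mem_closure_iff.1 (hX.subset_closure (hτX y₁ hy₁).1.1) _ hopen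
    ⟨(hτX y₁ hy₁).1.2, (hτX y₁ hy₁).2⟩
  obtain ⟨y, hy, rfl⟩ := himg b hb.1 hbO hbW
  obtain ⟨m, h, A, V, hV, haV, hzero, hA, -, hfin⟩ := exists_tangent_of_mem_regularPoints hb
  have hτd : HasFDerivAt τ (fderiv ℂ τ y) y :=
    ((hτ.contDiffAt (hΔ.mem_nhds hy)).differentiableAt one_ne_zero).hasFDerivAt
  have h1 : A.comp (fderiv ℂ τ y) = 0 := by
    refine (hA.hasFDerivAt.comp y hτd).unique ?_
    refine (hasFDerivAt_const (0 : Fin m → ℂ) y).congr_of_eventuallyEq ?_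
    filter_upwards [hΔ.mem_nhds hy, hτd.continuousAt.preimage_mem_nhds (hV.mem_nhds haV)]
      with z hz hzV
    exact hzero _ ⟨(hτX z hz).1.1, hzV⟩
  have h2 : (π.comp (e : CSpace N →L[ℂ] (Fin N → ℂ))).comp (fderiv ℂ τ y) =
      ContinuousLinearMap.id ℂ _ := by
    refine ((π.comp (e : CSpace N →L[ℂ] (Fin N → ℂ))).hasFDerivAt.comp y hτd).unique ?_
    refine ((hasFDerivAt_id (𝕜 := ℂ) y).const_add (π (e x))).congr_of_eventuallyEq ?_
    filter_upwards [hΔ.mem_nhds hy] with z hz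
    simp [τ, hπ z hz]
  have h3 : Function.Injective (fderiv ℂ τ y) := fun u v huv => by
    have h4 := congrArg (π.comp (e : CSpace N →L[ℂ] (Fin N → ℂ))) huv
    rw [← ContinuousLinearMap.comp_apply, ← ContinuousLinearMap.comp_apply, h2] at h4
    exact h4
  have h5 := LinearMap.finrank_le_finrank_of_injective
    (f := (fderiv ℂ τ y).toLinearMap.codRestrict (LinearMap.ker A.toLinearMap)
      (fun v => (DFunLike.congr_fun h1 v : A (fderiv ℂ τ y v) = 0))) (fun u v huv => h3 (congrArg Subtype.val huv))
  rw [hfin, Module.finrank_fin_fun] at h5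
  exact h5

theorem IsPureDim.exists_projections (hX : IsPureDim n X) {x : CSpace N} (hx : x ∈ X) :
    ∃ U : Set (CSpace N), IsOpen U ∧ x ∈ U ∧
      ∃ (D : ℕ) (𝓕 : Set (CSpace N →L[ℂ] (Fin n → ℂ))), 𝓕.Finite ∧
        (∀ π ∈ 𝓕, ∀ y, ∀ s : Finset (CSpace N), (∀ z ∈ s, z ∈ X ∩ U ∧ π z = y) → s.card ≤ D) ∧
        ∃ C : ℝ, 0 ≤ C ∧ ∀ P : Submodule ℂ (CSpace N), Module.finrank ℂ P ≤ n →
          ∃ π ∈ 𝓕, ∀ p ∈ P, ‖p‖ ≤ C * ‖π p‖ := by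
  classical
  obtain ⟨V, hV, hxV, m, h, hh, hXV⟩ := hX.isAnalyticVariety x hx
  let e : CSpace N ≃L[ℂ] (Fin N → ℂ) := EuclideanSpace.equiv (Fin N) ℂ
  let V' : Set (Fin N → ℂ) := (fun p => x + e.symm p) ⁻¹' V
  have hV' : IsOpen V' := hV.preimage (by fun_prop)
  have hset : {p : Fin N → ℂ | p ∈ V' ∧ ∀ i, h (x + e.symm p) i = 0} =
      {p | x + e.symm p ∈ X ∩ V} := by
    ext p
    simp only [mem_ofPred_eq, hXV, V', mem_preimage, funext_iff, Pi.zero_apply]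
  have hgood := hasGoodProjections (n := n) N hV' (by simpa [V'] using hxV)
    (fun (i : Fin m) p => h (x + e.symm p) i)
    (fun i => by
      have h1 : ContDiffOn ℂ 1 h V := hh.contDiffOn hV.uniqueDiffOn
      have h2 : ContDiffOn ℂ 1 (fun p => x + e.symm p) V' :=
        (contDiff_const.add e.symm.contDiff).contDiffOn
      exact contDiffOn_pi.1 (h1.comp h2 fun p hp => hp) i)
    (fun k hk => by
      rw [hset] at hk
      exact hX.le_of_hasChart hV x e hk)
  rw [hset] at hgood
  obtain ⟨U, hU, D, 𝓕, h𝓕, hfib, C, hC, htr⟩ := hgood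
  obtain ⟨U', hU'U, hU', h0U'⟩ := _root_.mem_nhds_iff.1 hU
  let e' : CSpace N →L[ℂ] (Fin N → ℂ) := e
  let e'' : (Fin N → ℂ) →L[ℂ] CSpace N := e.symm
  refine ⟨(fun z => e (z - x)) ⁻¹' U' ∩ V, (hU'.preimage (by fun_prop)).inter hV,
    ⟨by simpa using h0U', hxV⟩, D, (fun π => π.comp e') '' 𝓕, h𝓕.image _, ?_,
    ‖e''‖ * C, by positivity, ?_⟩
  · rintro _ ⟨π, hπ, rfl⟩ y s hs
    have hinj : Function.Injective (fun z => e (z - x)) := fun a b hab => by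
      simpa using e.injective hab
    rw [← Finset.card_image_of_injective s hinj]
    refine hfib π hπ (y - π (e x)) _ fun q hq => ?_
    obtain ⟨z, hz, rfl⟩ := Finset.mem_image.1 hq
    obtain ⟨⟨h1, h2, h3⟩, h4⟩ := hs z hz
    refine ⟨hU'U h2, ?_, ?_⟩
    · change x + e.symm (e (z - x)) ∈ X ∩ V
      rw [e.symm_apply_apply, add_sub_cancel]
      exact ⟨h1, h3⟩
    · rw [← h4, map_sub, map_sub]
      rfl
  · intro P hP
    obtain ⟨π, hπ, hb⟩ := htr (P.map (e'.toLinearMap)) ((Submodule.finrank_map_le _ _).trans hP)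
    refine ⟨_, mem_image_of_mem _ hπ, fun p hp => ?_⟩
    have h1 : p = e'' (e' p) := (e.symm_apply_apply p).symm
    calc ‖p‖ ≤ ‖e''‖ * ‖e' p‖ := by
          conv_lhs => rw [h1]
          exact e''.le_opNorm _
      _ ≤ ‖e''‖ * (C * ‖π (e' p)‖) := by
          gcongr
          exact hb _ (Submodule.mem_map_of_mem hp)
      _ = _ := by rw [mul_assoc]; rfl

/-- By strict differentiability, secants of `X` near `a` are nearly tangent, and `π` is bounded
below on the tangent space by `C⁻¹`. Doubling `C` absorbs the error, so the constant does not
degenerate as `a` approaches the singular set. -/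
theorem exists_local_antilipschitz {a : CSpace N} (ha : a ∈ regularPoints n X) {C : ℝ} (hC : 0 ≤ C)
    {𝓕 : Set (CSpace N →L[ℂ] (Fin n → ℂ))}
    (htr : ∀ P : Submodule ℂ (CSpace N), Module.finrank ℂ P ≤ n →
      ∃ π ∈ 𝓕, ∀ p ∈ P, ‖p‖ ≤ C * ‖π p‖) :
    ∃ π ∈ 𝓕, ∃ O : Set (CSpace N), IsOpen O ∧ a ∈ O ∧
      ∀ x ∈ X ∩ O, ∀ x' ∈ X ∩ O, ‖x - x'‖ ≤ 2 * C * ‖π x - π x'‖ := by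
  obtain ⟨m, h, A, V, hV, haV, hzero, hA, hsurj, hfin⟩ := exists_tangent_of_mem_regularPoints ha
  obtain ⟨π, hπ, hb⟩ := htr _ hfin.le
  refine ⟨π, hπ, ?_⟩
  obtain ⟨B, hB⟩ := A.toLinearMap.exists_rightInverse_of_surjective (LinearMap.range_eq_top.2 hsurj)
  let B' : (Fin m → ℂ) →L[ℂ] CSpace N := LinearMap.toContinuousLinearMap B
  have hAB : ∀ u, A (B' u) = u := fun u => congrArg (fun L => L u) hB
  -- Chosen so that the normal part `q` of a secant `v` satisfies `(C ‖π‖ + 1) ‖q‖ ≤ ‖v‖ / 2`.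
  set c : ℝ := 1 / (2 * ((C * ‖π‖ + 1) * ‖B'‖ + 1)) with hc
  have hc0 : 0 < c := by positivity
  have hlo := hA.isLittleO
  rw [Asymptotics.isLittleO_iff] at hlo
  have hev := hlo hc0
  rw [nhds_prod_eq] at hev
  obtain ⟨pa, hpa, pb, hpb, hab⟩ := eventually_prod_iff.1 hev
  obtain ⟨O, hOs, hO, haO⟩ := _root_.mem_nhds_iff.1 ((hpa.and hpb).and (hV.mem_nhds haV))
  refine ⟨O, hO, haO, fun x hx x' hx' => ?_⟩
  have h1 := hab (hOs hx.2).1.1 (hOs hx'.2).1.2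
  simp only [hzero x ⟨hx.1, (hOs hx.2).2⟩, hzero x' ⟨hx'.1, (hOs hx'.2).2⟩, sub_zero, zero_sub,
    norm_neg] at h1
  set v := x - x' with hv
  set q := B' (A v) with hq
  have h2 : ‖q‖ ≤ ‖B'‖ * (c * ‖v‖) := (B'.le_opNorm _).trans (by gcongr)
  have h3 : ‖v - q‖ ≤ C * ‖π (v - q)‖ := hb _ (by
    change A (v - q) = 0
    rw [map_sub, hq, hAB, sub_self])
  have h4 : ‖π (v - q)‖ ≤ ‖π v‖ + ‖π‖ * ‖q‖ := by
    rw [map_sub]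
    exact (norm_sub_le _ _).trans (by gcongr; exact π.le_opNorm q)
  have h5 : ‖v‖ ≤ ‖v - q‖ + ‖q‖ := by
    simpa using norm_add_le (v - q) q
  have h6 : (C * ‖π‖ + 1) * (‖B'‖ * (c * ‖v‖)) ≤ 1 / 2 * ‖v‖ := by
    have h7 : (C * ‖π‖ + 1) * ‖B'‖ * c ≤ 1 / 2 := by
      rw [hc, mul_one_div, div_le_iff₀ (by positivity)]
      linarith
    calc _ = (C * ‖π‖ + 1) * ‖B'‖ * c * ‖v‖ := by ring
      _ ≤ _ := by gcongr
  have h8 : (C * ‖π‖ + 1) * ‖q‖ ≤ (C * ‖π‖ + 1) * (‖B'‖ * (c * ‖v‖)) := by gcongr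
  have h9 : C * ‖π (v - q)‖ ≤ C * (‖π v‖ + ‖π‖ * ‖q‖) := by gcongr
  rw [← map_sub]
  nlinarith

end RegularPoints


open Set Filter Topology Metric

/-! ### Hausdorff measure under maps with finite fibres -/

section HausdorffBound

theorem hausdorffMeasure_le_image {E G : Type*} [MetricSpace E] [MeasurableSpace E] [BorelSpace E]
    [MetricSpace G] [MeasurableSpace G] [BorelSpace G] {A : Set E} {π : E → G} {K : ℝ≥0}
    (hA : ∀ x ∈ A, ∀ x' ∈ A, dist x x' ≤ K * dist (π x) (π x')) {s : ℝ} (hs : 0 ≤ s) :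
    μH[s] A ≤ (K : ℝ≥0∞) ^ s * μH[s] (π '' A) := by
  classical
  rcases A.eq_empty_or_nonempty with rfl | ⟨a, ha⟩
  · simp
  have : Nonempty E := ⟨a⟩
  have hinj : InjOn π A := fun x hx x' hx' h => by
    have h1 := hA x hx x' hx'
    rw [h, dist_self, mul_zero] at h1
    exact dist_le_zero.1 h1
  have hinv : ∀ x ∈ A, Function.invFunOn π A (π x) = x := fun x hx => hinj.leftInvOn_invFunOn hx
  have hl : LipschitzOnWith K (Function.invFunOn π A) (π '' A) := by
    refine LipschitzOnWith.of_dist_le_mul ?_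
    rintro _ ⟨x, hx, rfl⟩ _ ⟨x', hx', rfl⟩
    rw [hinv x hx, hinv x' hx']
    exact hA x hx x' hx'
  have h1 := hl.hausdorffMeasure_image_le hs
  rwa [show Function.invFunOn π A '' (π '' A) = A by
    rw [image_image]
    exact (image_congr hinv).trans (image_id' A)] at h1

/-- By Lindelöf, `M` splits into countably many disjoint Borel pieces on which `π` has a
`K`-Lipschitz inverse. Their images are Borel, being injective continuous images, and overlap at
most `D` times inside `T`. -/
theorem hausdorffMeasure_le_of_finite_fibres {E G : Type*} [MetricSpace E] [MeasurableSpace E]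
    [BorelSpace E] [PolishSpace E] [MetricSpace G] [MeasurableSpace G] [BorelSpace G]
    {M : Set E} (hM : MeasurableSet M) {π : E → G} (hπ : Continuous π) {K : ℝ≥0} {D : ℕ}
    (hloc : ∀ a ∈ M, ∃ O : Set E, IsOpen O ∧ a ∈ O ∧
      ∀ x ∈ M ∩ O, ∀ x' ∈ M ∩ O, dist x x' ≤ K * dist (π x) (π x'))
    (hfib : ∀ y, ∀ s : Finset E, (∀ x ∈ s, x ∈ M ∧ π x = y) → s.card ≤ D)
    {s : ℝ} (hs : 0 ≤ s) {T : Set G} (hT : MeasurableSet T) (hMT : MapsTo π M T) :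
    μH[s] M ≤ (K : ℝ≥0∞) ^ s * (D * μH[s] T) := by
  classical
  rcases M.eq_empty_or_nonempty with rfl | ⟨a₀, ha₀⟩
  · simp
  choose O hO haO hOK using fun a : M => hloc a a.2
  obtain ⟨S, hS, hSO⟩ := TopologicalSpace.isOpen_iUnion_countable O hO
  have hSne : S.Nonempty := by
    by_contra hcon
    rw [not_nonempty_iff_eq_empty] at hcon
    rw [hcon] at hSO
    have h1 : a₀ ∈ ⋃ i, O i := mem_iUnion.2 ⟨⟨a₀, ha₀⟩, haO _⟩
    rw [← hSO] at h1
    simp at h1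
  obtain ⟨f, rfl⟩ := hS.exists_eq_range hSne
  let A : ℕ → Set E := fun i => M ∩ disjointed (fun i => O (f i)) i
  have hAm : ∀ i, MeasurableSet (A i) := fun i =>
    hM.inter (MeasurableSet.disjointed (fun i => (hO (f i)).measurableSet) i)
  have hdis : Pairwise (Function.onFun Disjoint A) := fun i j hij =>
    (disjoint_disjointed (fun i => O (f i)) hij).mono inter_subset_right inter_subset_right
  have hcov : M = ⋃ i, A i := by
    rw [← inter_iUnion, iUnion_disjointed]
    refine (inter_eq_self_of_subset_left fun a ha => ?_).symm
    have h1 : a ∈ ⋃ i, O i := mem_iUnion.2 ⟨⟨a, ha⟩, haO _⟩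
    rw [← hSO, biUnion_range] at h1
    exact h1
  have hAK : ∀ i, ∀ x ∈ A i, ∀ x' ∈ A i, dist x x' ≤ K * dist (π x) (π x') := fun i x hx x' hx' =>
    hOK (f i) x ⟨hx.1, disjointed_subset _ i hx.2⟩ x' ⟨hx'.1, disjointed_subset _ i hx'.2⟩
  have hπA : ∀ i, MeasurableSet (π '' A i) := fun i =>
    (hAm i).image_of_continuousOn_injOn hπ.continuousOn fun x hx x' hx' h => by
      have h1 := hAK i x hx x' hx'
      rw [h, dist_self, mul_zero] at h1
      exact dist_le_zero.1 h1
  -- A preimage of `y` chosen in each piece whose image contains `y` gives distinct points of one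
  -- fibre, as the pieces are disjoint.
  have hsum : ∀ y, ∑' i, (π '' A i).indicator (fun _ => (1 : ℝ≥0∞)) y ≤
      T.indicator (fun _ => (D : ℝ≥0∞)) y := by
    intro y
    rw [ENNReal.tsum_eq_iSup_sum]
    refine iSup_le fun I => ?_
    by_cases hy : y ∈ T
    · rw [indicator_of_mem hy]
      have h1 : ∑ i ∈ I, (π '' A i).indicator (fun _ => (1 : ℝ≥0∞)) y =
          ((I.filter fun i => y ∈ π '' A i).card : ℝ≥0∞) := by
        simp only [indicator_apply, Finset.sum_ite, Finset.sum_const_zero, add_zero,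
          Finset.sum_const, nsmul_eq_mul, mul_one]
      rw [h1]
      have hx : ∀ i : ℕ, ∃ x, y ∈ π '' A i → x ∈ A i ∧ π x = y := fun i => by
        by_cases h : y ∈ π '' A i
        · obtain ⟨x, hx⟩ := h
          exact ⟨x, fun _ => hx⟩
        · exact ⟨a₀, fun h' => absurd h' h⟩
      choose x hx using hx
      have hinj : InjOn x (I.filter fun i => y ∈ π '' A i : Finset ℕ) := fun i hi j hj hij => by
        by_contra hne
        have h2 := (hx i (Finset.mem_filter.1 hi).2).1
        have h3 := (hx j (Finset.mem_filter.1 hj).2).1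
        rw [hij] at h2
        exact (disjoint_left.1 (hdis hne) h2) h3
      rw [← Finset.card_image_of_injOn hinj]
      have h4 := hfib y ((I.filter fun i => y ∈ π '' A i).image x) fun z hz => by
        obtain ⟨i, hi, rfl⟩ := Finset.mem_image.1 hz
        obtain ⟨h5, h6⟩ := hx i (Finset.mem_filter.1 hi).2
        exact ⟨h5.1, h6⟩
      exact_mod_cast h4
    · rw [Finset.sum_eq_zero fun i _ => ?_]
      · exact zero_le
      · refine indicator_of_notMem ?_ _
        rintro ⟨x, hx, rfl⟩
        exact hy (hMT hx.1)
  calc μH[s] M = ∑' i, μH[s] (A i) := by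
        conv_lhs => rw [hcov]
        exact measure_iUnion hdis hAm
    _ ≤ ∑' i, (K : ℝ≥0∞) ^ s * μH[s] (π '' A i) :=
        ENNReal.tsum_le_tsum fun i => hausdorffMeasure_le_image (hAK i) hs
    _ = (K : ℝ≥0∞) ^ s * ∑' i, μH[s] (π '' A i) := ENNReal.tsum_mul_left
    _ ≤ (K : ℝ≥0∞) ^ s * (D * μH[s] T) := by
        gcongr
        calc ∑' i, μH[s] (π '' A i)
            = ∑' i, ∫⁻ y, (π '' A i).indicator (fun _ => (1 : ℝ≥0∞)) y ∂μH[s] := by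
              refine tsum_congr fun i => ?_
              rw [lintegral_indicator_const (hπA i), one_mul]
          _ = ∫⁻ y, ∑' i, (π '' A i).indicator (fun _ => (1 : ℝ≥0∞)) y ∂μH[s] :=
              (lintegral_tsum fun i => (measurable_const.indicator (hπA i)).aemeasurable).symm
          _ ≤ ∫⁻ y, T.indicator (fun _ => (D : ℝ≥0∞)) y ∂μH[s] := lintegral_mono hsum
          _ = D * μH[s] T := lintegral_indicator_const hT _

theorem exists_hausdorffMeasure_closedBall_le (n : ℕ) : ∃ c : ℝ≥0, ∀ (y : Fin n → ℂ) {r : ℝ},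
    0 ≤ r → μH[(2 * n : ℕ)] (closedBall y r) ≤ c * ENNReal.ofReal (r ^ (2 * n)) := by
  have hfin : Module.finrank ℝ (Fin n → ℂ) = 2 * n := by
    rw [Module.finrank_pi_fintype]
    simp [mul_comm]
  have hH : (μH[(2 * n : ℕ)] : Measure (Fin n → ℂ)).IsAddHaarMeasure := by
    rw [← hfin]; infer_instance
  refine ⟨((μH[(2 * n : ℕ)] : Measure (Fin n → ℂ)) (ball 0 1)).toNNReal, fun y r hr => ?_⟩
  rw [ENNReal.coe_toNNReal measure_ball_lt_top.ne,
    Measure.addHaar_closedBall _ y hr, hfin, mul_comm]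

end HausdorffBound

/-! ### The volume bound on balls -/

section UpperRegularity

variable {N n : ℕ} {X : Set (CSpace N)}

/-- The regular points are covered by the finitely many open sets `G π` where `π` has a local
inverse with constant `2 * C`. In each, the part inside a ball of radius `r` projects into a ball of
radius `‖π‖ r` in `ℂ^n` with at most `D` sheets. -/
theorem IsPureDim.exists_local_volume_bound (hX : IsPureDim n X) {x : CSpace N} (hx : x ∈ X) :
    ∃ U : Set (CSpace N), IsOpen U ∧ x ∈ U ∧ ∃ C : ℝ≥0, ∀ (w : CSpace N) {r : ℝ}, 0 ≤ r →
      volX n X (U ∩ ball w r) ≤ C * ENNReal.ofReal (r ^ (2 * n)) := by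
  classical
  obtain ⟨U, hU, hxU, D, 𝓕, h𝓕, hfib, C, hC, htr⟩ := hX.exists_projections hx
  obtain ⟨c, hc⟩ := exists_hausdorffMeasure_closedBall_le n
  have hreg := measurableSet_regularPoints (n := n) hX.isAnalyticVariety.measurableSet
  set K : ℝ≥0 := ⟨2 * C, by positivity⟩ with hK
  set κ := Measure.addHaarScalarFactor (volume : Measure (EuclideanSpace ℝ (Fin (2 * n))))
    μH[(2 * n : ℕ)] with hκ
  let G : (CSpace N →L[ℂ] (Fin n → ℂ)) → Set (CSpace N) := fun π => {a | ∃ O : Set (CSpace N),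
    IsOpen O ∧ a ∈ O ∧ ∀ x ∈ X ∩ O, ∀ x' ∈ X ∩ O, dist x x' ≤ K * dist (π x) (π x')}
  have hG : ∀ π, IsOpen (G π) := fun π => isOpen_iff_mem_nhds.2 fun a ⟨O, hO, haO, h⟩ =>
    Filter.mem_of_superset (hO.mem_nhds haO) fun y hy => ⟨O, hO, hy, h⟩
  have hcov : regularPoints n X ⊆ ⋃ π ∈ 𝓕, G π := fun a ha => by
    obtain ⟨π, hπ, O, hO, haO, h⟩ := exists_local_antilipschitz ha hC htr
    refine mem_biUnion hπ ⟨O, hO, haO, fun x hx x' hx' => ?_⟩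
    rw [dist_eq_norm, dist_eq_norm]
    exact h x hx x' hx'
  let B : (CSpace N →L[ℂ] (Fin n → ℂ)) → ℝ≥0 := fun π =>
    K ^ (2 * n) * (D * (c * ‖π‖₊ ^ (2 * n)))
  refine ⟨U, hU, hxU, κ * ∑ π ∈ h𝓕.toFinset, B π, fun w r hr => ?_⟩
  rw [volX, Measure.restrict_apply (hU.inter isOpen_ball).measurableSet,
    Measure.euclideanHausdorffMeasure_def, ← hκ]
  have hpiece : ∀ π ∈ 𝓕, μH[(2 * n : ℕ)] (U ∩ ball w r ∩ regularPoints n X ∩ G π) ≤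
      B π * ENNReal.ofReal (r ^ (2 * n)) := by
    intro π hπ
    have h1 := hausdorffMeasure_le_of_finite_fibres
      (M := U ∩ ball w r ∩ regularPoints n X ∩ G π) (π := π) (K := K) (D := D)
      (((hU.inter isOpen_ball).measurableSet.inter hreg).inter (hG π).measurableSet) π.continuous
      (fun a ha => by
        obtain ⟨O, hO, haO, h⟩ := ha.2
        exact ⟨O, hO, haO, fun x hx x' hx' =>
          h x ⟨regularPoints_subset hx.1.1.2, hx.2⟩ x' ⟨regularPoints_subset hx'.1.1.2, hx'.2⟩⟩)
      (fun y s hs => hfib π hπ y s fun z hz =>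
        ⟨⟨regularPoints_subset (hs z hz).1.1.2, (hs z hz).1.1.1.1⟩, (hs z hz).2⟩)
      (Nat.cast_nonneg (2 * n)) (T := closedBall (π w) (‖π‖ * r)) measurableSet_closedBall
      (fun z hz => by
        have h2 : dist z w < r := hz.1.1.2
        rw [dist_eq_norm] at h2
        rw [mem_closedBall, dist_eq_norm, ← map_sub]
        exact (π.le_opNorm _).trans (by gcongr))
    refine h1.trans ?_
    have h3 := hc (π w) (r := ‖π‖ * r) (by positivity)
    have h4 : ENNReal.ofReal ((‖π‖ * r) ^ (2 * n)) =
        (‖π‖₊ ^ (2 * n) : ℝ≥0) * ENNReal.ofReal (r ^ (2 * n)) := by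
      rw [mul_pow, ENNReal.ofReal_mul (by positivity), ENNReal.ofReal_pow (norm_nonneg _),
        ofReal_norm, enorm_eq_nnnorm, ENNReal.coe_pow]
    rw [h4] at h3
    rw [ENNReal.rpow_natCast]
    calc (K : ℝ≥0∞) ^ (2 * n) * (D * μH[(2 * n : ℕ)] (closedBall (π w) (‖π‖ * r)))
        ≤ (K : ℝ≥0∞) ^ (2 * n) * (D * (c * ((‖π‖₊ ^ (2 * n) : ℝ≥0) *
            ENNReal.ofReal (r ^ (2 * n))))) := by gcongr
      _ = _ := by
        simp only [B]
        push_cast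
        ring
  have hall : μH[(2 * n : ℕ)] (U ∩ ball w r ∩ regularPoints n X) ≤
      (∑ π ∈ h𝓕.toFinset, B π : ℝ≥0) * ENNReal.ofReal (r ^ (2 * n)) := by
    calc μH[(2 * n : ℕ)] (U ∩ ball w r ∩ regularPoints n X)
        ≤ μH[(2 * n : ℕ)] (⋃ π ∈ h𝓕.toFinset, U ∩ ball w r ∩ regularPoints n X ∩ G π) := by
          refine measure_mono fun z hz => ?_
          obtain ⟨π, hπ, hzπ⟩ := mem_iUnion₂.1 (hcov hz.2)
          exact mem_biUnion (h𝓕.mem_toFinset.2 hπ) ⟨hz, hzπ⟩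
      _ ≤ ∑ π ∈ h𝓕.toFinset, μH[(2 * n : ℕ)] (U ∩ ball w r ∩ regularPoints n X ∩ G π) :=
          measure_biUnion_finset_le _ _
      _ ≤ ∑ π ∈ h𝓕.toFinset, B π * ENNReal.ofReal (r ^ (2 * n)) :=
          Finset.sum_le_sum fun π hπ => hpiece π (h𝓕.mem_toFinset.1 hπ)
      _ = _ := by rw [← Finset.sum_mul]; push_cast; rfl
  calc (κ • μH[(2 * n : ℕ)]) (U ∩ ball w r ∩ regularPoints n X)
      = κ * μH[(2 * n : ℕ)] (U ∩ ball w r ∩ regularPoints n X) := rfl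
    _ ≤ κ * ((∑ π ∈ h𝓕.toFinset, B π : ℝ≥0) * ENNReal.ofReal (r ^ (2 * n))) := by gcongr
    _ = _ := by push_cast; ring

theorem IsPureDim.exists_volume_bound (hX : IsPureDim n X) {D : Set (CSpace N)}
    (hD : IsRelCompactOpen X D) : ∃ C : ℝ≥0, ∀ (w : CSpace N) {r : ℝ}, 0 ≤ r →
      (volX n X).restrict D (ball w r) ≤ C * ENNReal.ofReal (r ^ (2 * n)) := by
  have key : ∃ C : ℝ≥0, ∀ (w : CSpace N) {r : ℝ}, 0 ≤ r →
      volX n X (closure D ∩ ball w r) ≤ C * ENNReal.ofReal (r ^ (2 * n)) := by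
    refine hD.isCompact_closure.induction_on (p := fun S => ∃ C : ℝ≥0, ∀ (w : CSpace N) {r : ℝ},
      0 ≤ r → volX n X (S ∩ ball w r) ≤ C * ENNReal.ofReal (r ^ (2 * n))) ?_ ?_ ?_ ?_
    · exact ⟨0, fun w r _ => by simp⟩
    · rintro s t hst ⟨C, hC⟩
      exact ⟨C, fun w r hr => (measure_mono (inter_subset_inter_left _ hst)).trans (hC w hr)⟩
    · rintro s t ⟨C, hC⟩ ⟨C', hC'⟩
      refine ⟨C + C', fun w r hr => ?_⟩
      rw [union_inter_distrib_right]
      refine (measure_union_le _ _).trans ?_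
      rw [ENNReal.coe_add, add_mul]
      exact add_le_add (hC w hr) (hC' w hr)
    · intro x hx
      obtain ⟨U, hU, hxU, C, hC⟩ := hX.exists_local_volume_bound (hD.closure_subset hx)
      exact ⟨U, mem_nhdsWithin_of_mem_nhds (hU.mem_nhds hxU), C, hC⟩
  obtain ⟨C, hC⟩ := key
  refine ⟨C, fun w r hr => ?_⟩
  rw [Measure.restrict_apply measurableSet_ball, inter_comm]
  exact (measure_mono (inter_subset_inter_left _ _root_.subset_closure)).trans (hC w hr)

end UpperRegularity


open Set Filter Topology Metric

/-! ### Riesz potentials of measures of bounded growth -/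

section RieszPotentials

variable {E : Type*} [NormedAddCommGroup E] [MeasurableSpace E] {μ : Measure E} {m : ℕ} {C : ℝ≥0}

theorem nullSingletonClass_of_measure_ball_le (hm : m ≠ 0)
    (hC : ∀ (w : E) {r : ℝ}, 0 ≤ r → μ (ball w r) ≤ C * ENNReal.ofReal (r ^ m)) : NullSingletonClass μ := by
  refine ⟨fun w => le_antisymm ?_ zero_le⟩
  have h1 : Tendsto (fun r : ℝ => (C : ℝ≥0∞) * ENNReal.ofReal (r ^ m)) (𝓝[>] 0) (𝓝 0) := by
    have h2 : Tendsto (fun r : ℝ => (C : ℝ≥0∞) * ENNReal.ofReal (r ^ m)) (𝓝 0)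
        (𝓝 ((C : ℝ≥0∞) * ENNReal.ofReal ((0 : ℝ) ^ m))) :=
      ENNReal.Tendsto.const_mul (ENNReal.tendsto_ofReal ((continuous_pow m).tendsto 0))
        (Or.inr ENNReal.coe_ne_top)
    rw [zero_pow hm, ENNReal.ofReal_zero, mul_zero] at h2
    exact h2.mono_left nhdsWithin_le_nhds
  refine ge_of_tendsto h1 ?_
  filter_upwards [self_mem_nhdsWithin] with r hr
  exact (measure_mono (singleton_subset_iff.2 (mem_ball_self hr))).trans (hC w (le_of_lt hr))

/-- Layer cake: the set where the integrand exceeds `t` lies in a ball of radius `t^(-1/p)`, of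
measure at most `C t^(-m/p)`, integrable on `t > 1` because `p < m`. For `t ≤ 1` the total mass
suffices. -/
theorem exists_lintegral_rpow_le [BorelSpace E] [IsFiniteMeasure μ]
    (hC : ∀ (w : E) {r : ℝ}, 0 ≤ r → μ (ball w r) ≤ C * ENNReal.ofReal (r ^ m))
    {p : ℝ} (hp0 : 0 ≤ p) (hpm : p < m) :
    ∃ A : ℝ≥0, ∀ w : E, ∫⁻ ζ, ENNReal.ofReal (‖ζ - w‖ ^ (-p)) ∂μ ≤ A := by
  rcases hp0.eq_or_lt with rfl | hp
  · refine ⟨(μ univ).toNNReal, fun w => ?_⟩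
    simp
  set q : ℝ := -(m / p) with hq
  have hq1 : q < -1 := by
    rw [hq, neg_lt_neg_iff, one_lt_div hp]; exact hpm
  have hint : IntegrableOn (fun t : ℝ => t ^ q) (Ioi 1) := integrableOn_Ioi_rpow_of_lt hq1 one_pos
  have hfin : ∫⁻ t in Ioi (1 : ℝ), ENNReal.ofReal (t ^ q) < ∞ := hint.lintegral_lt_top
  set A : ℝ≥0∞ := μ univ + C * ∫⁻ t in Ioi (1 : ℝ), ENNReal.ofReal (t ^ q) with hA
  have hAtop : A ≠ ∞ := by
    rw [hA]
    exact (ENNReal.add_lt_top.2 ⟨measure_lt_top μ _, ENNReal.mul_lt_top ENNReal.coe_lt_top hfin⟩).ne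
  refine ⟨A.toNNReal, fun w => ?_⟩
  rw [ENNReal.coe_toNNReal hAtop, lintegral_eq_lintegral_meas_lt μ
    (Eventually.of_forall fun ζ => by positivity) (by fun_prop)]
  have hsplit : Ioi (0 : ℝ) = Ioc 0 1 ∪ Ioi 1 := (Ioc_union_Ioi_eq_Ioi zero_le_one).symm
  rw [hsplit]
  refine (lintegral_union_le _ _ _).trans (add_le_add ?_ ?_)
  · calc ∫⁻ t in Ioc (0 : ℝ) 1, μ {a | t < ‖a - w‖ ^ (-p)}
        ≤ ∫⁻ _t in Ioc (0 : ℝ) 1, μ univ := lintegral_mono fun t => measure_mono (subset_univ _)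
      _ = μ univ := by simp
  · rw [← lintegral_const_mul _ (by fun_prop)]
    refine setLIntegral_mono (by fun_prop) fun t ht => ?_
    have ht0 : (0 : ℝ) < t := one_pos.trans ht
    have hsub : {a | t < ‖a - w‖ ^ (-p)} ⊆ ball w (t ^ (-(1 / p))) := by
      intro a ha
      have ha' : t < ‖a - w‖ ^ (-p) := ha
      rw [mem_ball, dist_eq_norm]
      rcases (norm_nonneg (a - w)).eq_or_lt with h0 | h0
      · rw [← h0]; positivity
      · have h1 := Real.rpow_lt_rpow_of_neg ht0 ha' (z := -(1 / p)) (by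
          rw [neg_lt_zero]; positivity)
        rwa [← Real.rpow_mul h0.le, neg_mul_neg, mul_one_div_cancel hp.ne', Real.rpow_one] at h1
    refine (measure_mono hsub).trans ((hC w (by positivity)).trans ?_)
    rw [← Real.rpow_natCast, ← Real.rpow_mul ht0.le]
    refine le_of_eq ?_
    congr 3
    rw [hq]; ring

/-- Pointwise estimate behind the weighted Riesz potentials. -/
theorem weighted_potential_le {M γ a s R x y v : ℝ} (ha : 0 ≤ a) (haγ : a ≤ γ)
    (hsM : s ≤ M) (hs : 0 ≤ s) (hx : 0 < x) (hy : 0 < y) (hv : 0 ≤ v)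
    (hvR : v ≤ R) (hxy : v ≤ x + y) :
    v ^ (γ - a) * x ^ (-γ) * y ^ (s - M) ≤
      (2 ^ γ + 2 ^ M * (1 + R ^ (γ + (s - a) - M))) *
        (x ^ (-(M - (s - a))) + y ^ (-(M - (s - a))) + x ^ (-γ)) := by
  have hR : 0 ≤ R := hv.trans hvR
  have hγ : 0 ≤ γ := ha.trans haγ
  have p1 : 0 < x ^ (-(M - (s - a))) := Real.rpow_pos_of_pos hx _
  have p2 : 0 < y ^ (-(M - (s - a))) := Real.rpow_pos_of_pos hy _
  have p3 : 0 < x ^ (-γ) := Real.rpow_pos_of_pos hx _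
  have p4 : (0 : ℝ) < 2 ^ γ := by positivity
  have p5 : (0 : ℝ) < 2 ^ M := by positivity
  have p6 : 0 ≤ R ^ (γ + (s - a) - M) := Real.rpow_nonneg hR _
  have p7 : 0 < y ^ (s - M) := Real.rpow_pos_of_pos hy _
  -- Here `v`, `x`, `y` play `‖w‖`, `‖ζ‖`, `‖ζ - w‖`. If `v ≤ 2x` the weight is at most a multiple
  -- of `x^(-a)`; otherwise `y ≥ v/2`, and the pole at `w` is harmless.
  by_cases hvx : v ≤ 2 * x
  · have h1 : v ^ (γ - a) * x ^ (-γ) ≤ 2 ^ γ * x ^ (-a) := by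
      calc v ^ (γ - a) * x ^ (-γ) ≤ (2 * x) ^ (γ - a) * x ^ (-γ) := by
            gcongr
        _ = 2 ^ (γ - a) * (x ^ (γ - a) * x ^ (-γ)) := by
            rw [Real.mul_rpow (by norm_num) hx.le]; ring
        _ = 2 ^ (γ - a) * x ^ (-a) := by
            rw [← Real.rpow_add hx]; congr 2; ring
        _ ≤ 2 ^ γ * x ^ (-a) := by
            gcongr
            · norm_num
            · linarith
    have h2 : x ^ (-a) * y ^ (s - M) ≤ x ^ (-(M - (s - a))) + y ^ (-(M - (s - a))) := by
      have e1 : -(M - (s - a)) = -a + (s - M) := by ring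
      rcases le_total x y with h | h
      · have h3 : y ^ (s - M) ≤ x ^ (s - M) :=
          Real.rpow_le_rpow_of_nonpos hx h (by linarith)
        calc x ^ (-a) * y ^ (s - M) ≤ x ^ (-a) * x ^ (s - M) := by gcongr
          _ = x ^ (-(M - (s - a))) := by rw [← Real.rpow_add hx, e1]
          _ ≤ _ := by linarith
      · have h3 : x ^ (-a) ≤ y ^ (-a) := Real.rpow_le_rpow_of_nonpos hy h (by linarith)
        calc x ^ (-a) * y ^ (s - M) ≤ y ^ (-a) * y ^ (s - M) := by gcongr
          _ = y ^ (-(M - (s - a))) := by rw [← Real.rpow_add hy, e1]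
          _ ≤ _ := by linarith
    calc v ^ (γ - a) * x ^ (-γ) * y ^ (s - M) ≤ 2 ^ γ * x ^ (-a) * y ^ (s - M) := by gcongr
      _ = 2 ^ γ * (x ^ (-a) * y ^ (s - M)) := by ring
      _ ≤ (2 ^ γ + 2 ^ M * (1 + R ^ (γ + (s - a) - M))) *
          (x ^ (-(M - (s - a))) + y ^ (-(M - (s - a))) + x ^ (-γ)) := by
        refine mul_le_mul ?_ (by linarith) (by positivity) (by positivity)
        have : 0 ≤ 2 ^ M * (1 + R ^ (γ + (s - a) - M)) := by positivity
        linarith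
  · push Not at hvx
    have hv0 : 0 < v := by linarith
    have h1 : y ^ (s - M) ≤ 2 ^ M * v ^ (s - M) := by
      calc y ^ (s - M) ≤ (v / 2) ^ (s - M) :=
            Real.rpow_le_rpow_of_nonpos (by positivity) (by linarith) (by linarith)
        _ = 2 ^ (M - s) * v ^ (s - M) := by
            rw [Real.div_rpow hv (by norm_num), div_eq_mul_inv, ← Real.rpow_neg (by norm_num),
              neg_sub, mul_comm]
        _ ≤ 2 ^ M * v ^ (s - M) := by
            gcongr
            · norm_num
            · linarith
    have h2 : v ^ (γ - a) * x ^ (-γ) * y ^ (s - M) ≤ 2 ^ M * (v ^ (γ + (s - a) - M) * x ^ (-γ)) := by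
      calc v ^ (γ - a) * x ^ (-γ) * y ^ (s - M)
          ≤ v ^ (γ - a) * x ^ (-γ) * (2 ^ M * v ^ (s - M)) := by gcongr
        _ = 2 ^ M * ((v ^ (γ - a) * v ^ (s - M)) * x ^ (-γ)) := by ring
        _ = _ := by rw [← Real.rpow_add hv0]; congr 3; ring
    have h3 : v ^ (γ + (s - a) - M) * x ^ (-γ) ≤
        (1 + R ^ (γ + (s - a) - M)) *
          (x ^ (-(M - (s - a))) + y ^ (-(M - (s - a))) + x ^ (-γ)) := by
      rcases le_total (γ + (s - a) - M) 0 with h | h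
      · have h4 : v ^ (γ + (s - a) - M) ≤ x ^ (γ + (s - a) - M) :=
          Real.rpow_le_rpow_of_nonpos hx (by linarith) h
        calc v ^ (γ + (s - a) - M) * x ^ (-γ) ≤ x ^ (γ + (s - a) - M) * x ^ (-γ) := by gcongr
          _ = x ^ (-(M - (s - a))) := by rw [← Real.rpow_add hx]; congr 1; ring
          _ ≤ 1 * (x ^ (-(M - (s - a))) + y ^ (-(M - (s - a))) + x ^ (-γ)) := by linarith
          _ ≤ _ := by gcongr; linarith
      · calc v ^ (γ + (s - a) - M) * x ^ (-γ) ≤ R ^ (γ + (s - a) - M) * x ^ (-γ) := by gcongr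
          _ ≤ _ := by
            refine mul_le_mul (by linarith) (by linarith) p3.le (by positivity)
    calc _ ≤ 2 ^ M * ((1 + R ^ (γ + (s - a) - M)) *
          (x ^ (-(M - (s - a))) + y ^ (-(M - (s - a))) + x ^ (-γ))) := h2.trans (by gcongr)
      _ = (2 ^ M * (1 + R ^ (γ + (s - a) - M))) *
          (x ^ (-(M - (s - a))) + y ^ (-(M - (s - a))) + x ^ (-γ)) := by ring
      _ ≤ _ := by gcongr; linarith

/-- The parameter `a` is the power of `‖w‖` lost from the weight and `s` the order of the potential;
`a < s` keeps the combined singularity below the critical exponent `m`. -/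
theorem exists_lintegral_weighted_le [BorelSpace E] [IsFiniteMeasure μ] (hm : m ≠ 0)
    (hC : ∀ (w : E) {r : ℝ}, 0 ≤ r → μ (ball w r) ≤ C * ENNReal.ofReal (r ^ m))
    {γ a s : ℝ} (ha : 0 ≤ a) (haγ : a ≤ γ) (hγ : γ < m) (has : a < s) (hs : s ≤ 1) (R : ℝ) :
    ∃ A : ℝ≥0, ∀ w : E, ‖w‖ ≤ R →
      ∫⁻ ζ, ENNReal.ofReal (‖w‖ ^ (γ - a) * ‖ζ‖ ^ (-γ) * ‖ζ - w‖ ^ (s - m)) ∂μ ≤ A := by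
  have hm1 : (1 : ℝ) ≤ m := by exact_mod_cast Nat.one_le_iff_ne_zero.2 hm
  have hna := nullSingletonClass_of_measure_ball_le hm hC
  obtain ⟨A₁, hA₁⟩ := exists_lintegral_rpow_le hC (p := m - (s - a)) (by linarith) (by linarith)
  obtain ⟨A₂, hA₂⟩ := exists_lintegral_rpow_le hC (p := γ) (ha.trans haγ) hγ
  set K : ℝ := 2 ^ γ + 2 ^ (m : ℝ) * (1 + R ^ (γ + (s - a) - m)) with hK
  refine ⟨K.toNNReal * (A₁ + A₁ + A₂), fun w hw => ?_⟩
  have hR : 0 ≤ R := (norm_nonneg w).trans hw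
  have hK0 : 0 ≤ K := by
    have := Real.rpow_nonneg hR (γ + (s - a) - m)
    positivity
  have hae : ∀ᵐ ζ ∂μ, ζ ≠ 0 ∧ ζ ≠ w := by
    filter_upwards [compl_mem_ae_iff.2 (measure_singleton (μ := μ) (0 : E)),
      compl_mem_ae_iff.2 (measure_singleton (μ := μ) w)] with ζ h1 h2
    exact ⟨h1, h2⟩
  have h0 := hA₁ 0
  have h0' := hA₂ 0
  simp only [sub_zero] at h0 h0'
  calc ∫⁻ ζ, ENNReal.ofReal (‖w‖ ^ (γ - a) * ‖ζ‖ ^ (-γ) * ‖ζ - w‖ ^ (s - m)) ∂μ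
      ≤ ∫⁻ ζ, ENNReal.ofReal K * (ENNReal.ofReal (‖ζ‖ ^ (-(m - (s - a)))) +
          ENNReal.ofReal (‖ζ - w‖ ^ (-(m - (s - a)))) + ENNReal.ofReal (‖ζ‖ ^ (-γ))) ∂μ := by
        refine lintegral_mono_ae ?_
        filter_upwards [hae] with ζ hζ
        rw [← ENNReal.ofReal_add (by positivity) (by positivity),
          ← ENNReal.ofReal_add (by positivity) (by positivity), ← ENNReal.ofReal_mul hK0]
        refine ENNReal.ofReal_le_ofReal ?_
        refine weighted_potential_le ha haγ (by linarith) (by linarith)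
          (norm_pos_iff.2 hζ.1) (norm_pos_iff.2 (sub_ne_zero.2 hζ.2))
          (norm_nonneg w) hw ?_
        have := norm_sub_le ζ (ζ - w)
        rwa [sub_sub_cancel] at this
    _ = ENNReal.ofReal K * (∫⁻ ζ, ENNReal.ofReal (‖ζ‖ ^ (-(m - (s - a)))) ∂μ +
          ∫⁻ ζ, ENNReal.ofReal (‖ζ - w‖ ^ (-(m - (s - a)))) ∂μ +
          ∫⁻ ζ, ENNReal.ofReal (‖ζ‖ ^ (-γ)) ∂μ) := by
        rw [lintegral_const_mul _ (by fun_prop), lintegral_add_left (by fun_prop),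
          lintegral_add_left (by fun_prop)]
    _ ≤ ENNReal.ofReal K * (A₁ + A₁ + A₂) := by
        gcongr
        exact hA₁ w
    _ = _ := by push_cast; rfl

end RieszPotentials


open Set Filter Topology Metric

/-! ### Pointwise estimates of the kernel -/

section Kernel

/-- Interpolates between a Lipschitz bound, used for `‖u - v‖ ≤ ‖u‖`, and the triangle inequality.
In `m + 1` the numerator contributes `1` and Bernoulli's inequality for the denominator `m`. -/
theorem norm_inv_pow_kernel_sub_le {N : ℕ} (m : ℕ) (hm : m ≠ 0) (i : Fin N) {u v : CSpace N}
    (hu : u ≠ 0) (huv : ‖u‖ ≤ ‖v‖) {β : ℝ} (hβ0 : 0 ≤ β) (hβ1 : β ≤ 1) :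
    ‖starRingEnd ℂ (u i) / ((‖u‖ ^ m : ℝ) : ℂ) - starRingEnd ℂ (v i) / ((‖v‖ ^ m : ℝ) : ℂ)‖ ≤
      (m + 1) * ‖u - v‖ ^ β * ‖u‖ ^ (1 - β - m) := by
  set a := ‖u‖ with ha
  set b := ‖v‖ with hb
  set d := ‖u - v‖ with hd
  have ha0 : 0 < a := norm_pos_iff.2 hu
  have hb0 : 0 < b := ha0.trans_le huv
  have hd0 : 0 ≤ d := norm_nonneg _
  have hbd : b - a ≤ d := by
    have := norm_sub_norm_le v u
    rwa [norm_sub_rev] at this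
  have hm1 : (1 : ℝ) ≤ m := by exact_mod_cast Nat.one_le_iff_ne_zero.2 hm
  have ham : 0 < a ^ m := pow_pos ha0 m
  have hbm : 0 < b ^ m := pow_pos hb0 m
  have hab : a ^ m ≤ b ^ m := pow_le_pow_left₀ ha0.le huv m
  have hui : ‖u i‖ ≤ a := PiLp.norm_apply_le u i
  have hvi : ‖v i‖ ≤ b := PiLp.norm_apply_le v i
  have huvi : ‖u i - v i‖ ≤ d := PiLp.norm_apply_le (u - v) i
  have hnorm : ∀ (w : ℂ) {c : ℝ}, 0 < c → ‖starRingEnd ℂ w / ((c : ℝ) : ℂ)‖ = ‖w‖ / c := by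
    intro w c hc
    rw [norm_div, RCLike.norm_conj, Complex.norm_real, Real.norm_of_nonneg hc.le]
  have hmono : b / b ^ m ≤ a / a ^ m := by
    obtain ⟨k, rfl⟩ := Nat.exists_eq_succ_of_ne_zero hm
    rw [pow_succ, pow_succ, div_mul_cancel_right₀ hb0.ne', div_mul_cancel_right₀ ha0.ne']
    gcongr
  have hcrude : ‖starRingEnd ℂ (u i) / ((a ^ m : ℝ) : ℂ) -
      starRingEnd ℂ (v i) / ((b ^ m : ℝ) : ℂ)‖ ≤ 2 * (a / a ^ m) := by
    refine (norm_sub_le _ _).trans ?_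
    rw [hnorm _ ham, hnorm _ hbm]
    have h1 : ‖u i‖ / a ^ m ≤ a / a ^ m := by gcongr
    have h2 : ‖v i‖ / b ^ m ≤ b / b ^ m := by gcongr
    linarith
  have hlip : ‖starRingEnd ℂ (u i) / ((a ^ m : ℝ) : ℂ) -
      starRingEnd ℂ (v i) / ((b ^ m : ℝ) : ℂ)‖ ≤ (m + 1) * (d / a ^ m) := by
    have h1 : starRingEnd ℂ (u i) / ((a ^ m : ℝ) : ℂ) - starRingEnd ℂ (v i) / ((b ^ m : ℝ) : ℂ) =
        starRingEnd ℂ (u i - v i) / ((b ^ m : ℝ) : ℂ) +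
          starRingEnd ℂ (u i) * (((1 / a ^ m - 1 / b ^ m : ℝ)) : ℂ) := by
      push_cast
      rw [map_sub]
      ring
    have h2 : 0 ≤ 1 / a ^ m - 1 / b ^ m := sub_nonneg.2 (one_div_le_one_div_of_le ham hab)
    rw [h1]
    refine (norm_add_le _ _).trans ?_
    rw [hnorm _ hbm, norm_mul, RCLike.norm_conj, Complex.norm_real, Real.norm_of_nonneg h2]
    have h3 : ‖u i - v i‖ / b ^ m ≤ d / a ^ m := by gcongr
    have h4 : 1 / a ^ m - 1 / b ^ m ≤ m * (d / a) / a ^ m := by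
      have h5 := one_add_mul_le_pow (a := (a - b) / b) (by
        rw [le_div_iff₀ hb0]; linarith) m
      have h6 : 1 + (a - b) / b = a / b := by field_simp; ring
      rw [h6, div_pow] at h5
      have h7 : (b - a) / b ≤ d / a := by gcongr
      have h8 : 1 / a ^ m - 1 / b ^ m = (1 - a ^ m / b ^ m) / a ^ m := by field_simp
      rw [h8]
      gcongr
      have h9 : (a - b) / b = -((b - a) / b) := by ring
      rw [h9] at h5
      nlinarith
    have h10 : ‖u i‖ * (1 / a ^ m - 1 / b ^ m) ≤ m * (d / a ^ m) := by
      calc ‖u i‖ * (1 / a ^ m - 1 / b ^ m) ≤ a * (m * (d / a) / a ^ m) := by gcongr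
        _ = m * (d / a ^ m) := by field_simp
    linarith
  have hkey : a ^ (1 - β - m) = a / a ^ m / a ^ β := by
    rw [Real.rpow_sub ha0, Real.rpow_sub ha0, Real.rpow_one, Real.rpow_natCast]
    ring
  have haβ : 0 < a ^ β := Real.rpow_pos_of_pos ha0 β
  have hsplit : (m + 1) * d ^ β * a ^ (1 - β - m) = (m + 1) * ((d / a) ^ β * (a / a ^ m)) := by
    rw [hkey, Real.div_rpow hd0 ha0.le]; ring
  rw [hsplit]
  rcases le_total d a with h | h
  · refine hlip.trans ?_
    have h1 : d / a ≤ (d / a) ^ β := by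
      conv_lhs => rw [← Real.rpow_one (d / a)]
      exact Real.rpow_le_rpow_of_exponent_ge' (by positivity) ((div_le_one ha0).2 h) hβ0 hβ1
    have h2 : d / a ^ m = d / a * (a / a ^ m) := by field_simp
    rw [h2]
    gcongr
  · refine hcrude.trans ?_
    have h1 : 1 ≤ (d / a) ^ β := Real.one_le_rpow ((one_le_div ha0).2 h) hβ0
    have h2 : 0 < a / a ^ m := by positivity
    have h3 : a / a ^ m ≤ (d / a) ^ β * (a / a ^ m) := le_mul_of_one_le_left h2.le h1
    nlinarith

/-- By homogeneity this reduces to `1 - t^γ ≤ max 1 γ * (1 - t)` for `t = x / y` in the unit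
interval, followed by `1 - t ≤ (1 - t)^β`. -/
theorem rpow_sub_rpow_le {γ β x y d : ℝ} (hγ : 0 < γ) (hβ0 : 0 ≤ β) (hβ1 : β ≤ 1)
    (hx : 0 ≤ x) (hxy : x ≤ y) (hd : y - x ≤ d) :
    y ^ γ - x ^ γ ≤ max 1 γ * d ^ β * y ^ (γ - β) := by
  have hd0 : 0 ≤ d := by linarith
  rcases (hx.trans hxy).eq_or_lt with h0 | hy
  · have hx0 : x = 0 := by linarith
    rw [← h0, hx0, sub_self]
    positivity
  set t := x / y with ht
  have ht0 : 0 ≤ t := by positivity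
  have ht1 : t ≤ 1 := (div_le_one hy).2 hxy
  have h1 : 1 - t ^ γ ≤ max 1 γ * (1 - t) := by
    rcases le_total γ 1 with h | h
    · rw [max_eq_left h, one_mul]
      have : t ≤ t ^ γ := by
        conv_lhs => rw [← Real.rpow_one t]
        exact Real.rpow_le_rpow_of_exponent_ge' ht0 ht1 hγ.le h
      linarith
    · rw [max_eq_right h]
      have := one_add_mul_self_le_rpow_one_add (s := t - 1) (by linarith) h
      rw [add_sub_cancel] at this
      linarith
  have h2 : 1 - t ≤ (1 - t) ^ β := by
    conv_lhs => rw [← Real.rpow_one (1 - t)]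
    exact Real.rpow_le_rpow_of_exponent_ge' (by linarith) (by linarith) hβ0 hβ1
  have h3 : (1 - t) ^ β ≤ (d / y) ^ β := by
    refine Real.rpow_le_rpow (by linarith) ?_ hβ0
    have : 1 - t = (y - x) / y := by rw [ht]; field_simp
    rw [this]
    gcongr
  have h4 : x ^ γ = t ^ γ * y ^ γ := by
    rw [← Real.mul_rpow ht0 hy.le, ht, div_mul_cancel₀ _ hy.ne']
  calc y ^ γ - x ^ γ = (1 - t ^ γ) * y ^ γ := by rw [h4]; ring
    _ ≤ max 1 γ * (d / y) ^ β * y ^ γ := by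
        gcongr
        exact h1.trans (by gcongr; exact h2.trans h3)
    _ = max 1 γ * d ^ β * y ^ (γ - β) := by
        rw [Real.div_rpow hd0 hy.le, Real.rpow_sub hy]; ring

variable {N n : ℕ} {γ : ℝ} {i : Fin N}

theorem measurable_kernel (z : CSpace N) : Measurable (fun ζ => kernel n γ i ζ z) := by
  unfold kernel
  have h1 : Measurable fun ζ : CSpace N => ζ i := (by fun_prop : Continuous fun ζ : CSpace N => ζ i).measurable
  fun_prop

/-- The Riesz-type part of the kernel. -/
theorem norm_kernel_le {ζ z : CSpace N} (hζz : ζ ≠ z) :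
    ‖kernel n γ i ζ z‖ ≤ ‖z‖ ^ γ * ‖ζ‖ ^ (-γ) * ‖ζ - z‖ ^ (1 - ((2 * n : ℕ) : ℝ)) := by
  have h0 : 0 < ‖ζ - z‖ := norm_pos_iff.2 (sub_ne_zero.2 hζz)
  have h1 : ‖ζ i - z i‖ ≤ ‖ζ - z‖ := PiLp.norm_apply_le (ζ - z) i
  rw [kernel, norm_mul, norm_div, RCLike.norm_conj, Complex.norm_real, Complex.norm_real,
    Real.norm_of_nonneg (by positivity), Real.norm_of_nonneg (by positivity),
    Real.rpow_neg (norm_nonneg _), Real.rpow_sub h0, Real.rpow_one, Real.rpow_natCast,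
    div_eq_mul_inv (‖z‖ ^ γ)]
  gcongr

theorem norm_kernel_sub_le (hn : n ≠ 0) (hγ : 0 ≤ γ) {ζ z w : CSpace N} (hζz : ζ ≠ z) (hζw : ζ ≠ w)
    (hzw : ‖z‖ ≤ ‖w‖) {β : ℝ} (hβ0 : 0 ≤ β) (hβ1 : β ≤ 1) :
    ‖kernel n γ i ζ z - kernel n γ i ζ w‖ ≤ ‖z - w‖ ^ β *
      (((2 * n : ℕ) + 1) * (‖z‖ ^ γ * ‖ζ‖ ^ (-γ) * ‖ζ - z‖ ^ (1 - β - ((2 * n : ℕ) : ℝ)) +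
        ‖w‖ ^ γ * ‖ζ‖ ^ (-γ) * ‖ζ - w‖ ^ (1 - β - ((2 * n : ℕ) : ℝ))) +
      if γ = 0 then 0 else
        max 1 γ * (‖w‖ ^ (γ - β) * ‖ζ‖ ^ (-γ) * ‖ζ - w‖ ^ (1 - ((2 * n : ℕ) : ℝ)))) := by
  set m := 2 * n with hm
  have hm0 : m ≠ 0 := by omega
  set u := ζ - z with hu
  set v := ζ - w with hv
  have hu0 : u ≠ 0 := sub_ne_zero.2 hζz
  have hv0 : v ≠ 0 := sub_ne_zero.2 hζw
  have hvp : 0 < ‖v‖ := norm_pos_iff.2 hv0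
  set g : CSpace N → ℂ := fun u => starRingEnd ℂ (u i) / ((‖u‖ ^ m : ℝ) : ℂ) with hg
  have hk : ∀ y, kernel n γ i ζ y = ((‖y‖ ^ γ * ‖ζ‖ ^ (-γ) : ℝ) : ℂ) * g (ζ - y) := fun y => by
    simp only [kernel, hg, Real.rpow_neg (norm_nonneg ζ), div_eq_mul_inv, PiLp.sub_apply, hm]
  have hdist : ‖z - w‖ = ‖u - v‖ := by
    rw [hu, hv, sub_sub_sub_cancel_left, norm_sub_rev]
  have hgdiff : ‖g u - g v‖ ≤ (m + 1) * ‖z - w‖ ^ β *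
      (‖u‖ ^ (1 - β - (m : ℝ)) + ‖v‖ ^ (1 - β - (m : ℝ))) := by
    have hp1 : 0 ≤ ‖u‖ ^ (1 - β - (m : ℝ)) := by positivity
    have hp2 : 0 ≤ ‖v‖ ^ (1 - β - (m : ℝ)) := by positivity
    rw [hdist]
    rcases le_total ‖u‖ ‖v‖ with h | h
    · refine (norm_inv_pow_kernel_sub_le m hm0 i hu0 h hβ0 hβ1).trans ?_
      gcongr
      linarith
    · rw [norm_sub_rev, norm_sub_rev u v]
      refine (norm_inv_pow_kernel_sub_le m hm0 i hv0 h hβ0 hβ1).trans ?_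
      gcongr
      linarith
  have hgv : ‖g v‖ ≤ ‖v‖ ^ (1 - (m : ℝ)) := by
    have h1 : ‖v i‖ ≤ ‖v‖ := PiLp.norm_apply_le v i
    rw [hg, norm_div, RCLike.norm_conj, Complex.norm_real, Real.norm_of_nonneg (by positivity),
      Real.rpow_sub hvp, Real.rpow_one, Real.rpow_natCast]
    gcongr
  have hpow : ‖w‖ ^ γ - ‖z‖ ^ γ ≤ if γ = 0 then 0 else max 1 γ * ‖z - w‖ ^ β * ‖w‖ ^ (γ - β) := by
    split_ifs with h
    · simp [h]
    · refine rpow_sub_rpow_le (lt_of_le_of_ne hγ (Ne.symm h)) hβ0 hβ1 (norm_nonneg z) hzw ?_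
      rw [norm_sub_rev]
      exact norm_sub_norm_le w z
  have hpow0 : 0 ≤ ‖w‖ ^ γ - ‖z‖ ^ γ := sub_nonneg.2 (Real.rpow_le_rpow (norm_nonneg z) hzw hγ)
  -- The first term varies the pole and the second the weight. As `‖z‖ ≤ ‖w‖`, the weight at `z` may
  -- be replaced by that at `w`; for `γ = 0` the second term disappears.
  have hsplit : kernel n γ i ζ z - kernel n γ i ζ w =
      ((‖z‖ ^ γ * ‖ζ‖ ^ (-γ) : ℝ) : ℂ) * (g u - g v) -
        (((‖w‖ ^ γ - ‖z‖ ^ γ) * ‖ζ‖ ^ (-γ) : ℝ) : ℂ) * g v := by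
    rw [hk, hk]
    push_cast
    ring
  have hzwγ : ‖z‖ ^ γ ≤ ‖w‖ ^ γ := sub_nonneg.1 hpow0
  have hζγ : 0 ≤ ‖ζ‖ ^ (-γ) := by positivity
  have hfirst : ‖z‖ ^ γ * ‖ζ‖ ^ (-γ) * ‖g u - g v‖ ≤ ‖z - w‖ ^ β * ((m + 1) *
      (‖z‖ ^ γ * ‖ζ‖ ^ (-γ) * ‖u‖ ^ (1 - β - (m : ℝ)) +
        ‖w‖ ^ γ * ‖ζ‖ ^ (-γ) * ‖v‖ ^ (1 - β - (m : ℝ)))) := by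
    calc ‖z‖ ^ γ * ‖ζ‖ ^ (-γ) * ‖g u - g v‖
        ≤ ‖z‖ ^ γ * ‖ζ‖ ^ (-γ) * ((m + 1) * ‖z - w‖ ^ β *
            (‖u‖ ^ (1 - β - (m : ℝ)) + ‖v‖ ^ (1 - β - (m : ℝ)))) := by gcongr
      _ = ‖z - w‖ ^ β * ((m + 1) * (‖z‖ ^ γ * ‖ζ‖ ^ (-γ) * ‖u‖ ^ (1 - β - (m : ℝ)) +
            ‖z‖ ^ γ * ‖ζ‖ ^ (-γ) * ‖v‖ ^ (1 - β - (m : ℝ)))) := by ring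
      _ ≤ _ := by gcongr
  have hsecond : (‖w‖ ^ γ - ‖z‖ ^ γ) * ‖ζ‖ ^ (-γ) * ‖g v‖ ≤ ‖z - w‖ ^ β *
      if γ = 0 then 0 else
        max 1 γ * (‖w‖ ^ (γ - β) * ‖ζ‖ ^ (-γ) * ‖v‖ ^ (1 - (m : ℝ))) := by
    have h1 : (‖w‖ ^ γ - ‖z‖ ^ γ) * ‖ζ‖ ^ (-γ) * ‖g v‖ ≤
        (if γ = 0 then 0 else max 1 γ * ‖z - w‖ ^ β * ‖w‖ ^ (γ - β)) * ‖ζ‖ ^ (-γ) *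
          ‖v‖ ^ (1 - (m : ℝ)) := by
      have h2 := hpow0.trans hpow
      exact mul_le_mul (mul_le_mul_of_nonneg_right hpow hζγ) hgv (norm_nonneg _)
        (mul_nonneg h2 hζγ)
    refine h1.trans (le_of_eq ?_)
    split_ifs
    · ring
    · ring
  rw [hsplit, mul_add]
  refine (norm_sub_le _ _).trans (add_le_add ?_ ?_)
  · rw [norm_mul, Complex.norm_real, Real.norm_of_nonneg (by positivity)]
    exact hfirst
  · rw [norm_mul, Complex.norm_real, Real.norm_of_nonneg (mul_nonneg hpow0 hζγ)]
    exact hsecond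

end Kernel


open Set Filter Topology Metric

/-! ### The kernel as a Hölder map into `L¹` -/

section IntegratedKernel

variable {N n : ℕ} {μ : Measure (CSpace N)} [IsFiniteMeasure μ] {C : ℝ≥0} {γ : ℝ}

theorem exists_lintegral_kernel_le (hn : n ≠ 0)
    (hC : ∀ (w : CSpace N) {r : ℝ}, 0 ≤ r → μ (ball w r) ≤ C * ENNReal.ofReal (r ^ (2 * n)))
    (hγ0 : 0 ≤ γ) (hγ : γ < (2 * n : ℕ)) (i : Fin N) (R : ℝ) :
    ∃ A : ℝ≥0, ∀ z : CSpace N, ‖z‖ ≤ R → ∫⁻ ζ, ‖kernel n γ i ζ z‖ₑ ∂μ ≤ A := by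
  have hm : 2 * n ≠ 0 := by positivity
  have hna := nullSingletonClass_of_measure_ball_le hm hC
  obtain ⟨A, hA⟩ := exists_lintegral_weighted_le hm hC (a := 0) (s := 1) le_rfl hγ0 hγ
    zero_lt_one le_rfl R
  refine ⟨A, fun z hz => le_trans (lintegral_mono_ae ?_) (hA z hz)⟩
  filter_upwards [compl_mem_ae_iff.2 (measure_singleton z)] with ζ hζ
  rw [← ofReal_norm, sub_zero]
  exact ENNReal.ofReal_le_ofReal (norm_kernel_le hζ)

/-- Moving the pole costs `β` orders of the potential (`a = 0`, `s = 1 - β`), while moving the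
weight costs `β` powers of `‖w‖` (`a = β`, `s = 1`). The latter requires `β ≤ γ`, unless `γ = 0` and
there is no weight. -/
theorem exists_lintegral_kernel_sub_le (hn : n ≠ 0)
    (hC : ∀ (w : CSpace N) {r : ℝ}, 0 ≤ r → μ (ball w r) ≤ C * ENNReal.ofReal (r ^ (2 * n)))
    (hγ0 : 0 ≤ γ) (hγ : γ < (2 * n : ℕ)) (i : Fin N) (R : ℝ) {β : ℝ} (hβ0 : 0 ≤ β)
    (hβ1 : β < 1) (hγβ : γ = 0 ∨ β ≤ γ) :
    ∃ B : ℝ≥0, ∀ z w : CSpace N, ‖z‖ ≤ R → ‖w‖ ≤ R →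
      ∫⁻ ζ, ‖kernel n γ i ζ z - kernel n γ i ζ w‖ₑ ∂μ ≤ B * ENNReal.ofReal (‖z - w‖ ^ β) := by
  have hm : 2 * n ≠ 0 := by positivity
  have hna := nullSingletonClass_of_measure_ball_le hm hC
  obtain ⟨A₁, hA₁⟩ := exists_lintegral_weighted_le hm hC (a := 0) (s := 1 - β) le_rfl hγ0 hγ
    (by linarith) (by linarith) R
  obtain ⟨A₂, hA₂⟩ : ∃ A : ℝ≥0, ∀ w : CSpace N, ‖w‖ ≤ R → ∫⁻ ζ, ENNReal.ofReal
      (if γ = 0 then 0 else max 1 γ * (‖w‖ ^ (γ - β) * ‖ζ‖ ^ (-γ) *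
        ‖ζ - w‖ ^ (1 - ((2 * n : ℕ) : ℝ)))) ∂μ ≤ A := by
    by_cases h0 : γ = 0
    · exact ⟨0, fun w _ => by simp [h0]⟩
    obtain ⟨A, hA⟩ := exists_lintegral_weighted_le hm hC (a := β) (s := 1) hβ0
      (hγβ.resolve_left h0) hγ hβ1 le_rfl R
    refine ⟨(max 1 γ).toNNReal * A, fun w hw => ?_⟩
    simp only [if_neg h0]
    have hM : (0 : ℝ) ≤ max 1 γ := by positivity
    simp_rw [ENNReal.ofReal_mul hM]
    rw [lintegral_const_mul' _ _ ENNReal.ofReal_ne_top, ENNReal.coe_mul]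
    exact mul_le_mul_right (hA w hw) _
  set c : ℝ := ((2 * n : ℕ) : ℝ) + 1 with hc
  have hc0 : 0 ≤ c := by positivity
  have key : ∀ z w : CSpace N, ‖z‖ ≤ R → ‖w‖ ≤ R → ‖z‖ ≤ ‖w‖ →
      ∫⁻ ζ, ‖kernel n γ i ζ z - kernel n γ i ζ w‖ₑ ∂μ ≤
        (c.toNNReal * (A₁ + A₁) + A₂ : ℝ≥0) * ENNReal.ofReal (‖z - w‖ ^ β) := by
    intro z w hz hw hzw
    set F : CSpace N → CSpace N → ℝ≥0∞ := fun w ζ => ENNReal.ofReal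
      (‖w‖ ^ (γ - 0) * ‖ζ‖ ^ (-γ) * ‖ζ - w‖ ^ (1 - β - ((2 * n : ℕ) : ℝ))) with hF
    have hFm : ∀ w, Measurable (F w) := fun w => by
      simp only [hF]
      fun_prop
    set G : CSpace N → ℝ≥0∞ := fun ζ => ENNReal.ofReal
      (if γ = 0 then 0 else max 1 γ * (‖w‖ ^ (γ - β) * ‖ζ‖ ^ (-γ) *
        ‖ζ - w‖ ^ (1 - ((2 * n : ℕ) : ℝ)))) with hG
    calc ∫⁻ ζ, ‖kernel n γ i ζ z - kernel n γ i ζ w‖ₑ ∂μ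
        ≤ ∫⁻ ζ, ENNReal.ofReal (‖z - w‖ ^ β) * (ENNReal.ofReal c * (F z ζ + F w ζ) + G ζ) ∂μ := by
          refine lintegral_mono_ae ?_
          filter_upwards [compl_mem_ae_iff.2 (measure_singleton z),
            compl_mem_ae_iff.2 (measure_singleton w)] with ζ hζz hζw
          rw [← ofReal_norm]
          refine (ENNReal.ofReal_le_ofReal
            (norm_kernel_sub_le hn hγ0 hζz hζw hzw hβ0 hβ1.le)).trans ?_
          rw [ENNReal.ofReal_mul (by positivity)]
          refine mul_le_mul_right ?_ _
          refine ENNReal.ofReal_add_le.trans (add_le_add_left ?_ _)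
          rw [ENNReal.ofReal_mul (by positivity)]
          refine mul_le_mul_right ?_ _
          simp only [hF, sub_zero]
          exact ENNReal.ofReal_add_le
      _ = ENNReal.ofReal (‖z - w‖ ^ β) * (ENNReal.ofReal c *
            (∫⁻ ζ, F z ζ ∂μ + ∫⁻ ζ, F w ζ ∂μ) + ∫⁻ ζ, G ζ ∂μ) := by
          rw [lintegral_const_mul' _ _ ENNReal.ofReal_ne_top,
            lintegral_add_left (f := fun ζ => ENNReal.ofReal c * (F z ζ + F w ζ))
              (((hFm z).add (hFm w)).const_mul _),
            lintegral_const_mul' _ _ ENNReal.ofReal_ne_top, lintegral_add_left (hFm z)]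
      _ ≤ ENNReal.ofReal (‖z - w‖ ^ β) * (ENNReal.ofReal c * (A₁ + A₁) + A₂) := by
          gcongr
          · exact hA₁ z hz
          · exact hA₁ w hw
          · exact hA₂ w hw
      _ = _ := by
          rw [mul_comm]
          push_cast
          rfl
  refine ⟨c.toNNReal * (A₁ + A₁) + A₂, fun z w hz hw => ?_⟩
  rcases le_total ‖z‖ ‖w‖ with h | h
  · exact key z w hz hw h
  · simp_rw [fun ζ => enorm_sub_rev (kernel n γ i ζ z), norm_sub_rev z w]
    exact key w z hw hz h

end IntegratedKernel


open Set Filter Topology Metric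

/-! ### Compact embedding of Hölder spaces and integral operators -/

section HolderSpaceCompactness

variable {S : Type} [MetricSpace S] {α : ℝ≥0}

theorem holderWith_of_dist_le {C : ℝ≥0} {g : S → ℂ}
    (h : ∀ x y, ‖g x - g y‖ ≤ C * dist x y ^ (α : ℝ)) : HolderWith C α g := by
  intro x y
  rw [edist_dist, edist_dist, dist_eq_norm, ENNReal.ofReal_rpow_of_nonneg dist_nonneg α.coe_nonneg,
    ← ENNReal.ofReal_coe_nnreal, ← ENNReal.ofReal_mul C.coe_nonneg]
  exact ENNReal.ofReal_le_ofReal (h x y)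

theorem norm_sub_le_interpolate {β : ℝ} (hαβ : α < β) {A B : ℝ≥0} {g : S → ℂ}
    (hA : ∀ x, ‖g x‖ ≤ A) (hB : ∀ x y, ‖g x - g y‖ ≤ B * dist x y ^ β) (x y : S) :
    ‖g x - g y‖ ≤ (B ^ (α / β) * (2 * A) ^ (1 - α / β) : ℝ≥0) * dist x y ^ (α : ℝ) := by
  have hβ : 0 < β := α.coe_nonneg.trans_lt hαβ
  have hθ : 0 ≤ α / β := by positivity
  have hθ1 : 0 ≤ 1 - α / β := by
    rw [sub_nonneg, div_le_one hβ]
    exact hαβ.le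
  have h2 : ‖g x - g y‖ ≤ 2 * A := (norm_sub_le _ _).trans (by linarith [hA x, hA y])
  have h0 := norm_nonneg (g x - g y)
  have hd : (0 : ℝ) ≤ dist x y := dist_nonneg
  calc ‖g x - g y‖ = ‖g x - g y‖ ^ (α / β) * ‖g x - g y‖ ^ (1 - α / β) := by
        rw [← Real.rpow_add_of_nonneg h0 hθ hθ1, add_sub_cancel, Real.rpow_one]
    _ ≤ (B * dist x y ^ β) ^ (α / β) * (2 * A) ^ (1 - α / β) := by
        gcongr
        exact hB x y
    _ = _ := by
        rw [Real.mul_rpow B.coe_nonneg (by positivity), ← Real.rpow_mul hd,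
          mul_div_cancel₀ _ hβ.ne']
        push_cast
        ring

namespace HolderSpace

theorem ext_apply {F G : HolderSpace α S} (h : ∀ x, F x = G x) : F = G :=
  Subtype.ext (BoundedContinuousFunction.ext h)

theorem exists_apply_eq {β : ℝ} (hαβ : α < β) {A B : ℝ≥0} {g : S → ℂ}
    (hA : ∀ x, ‖g x‖ ≤ A) (hB : ∀ x y, ‖g x - g y‖ ≤ B * dist x y ^ β) :
    ∃ F : HolderSpace α S, ∀ x, F x = g x := by
  have hβ : 0 < β := α.coe_nonneg.trans_lt hαβ
  have hcont : Continuous g :=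
    (holderWith_of_dist_le (α := ⟨β, hβ.le⟩) (g := g) hB).continuous hβ
  exact ⟨⟨BoundedContinuousFunction.ofNormedAddCommGroup g hcont A hA,
    (holderWith_of_dist_le (norm_sub_le_interpolate hαβ hA hB)).memHolder⟩, fun x => rfl⟩

theorem norm_le_interpolate {β : ℝ} (hαβ : α < β) {A B : ℝ≥0} {F : HolderSpace α S}
    (hA : ∀ x, ‖F x‖ ≤ A) (hB : ∀ x y, ‖F x - F y‖ ≤ B * dist x y ^ β) :
    ‖F‖ ≤ A + (B ^ (α / β) * (2 * A) ^ (1 - α / β) : ℝ≥0) := by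
  rw [norm_def]
  exact add_le_add ((BoundedContinuousFunction.norm_le A.coe_nonneg).2 hA)
    (NNReal.coe_le_coe.2
      (holderWith_of_dist_le (norm_sub_le_interpolate hαβ hA hB)).nnholderNorm_le)

/-- Arzelà–Ascoli gives compactness in the supremum norm. On a `β`-Hölder bounded set the inclusion
into `C^α` is continuous for that norm, so compactness carries over. -/
theorem isCompact_setOf_holder [CompactSpace S] {β : ℝ} (hαβ : α < β) (A B : ℝ≥0) :
    IsCompact {F : HolderSpace α S | (∀ x, ‖F x‖ ≤ A) ∧
      ∀ x y, ‖F x - F y‖ ≤ B * dist x y ^ β} := by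
  have hβ : 0 < β := α.coe_nonneg.trans_lt hαβ
  have hθ1 : 0 < 1 - α / β := by
    rw [sub_pos, div_lt_one hβ]
    exact hαβ
  set Q : Set (S →ᵇ ℂ) := {g | (∀ x, ‖g x‖ ≤ A) ∧ ∀ x y, ‖g x - g y‖ ≤ B * dist x y ^ β} with hQ
  have hev : ∀ x : S, Continuous fun g : S →ᵇ ℂ => g x := fun x =>
    continuous_eval_const x
  have hQc : IsCompact Q := by
    refine BoundedContinuousFunction.arzela_ascoli₂ (closedBall 0 A) (isCompact_closedBall _ _) Q
      ?_ (fun g x hg => by simpa using hg.1 x) ?_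
    · have : Q = (⋂ x, {g | ‖g x‖ ≤ A}) ∩ ⋂ x, ⋂ y, {g | ‖g x - g y‖ ≤ B * dist x y ^ β} := by
        ext g
        simp [hQ]
      rw [this]
      exact (isClosed_iInter fun x => isClosed_le (hev x).norm continuous_const).inter
        (isClosed_iInter fun x => isClosed_iInter fun y =>
          isClosed_le ((hev x).sub (hev y)).norm continuous_const)
    · refine Metric.equicontinuous_of_continuity_modulus (fun t => B * t ^ β) ?_ _
        fun x y g => ?_
      · have h := ((Real.continuousAt_rpow_const 0 β (Or.inr hβ.le)).tendsto).const_mul (B : ℝ)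
        rwa [Real.zero_rpow hβ.ne', mul_zero] at h
      · rw [dist_eq_norm]
        exact g.2.2 x y
  choose j hj using fun g : Q => exists_apply_eq hαβ g.2.1 g.2.2
  have : CompactSpace Q := isCompact_iff_compactSpace.1 hQc
  have hjc : Continuous j := by
    rw [continuous_iff_continuousAt]
    intro g₀
    rw [ContinuousAt, tendsto_iff_dist_tendsto_zero]
    -- A difference of two elements has `β`-seminorm at most `2 * B`; interpolation against its
    -- supremum norm makes the `α`-seminorm small, since `1 - α / β > 0`.
    have hle : ∀ g : Q, dist (j g) (j g₀) ≤ nndist g g₀ +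
        ((2 * B) ^ (α / β) * (2 * nndist g g₀) ^ (1 - α / β) : ℝ≥0) := by
      intro g
      rw [dist_eq_norm]
      have hsub : ∀ x, (j g - j g₀) x = g.1 x - g₀.1 x := fun x => by
        rw [← hj, ← hj]
        rfl
      refine norm_le_interpolate hαβ (fun x => ?_) fun x y => ?_
      · rw [hsub, ← dist_eq_norm]
        exact BoundedContinuousFunction.dist_coe_le_dist x
      · rw [hsub, hsub, sub_sub_sub_comm]
        refine (norm_sub_le _ _).trans ?_
        have h1 := g.2.2 x y
        have h2 := g₀.2.2 x y
        push_cast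
        linarith
    refine squeeze_zero (fun _ => dist_nonneg) hle ?_
    have hlim : Tendsto (fun t : ℝ≥0 => t + (2 * B) ^ (α / β) * (2 * t) ^ (1 - α / β)) (𝓝 0)
        (𝓝 (0 + (2 * B) ^ (α / β) * (2 * 0) ^ (1 - α / β))) := by
      refine Continuous.tendsto ?_ 0
      exact continuous_id.add (continuous_const.mul
        ((NNReal.continuous_rpow_const hθ1.le).comp (continuous_const.mul continuous_id)))
    rw [mul_zero, NNReal.zero_rpow hθ1.ne', mul_zero, add_zero] at hlim
    have hnn : Tendsto (fun g : Q => nndist g g₀) (𝓝 g₀) (𝓝 0) := by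
      have h := (continuous_id.nndist continuous_const : Continuous fun g : Q => nndist g g₀).tendsto g₀
      rwa [show nndist (id g₀) g₀ = 0 from nndist_self g₀] at h
    exact NNReal.tendsto_coe.2 (hlim.comp hnn)
  convert isCompact_range hjc
  ext F
  constructor
  · intro hF
    exact ⟨⟨F.toBCF, hF⟩, ext_apply (hj _)⟩
  · rintro ⟨g, rfl⟩
    refine ⟨fun x => ?_, fun x y => ?_⟩
    · rw [hj]
      exact g.2.1 x
    · rw [hj, hj]
      exact g.2.2 x y

theorem holderWith_comp_isometry {S' : Type} [MetricSpace S'] {ι : S' → S} (hι : Isometry ι)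
    (F : HolderSpace α S) : HolderWith (nnHolderNorm α (F.toBCF : S → ℂ)) α (F.toBCF ∘ ι) := by
  intro x y
  rw [← hι.edist_eq]
  exact F.memHolder.holderWith (ι x) (ι y)

/-- Pull-back of Hölder functions along an isometry. -/
noncomputable def compIsometry {S' : Type} [MetricSpace S'] (ι : S' → S) (hι : Isometry ι) :
    HolderSpace α S →L[ℂ] HolderSpace α S' :=
  LinearMap.mkContinuous
    { toFun := fun F => ⟨F.toBCF.compContinuous ⟨ι, hι.continuous⟩,
        (holderWith_comp_isometry hι F).memHolder⟩
      map_add' := fun _ _ => rfl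
      map_smul' := fun _ _ => rfl } 1 fun F => by
    rw [one_mul, norm_def, norm_def]
    exact add_le_add ((BoundedContinuousFunction.norm_le (norm_nonneg _)).2
      fun x => F.toBCF.norm_coe_le_norm (ι x))
      (NNReal.coe_le_coe.2 (holderWith_comp_isometry hι F).nnholderNorm_le)

end HolderSpace

section IntegralOperator

variable {Ω : Type*} [MeasurableSpace Ω] {μ : Measure Ω} {k : Ω → S → ℂ}

theorem norm_coe_le_of_Lp_top (f : Lp ℂ ∞ μ) : ∀ᵐ ζ ∂μ, ‖f ζ‖ ≤ ‖f‖ := by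
  rw [Lp.norm_def, eLpNorm_exponent_top]
  filter_upwards [ae_le_eLpNormEssSup (f := f) (μ := μ)] with ζ hζ
  have h := (Lp.memLp f).eLpNorm_ne_top
  rw [eLpNorm_exponent_top] at h
  simpa using ENNReal.toReal_mono h hζ

theorem enorm_integral_mul_le (f : Lp ℂ ∞ μ) (g : Ω → ℂ) :
    ‖∫ ζ, f ζ * g ζ ∂μ‖ₑ ≤ ‖f‖ₑ * ∫⁻ ζ, ‖g ζ‖ₑ ∂μ := by
  refine (enorm_integral_le_lintegral_enorm _).trans ?_
  rw [← lintegral_const_mul' _ _ enorm_ne_top]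
  refine lintegral_mono_ae ?_
  filter_upwards [norm_coe_le_of_Lp_top f] with ζ hζ
  rw [enorm_mul]
  gcongr
  exact enorm_le_iff_norm_le.2 (by simpa using hζ)

theorem integrable_mul_of_Lp_top (f : Lp ℂ ∞ μ) {g : Ω → ℂ} (hg : Integrable g μ) :
    Integrable (fun ζ => f ζ * g ζ) μ :=
  hg.bdd_mul (Lp.aestronglyMeasurable f) (norm_coe_le_of_Lp_top f)

/-- An integral operator whose kernel is bounded in `L¹` and `β`-Hölder as an `L¹`-valued map on a
compact metric space is compact from `L^∞` to the Hölder functions of any exponent `α < β`. -/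
theorem exists_isCompactOperator_integral [CompactSpace S] {β : ℝ} (hαβ : α < β) {A B : ℝ≥0}
    (hk : ∀ z, AEStronglyMeasurable (fun ζ => k ζ z) μ)
    (hA : ∀ z, ∫⁻ ζ, ‖k ζ z‖ₑ ∂μ ≤ A)
    (hB : ∀ z w, ∫⁻ ζ, ‖k ζ z - k ζ w‖ₑ ∂μ ≤ B * ENNReal.ofReal (dist z w ^ β)) :
    ∃ T : Lp ℂ ∞ μ →L[ℂ] HolderSpace α S, IsCompactOperator T ∧
      ∀ (f : Lp ℂ ∞ μ) (z : S), Integrable (fun ζ => f ζ * k ζ z) μ ∧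
        T f z = ∫ ζ, f ζ * k ζ z ∂μ := by
  have hint : ∀ z, Integrable (fun ζ => k ζ z) μ := fun z =>
    ⟨hk z, (hA z).trans_lt ENNReal.coe_lt_top⟩
  have hfint : ∀ (f : Lp ℂ ∞ μ) z, Integrable (fun ζ => f ζ * k ζ z) μ := fun f z =>
    integrable_mul_of_Lp_top f (hint z)
  have h1 : ∀ (f : Lp ℂ ∞ μ) z, ‖∫ ζ, f ζ * k ζ z ∂μ‖ ≤ (‖f‖₊ * A : ℝ≥0) := by
    intro f z
    have h : ‖∫ ζ, f ζ * k ζ z ∂μ‖ₑ ≤ (‖f‖₊ * A : ℝ≥0) := by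
      refine (enorm_integral_mul_le f _).trans ?_
      rw [ENNReal.coe_mul]
      exact mul_le_mul_right (hA z) _
    exact_mod_cast h
  have h2 : ∀ (f : Lp ℂ ∞ μ) z w, ‖∫ ζ, f ζ * k ζ z ∂μ - ∫ ζ, f ζ * k ζ w ∂μ‖ ≤
      (‖f‖₊ * B : ℝ≥0) * dist z w ^ β := by
    intro f z w
    rw [← integral_sub (hfint f z) (hfint f w)]
    simp_rw [← mul_sub]
    have h : ‖∫ ζ, f ζ * (k ζ z - k ζ w) ∂μ‖ₑ ≤
        ENNReal.ofReal ((‖f‖₊ * B : ℝ≥0) * dist z w ^ β) := by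
      refine (enorm_integral_mul_le f _).trans ?_
      rw [ENNReal.ofReal_mul (NNReal.coe_nonneg _), ENNReal.ofReal_coe_nnreal, ENNReal.coe_mul,
        mul_assoc]
      exact mul_le_mul_right (hB z w) _
    rw [← ofReal_norm] at h
    exact (ENNReal.ofReal_le_ofReal_iff (by positivity)).1 h
  choose T hT using fun f => HolderSpace.exists_apply_eq hαβ (h1 f) (h2 f)
  let L : Lp ℂ ∞ μ →ₗ[ℂ] HolderSpace α S :=
    { toFun := T
      map_add' := fun f g => HolderSpace.ext_apply fun z => by
        change T (f + g) z = T f z + T g z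
        rw [hT, hT, hT, ← integral_add (hfint f z) (hfint g z)]
        refine integral_congr_ae ?_
        filter_upwards [Lp.coeFn_add f g] with ζ hζ
        rw [hζ, Pi.add_apply, add_mul]
      map_smul' := fun c f => HolderSpace.ext_apply fun z => by
        change T (c • f) z = c * T f z
        rw [hT, hT, ← integral_const_mul]
        refine integral_congr_ae ?_
        filter_upwards [Lp.coeFn_smul c f] with ζ hζ
        rw [hζ, Pi.smul_apply, smul_eq_mul, mul_assoc] }
  have hL : IsCompactOperator L := by
    -- Only compactness has to be shown; continuity of `T` follows from it.
    refine (isCompactOperator_iff_image_closedBall_subset_compact L one_pos).2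
      ⟨_, HolderSpace.isCompact_setOf_holder hαβ A B, ?_⟩
    rintro _ ⟨f, hf, rfl⟩
    have hf1 : ‖f‖₊ ≤ 1 := by simpa [← NNReal.coe_le_coe] using hf
    refine ⟨fun z => ?_, fun z w => ?_⟩
    · change ‖T f z‖ ≤ A
      rw [hT]
      exact (h1 f z).trans (NNReal.coe_le_coe.2 (mul_le_of_le_one_left' hf1))
    · change ‖T f z - T f w‖ ≤ _
      rw [hT, hT]
      refine (h2 f z w).trans ?_
      gcongr
      exact mul_le_of_le_one_left' hf1
  exact ⟨ContinuousLinearMap.mkOfIsCompactOperator hL, hL, fun f z => ⟨hfint f z, hT f z⟩⟩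

end IntegralOperator

end HolderSpaceCompactness


open Set Filter Topology Metric

theorem IsPureDim.isFiniteMeasure_volX_restrict {N n : ℕ} {X D : Set (CSpace N)}
    (hX : IsPureDim n X) (hD : IsRelCompactOpen X D) :
    IsFiniteMeasure ((volX n X).restrict D) := by
  obtain ⟨C, hC⟩ := hX.exists_volume_bound hD
  obtain ⟨R, hR⟩ := (hD.isCompact_closure.isBounded.subset _root_.subset_closure).subset_ball
    (0 : CSpace N)
  refine ⟨?_⟩
  have hle : volX n X D ≤ (volX n X).restrict D (ball 0 (max R 0)) := by
    rw [Measure.restrict_apply measurableSet_ball,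
      inter_eq_self_of_subset_right (hR.trans (ball_subset_ball (le_max_left _ _)))]
  rw [Measure.restrict_apply_univ]
  exact (hle.trans (hC 0 (le_max_right _ _))).trans_lt
    (ENNReal.mul_lt_top ENNReal.coe_lt_top ENNReal.ofReal_lt_top)

theorem exists_exponent_between {α γ : ℝ} (hα : α < 1) (hγα : γ = 0 ∨ α < γ) :
    ∃ β, α < β ∧ β < 1 ∧ (γ = 0 ∨ β ≤ γ) := by
  rcases hγα with h | h
  · obtain ⟨β, h1, h2⟩ := exists_between hα
    exact ⟨β, h1, h2, Or.inl h⟩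
  · obtain ⟨β, h1, h2⟩ := exists_between (lt_min hα h)
    exact ⟨β, h1, h2.trans_le (min_le_left _ _), Or.inr (h2.trans_le (min_le_right _ _)).le⟩

end AnalyticVariety

open AnalyticVariety in
theorem theorem4p3 (N n : ℕ) (X D : Set (CSpace N)) (hX : IsPureDim n X)
    (hD : IsRelCompactOpen X D) (γ : ℝ) (hγ0 : 0 ≤ γ) (hγ : γ < 2 * (n : ℝ)) (i : Fin N)
    (α : ℝ≥0) (hα : α < 1) (hγα : γ = 0 ∨ (α : ℝ) < γ) :
    ∃ T : Lp ℂ ∞ ((volX n X).restrict D) →L[ℂ] HolderSpace α D,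
      IsCompactOperator T ∧
      ∀ (f : Lp ℂ ∞ ((volX n X).restrict D)) (z : D),
        Integrable (fun ζ => f ζ * kernel n γ i ζ z) ((volX n X).restrict D) ∧
        T f z = ∫ ζ in D, f ζ * kernel n γ i ζ z ∂(volX n X) := by
  have hn : n ≠ 0 := by
    rintro rfl
    simp only [CharP.cast_eq_zero, mul_zero] at hγ
    exact absurd hγ0 hγ.not_ge
  have hγ' : γ < (2 * n : ℕ) := by exact_mod_cast hγ
  have := hX.isFiniteMeasure_volX_restrict hD
  obtain ⟨C, hC⟩ := hX.exists_volume_bound hD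
  obtain ⟨R, hR⟩ := hD.isCompact_closure.isBounded.exists_norm_le
  obtain ⟨β, hαβ, hβ1, hγβ⟩ := exists_exponent_between (NNReal.coe_lt_one.2 hα) hγα
  obtain ⟨A, hA⟩ := exists_lintegral_kernel_le hn hC hγ0 hγ' i R
  obtain ⟨B, hB⟩ := exists_lintegral_kernel_sub_le hn hC hγ0 hγ' i R
    (α.coe_nonneg.trans hαβ.le) hβ1 hγβ
  -- Arzelà–Ascoli needs a compact domain, so the operator is built with `z` ranging over `closure
  -- D` and then restricted to `D`; the integration stays over `D`.
  have : CompactSpace (closure D) := isCompact_iff_compactSpace.1 hD.isCompact_closure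
  obtain ⟨T, hT, hTf⟩ := exists_isCompactOperator_integral (μ := (volX n X).restrict D)
    (S := closure D) (k := fun ζ z => kernel n γ i ζ z) hαβ
    (fun z => (measurable_kernel (z : CSpace N)).aestronglyMeasurable)
    (fun z => hA z (hR z z.2)) fun z w => by
      rw [Subtype.dist_eq, dist_eq_norm]
      exact hB z w (hR z z.2) (hR w w.2)
  have hι : Isometry (Set.inclusion (subset_closure : D ⊆ closure D)) := fun _ _ => rfl
  exact ⟨(HolderSpace.compIsometry _ hι).comp T, hT.clm_comp (HolderSpace.compIsometry _ hι),
    fun f z => hTf f (Set.inclusion subset_closure z)⟩
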